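/- Let $\mathbb k$ be a field of characteristic $0$ and let $R$ be a complete local Noetherian commutative $\mathbb k$-algebra with maximal ideal $\mathfrak m$ and residue field $\mathbb k$. For a vector space $V$ put $V\widehat\otimes R=\varprojlim_N V\otimes R/\mathfrak m^N$; convergence is $\mathfrak m$-adic (pointwise for maps). For a $\mathbb Z$-graded vector space $U$ let $S(U)=\bigoplus_n S^n(U)$ be the graded symmetric algebra with its standard bialgebra structure $(\mu,\delta)$ (elements of $U$ are primitive), counit $\epsilon$ and unit $\eta$. For graded vector spaces $A,B$ let $\mathrm{Lin}^0_R(S(A),S(B))$ be the set of continuous degree-$0$ $R$-linear maps $h:S(A)\widehat\otimes R\to S(B)\widehat\otimes R$ with $h(1)\in S(B)\widehat\otimes\mathfrak m$. With powers taken for the convolution product $h\star h'=\mu(h\otimes h')\delta$, with unit $\mathsf e=\eta\epsilon$, put $\exp(h)=\mathsf e+h+h^2/2!+\cdots$ and $\log(\mathsf e+h)=h-h^2/2+h^3/3-\cdots$. The $\binom nm$-component $h^m_n:S^n(A)\to S^m(B)\widehat\otimes R$ of $h$ is its restriction to $S^n(A)$ followed by the projection onto $S^m(B)\widehat\otimes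 R$; $R$-linear extensions are denoted by the same symbols. For non-negative integers $a_1,\dots,a_k$ with sum $n$, an $(a_1,\dots,a_k)$-unshuffle is a permutation of $\{1,\dots,n\}$ that is increasing on each of the consecutive segments of lengths $a_1,\dots,a_k$; $\varepsilon(\sigma)$ denotes the Koszul sign, $u_1\odot\cdots\odot u_n=\varepsilon(\sigma)\,u_{\sigma(1)}\odot\cdots\odot u_{\sigma(n)}$. For $k,l\ge1$ and $j_1+\dots+j_k=s_1+\dots+s_l=r$, an $(s_1,\dots,s_l)$-unshuffle $\kappa$ of $r$ elements is called connected if the following graph is connected: it has upper vertices $1,\dots,l$ and lower vertices $1,\dots,k$, and $b$ (upper) is joined to $a$ (lower) iff $\kappa$ maps some element of the $b$-th segment of $\{1,\dots,r\}=\{1,\dots,s_1\}\cup\cdots\cup\{r-s_l+1,\dots,r\}$ into the $a$-th segment of $\{1,\dots,r\}=\{1,\dots,j_1\}\cup\cdots\cup\{r-j_k+1,\dots,r\}$. Let $${}^1\Psi^{s_1,\dots,s_l}_{j_1,\dots,j_k}:S^{j_1}(U'')\otimes\cdots\otimes S^{j_k}(U'')\to S^{s_1}(U'')\otimes\cdots\otimes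 S^{s_l}(U'')$$ be the linear map with $$(u_1\odot\cdots\odot u_{j_1})\otimes\cdots\otimes(u_{r-j_k+1}\odot\cdots\odot u_r)\mapsto\sum_{\kappa\text{ connected}}\varepsilon(\kappa)\,(u_{\kappa(1)}\odot\cdots\odot u_{\kappa(s_1)})\otimes\cdots\otimes(u_{\kappa(r-s_l+1)}\odot\cdots\odot u_{\kappa(r)})$$ for homogeneous $u_1,\dots,u_r\in U''$, the sum running over the connected $(s_1,\dots,s_l)$-unshuffles $\kappa$. **Theorem.** Let $U',U'',U'''$ be graded vector spaces, $g\in\mathrm{Lin}^0_R(S(U'),S(U''))$ and $f\in\mathrm{Lin}^0_R(S(U''),S(U'''))$. Then the maps ${}^1\Psi$ are well defined, the series defining $\exp(f)$, $\exp(g)$ and $f\diamond g:=\log(\exp(f)\circ\exp(g))$ converge, $f\diamond g\in\mathrm{Lin}^0_R(S(U'),S(U'''))$, and for all $m,n>0$ and all homogeneous $u_1,\dots,u_n\in U'$ $$(f\diamond g)^m_n(u_1\odot\cdots\odot u_n)=\sum\frac{\varepsilon(\sigma)}{k!\,l!}\,\mu^{[l-1]}\big(f^{t_1}_{s_1}\otimes\cdots\otimes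 f^{t_l}_{s_l}\big)\,{}^1\Psi^{s_1,\dots,s_l}_{j_1,\dots,j_k}\,\big(g^{j_1}_{i_1}\otimes\cdots\otimes g^{j_k}_{i_k}\big)\Big((u_{\sigma(1)}\odot\cdots\odot u_{\sigma(i_1)})\otimes\cdots\otimes(u_{\sigma(n-i_k+1)}\odot\cdots\odot u_{\sigma(n)})\Big),$$ where $\mu^{[l-1]}$ is the iterated multiplication and the ($\mathfrak m$-adically unconditionally convergent) sum runs over all $k,l\ge1$, all non-negative integers with $i_1+\cdots+i_k=n$, $t_1+\cdots+t_l=m$, $j_1+\cdots+j_k=s_1+\cdots+s_l$, and all $(i_1,\dots,i_k)$-unshuffles $\sigma$. -/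

import Mathlib

open IsLocalRing
open scoped TensorProduct

noncomputable section

namespace MVComp

/-! ## The completed tensor product `V ⊗̂ R` -/

section Completion

variable (𝕜 R : Type*) [Field 𝕜] [CommRing R] [IsLocalRing R] [Algebra 𝕜 R]

/-- `V ⊗̂ R = lim_N (V ⊗ R) / 𝔪^N (V ⊗ R)`, where `𝔪` is the maximal ideal of `R`
(the scalars are written on the left). -/
abbrev Cpl (V : Type*) [AddCommGroup V] [Module 𝕜 V] : Type _ :=
  AdicCompletion (maximalIdeal R) (R ⊗[𝕜] V)

/-- The `𝔪`-adic filtration `𝔪^N (V ⊗̂ R)` of `V ⊗̂ R`. -/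
abbrev filt (V : Type*) [AddCommGroup V] [Module 𝕜 V] (N : ℕ) : Submodule R (Cpl 𝕜 R V) :=
  maximalIdeal R ^ N • (⊤ : Submodule R (Cpl 𝕜 R V))

variable {V W Z : Type*} [AddCommGroup V] [Module 𝕜 V] [AddCommGroup W] [Module 𝕜 W]
  [AddCommGroup Z] [Module 𝕜 Z]

/-- The canonical map `V → V ⊗̂ R`. -/
def incl : V →ₗ[𝕜] Cpl 𝕜 R V :=
  (AdicCompletion.of (maximalIdeal R) (R ⊗[𝕜] V)).restrictScalars 𝕜 ∘ₗ
    TensorProduct.mk 𝕜 R V 1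

/-- The `R`-linear extension `V ⊗̂ R → W ⊗̂ R` of a `𝕜`-linear map `V → W`. -/
def baseC (h : V →ₗ[𝕜] W) : Cpl 𝕜 R V →ₗ[R] Cpl 𝕜 R W :=
  (AdicCompletion.map (maximalIdeal R) (h.baseChange R)).restrictScalars R

theorem baseC_incl (h : V →ₗ[𝕜] W) (v : V) : baseC 𝕜 R h (incl 𝕜 R v) = incl 𝕜 R (h v) := by
  change AdicCompletion.map (maximalIdeal R) (h.baseChange R)
    (AdicCompletion.of (maximalIdeal R) (R ⊗[𝕜] V) (1 ⊗ₜ v)) = _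
  rw [AdicCompletion.map_of]
  rfl

variable {𝕜 R}

/-- `R`-linear maps between completed tensor products are automatically continuous for the
`𝔪`-adic topologies, so "continuous `R`-linear map" and "`R`-linear map" agree. -/
theorem filt_le_comap (F : Cpl 𝕜 R V →ₗ[R] Cpl 𝕜 R W) (N : ℕ) :
    filt 𝕜 R V N ≤ (filt 𝕜 R W N).comap F := by
  rw [← Submodule.map_le_iff_le_comap, Submodule.map_smul'']
  exact Submodule.smul_mono le_rfl le_top

/-- Convergence of an unordered series in the `𝔪`-adic topology of `V ⊗̂ R`: modulo every
`𝔪^N`, the finite partial sums eventually agree with `x`. -/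
def AdicHasSum {ι : Type*} (v : ι → Cpl 𝕜 R V) (x : Cpl 𝕜 R V) : Prop :=
  ∀ N : ℕ, ∀ᶠ T in (Filter.atTop : Filter (Finset ι)), ∑ c ∈ T, v c ≡ x [SMOD filt 𝕜 R V N]

/-- Convergence of a series of `R`-linear maps: pointwise, in the `𝔪`-adic topology. -/
def LinHasSum {ι : Type*} (F : ι → (Cpl 𝕜 R V →ₗ[R] Cpl 𝕜 R W))
    (G : Cpl 𝕜 R V →ₗ[R] Cpl 𝕜 R W) : Prop :=
  ∀ x, AdicHasSum (fun c => F c x) (G x)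

open Classical in
/-- The sum of a series of `R`-linear maps (`0` if the series diverges). -/
def linSum {ι : Type*} (F : ι → (Cpl 𝕜 R V →ₗ[R] Cpl 𝕜 R W)) : Cpl 𝕜 R V →ₗ[R] Cpl 𝕜 R W :=
  if h : ∃ G, LinHasSum F G then h.choose else 0

variable [IsNoetherianRing R]

instance cplComplete : IsAdicComplete (maximalIdeal R) (Cpl 𝕜 R V) :=
  AdicCompletion.isAdicComplete (IsNoetherian.noetherian (maximalIdeal R))

/-- An `R`-linear map out of `V ⊗̂ R` is determined by its restriction to `V`. -/
theorem hom_ext {F G : Cpl 𝕜 R V →ₗ[R] Cpl 𝕜 R W}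
    (h : ∀ v : V, F (incl 𝕜 R v) = G (incl 𝕜 R v)) : F = G := by
  have key : ∀ z : R ⊗[𝕜] V, F (AdicCompletion.of (maximalIdeal R) _ z) =
      G (AdicCompletion.of (maximalIdeal R) _ z) := by
    intro z
    induction z using TensorProduct.induction_on with
    | zero => simp
    | tmul r v =>
      have : (r ⊗ₜ[𝕜] v : R ⊗[𝕜] V) = r • (1 ⊗ₜ[𝕜] v) := by
        rw [TensorProduct.smul_tmul', smul_eq_mul, mul_one]
      rw [this, map_smul, map_smul, map_smul]
      exact congrArg (r • ·) (h v)
    | add a b ha hb => rw [map_add, map_add, map_add, ha, hb]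
  refine LinearMap.ext fun x => ?_
  rw [← sub_eq_zero, ← LinearMap.sub_apply]
  refine IsHausdorff.haus (inferInstance : IsHausdorff (maximalIdeal R) (Cpl 𝕜 R W)) _ fun N => ?_
  rw [SModEq.zero]
  obtain ⟨z, hz⟩ := Submodule.mkQ_surjective _ (AdicCompletion.eval (maximalIdeal R) _ N x)
  have hx : x - AdicCompletion.of (maximalIdeal R) _ z ∈ filt 𝕜 R V N := by
    rw [filt, AdicCompletion.pow_smul_top_eq_ker_eval (IsNoetherian.noetherian (maximalIdeal R)),
      LinearMap.mem_ker, map_sub, AdicCompletion.eval_of, hz, sub_self]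
  have h2 := filt_le_comap (F - G) N hx
  rw [Submodule.mem_comap, map_sub, LinearMap.sub_apply _ _ (AdicCompletion.of _ _ z), key,
    sub_self, sub_zero] at h2
  exact h2

/-- Underlying function of `ext`. -/
def extFun (φ : V →ₗ[𝕜] Cpl 𝕜 R W) : Cpl 𝕜 R V →ₗ[R] Cpl 𝕜 R W :=
  (AdicCompletion.ofLinearEquiv (maximalIdeal R) (Cpl 𝕜 R W)).symm.toLinearMap ∘ₗ
    (AdicCompletion.map (maximalIdeal R) (φ.liftBaseChange R)).restrictScalars R

theorem extFun_incl (φ : V →ₗ[𝕜] Cpl 𝕜 R W) (v : V) : extFun φ (incl 𝕜 R v) = φ v := by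
  change (AdicCompletion.ofLinearEquiv (maximalIdeal R) (Cpl 𝕜 R W)).symm
    (AdicCompletion.map (maximalIdeal R) (φ.liftBaseChange R)
      (AdicCompletion.of (maximalIdeal R) (R ⊗[𝕜] V) (1 ⊗ₜ v))) = _
  rw [AdicCompletion.map_of, AdicCompletion.ofLinearEquiv_symm_of]
  simp

/-- The (unique) `R`-linear extension `V ⊗̂ R → W ⊗̂ R` of a `𝕜`-linear map `V → W ⊗̂ R`. -/
def ext : (V →ₗ[𝕜] Cpl 𝕜 R W) →ₗ[R] (Cpl 𝕜 R V →ₗ[R] Cpl 𝕜 R W) where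
  toFun := extFun
  map_add' φ ψ := hom_ext fun v => by simp [extFun_incl]
  map_smul' r φ := hom_ext fun v => by simp [extFun_incl]

theorem ext_incl (φ : V →ₗ[𝕜] Cpl 𝕜 R W) (v : V) : ext φ (incl 𝕜 R v) = φ v :=
  extFun_incl φ v

/-- The `R`-bilinear map `(V ⊗̂ R) × (W ⊗̂ R) → (V ⊗ W) ⊗̂ R` that extends
`(v, w) ↦ v ⊗ w`. -/
def tmulC : Cpl 𝕜 R V →ₗ[R] Cpl 𝕜 R W →ₗ[R] Cpl 𝕜 R (V ⊗[𝕜] W) :=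
  LinearMap.flip
    { toFun := fun y => ext
        { toFun := fun v => ext (incl 𝕜 R ∘ₗ TensorProduct.mk 𝕜 V W v) y
          map_add' := fun v v' => by
            rw [map_add, LinearMap.comp_add, map_add, LinearMap.add_apply]
          map_smul' := fun c v => by
            rw [map_smul, LinearMap.comp_smul, ← algebraMap_smul R c, map_smul,
              LinearMap.smul_apply, algebraMap_smul, RingHom.id_apply] }
      map_add' := fun y y' => hom_ext fun v => by simp [ext_incl]
      map_smul' := fun r y => hom_ext fun v => by simp [ext_incl] }

theorem tmulC_incl (v : V) (w : W) :
    tmulC (incl 𝕜 R v) (incl 𝕜 R w) = incl 𝕜 R (v ⊗ₜ[𝕜] w) := by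
  simp [tmulC, ext_incl]

/-- The `R`-linear extension `h₁ ⊗ h₂ : (V ⊗ V') ⊗̂ R → (W ⊗ W') ⊗̂ R` of the tensor product
of two `R`-linear maps `h₁ : V ⊗̂ R → W ⊗̂ R` and `h₂ : V' ⊗̂ R → W' ⊗̂ R` (no sign: both are
meant to be of degree zero). -/
def tensor₂ {V' W' : Type*} [AddCommGroup V'] [Module 𝕜 V'] [AddCommGroup W'] [Module 𝕜 W']
    (h₁ : Cpl 𝕜 R V →ₗ[R] Cpl 𝕜 R W) (h₂ : Cpl 𝕜 R V' →ₗ[R] Cpl 𝕜 R W') :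
    Cpl 𝕜 R (V ⊗[𝕜] V') →ₗ[R] Cpl 𝕜 R (W ⊗[𝕜] W') :=
  ext <| TensorProduct.lift <| LinearMap.mk₂ 𝕜
    (fun v v' => tmulC (h₁ (incl 𝕜 R v)) (h₂ (incl 𝕜 R v')))
    (fun v₁ v₂ v' => by simp)
    (fun c v v' => by
      rw [map_smul, ← algebraMap_smul R c, map_smul, map_smul, LinearMap.smul_apply,
        algebraMap_smul])
    (fun v v₁ v₂ => by simp)
    (fun c v v' => by
      rw [map_smul, ← algebraMap_smul R c, map_smul, map_smul, algebraMap_smul])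

theorem tensor₂_incl {V' W' : Type*} [AddCommGroup V'] [Module 𝕜 V'] [AddCommGroup W']
    [Module 𝕜 W'] (h₁ : Cpl 𝕜 R V →ₗ[R] Cpl 𝕜 R W) (h₂ : Cpl 𝕜 R V' →ₗ[R] Cpl 𝕜 R W')
    (v : V) (v' : V') : tensor₂ h₁ h₂ (incl 𝕜 R (v ⊗ₜ[𝕜] v')) =
      tmulC (h₁ (incl 𝕜 R v)) (h₂ (incl 𝕜 R v')) := by
  simp [tensor₂, ext_incl]

variable (𝕜 V) in
/-- `V ⊗ V^{⊗ n} → V^{⊗ (n + 1)}`, `v ⊗ (v_1 ⊗ ⋯ ⊗ v_n) ↦ v ⊗ v_1 ⊗ ⋯ ⊗ v_n`. -/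
def tcons (n : ℕ) :
    V ⊗[𝕜] (⨂[𝕜] _ : Fin n, V) →ₗ[𝕜] (⨂[𝕜] _ : Fin (n + 1), V) :=
  TensorProduct.lift <| PiTensorProduct.lift.toLinearMap ∘ₗ
    (PiTensorProduct.tprod 𝕜 (s := fun _ : Fin (n + 1) => V)).curryLeft

variable (𝕜 R V) in
/-- The `R`-multilinear map `(V ⊗̂ R)^n → V^{⊗ n} ⊗̂ R` that extends
`(v_1, …, v_n) ↦ v_1 ⊗ ⋯ ⊗ v_n`. -/
def tprodC : ∀ n : ℕ, MultilinearMap R (fun _ : Fin n => Cpl 𝕜 R V)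
    (Cpl 𝕜 R (⨂[𝕜] _ : Fin n, V))
  | 0 => MultilinearMap.constOfIsEmpty R _ (incl 𝕜 R (PiTensorProduct.tprod 𝕜 Fin.elim0))
  | n + 1 => LinearMap.uncurryLeft
      { toFun := fun y => (baseC 𝕜 R (tcons 𝕜 V n) ∘ₗ tmulC y).compMultilinearMap (tprodC n)
        map_add' := fun y y' => by ext; simp
        map_smul' := fun r y => by ext; simp }

theorem tprodC_incl (n : ℕ) (v : Fin n → V) :
    tprodC 𝕜 R V n (fun b => incl 𝕜 R (v b)) = incl 𝕜 R (PiTensorProduct.tprod 𝕜 v) := by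
  induction n with
  | zero => exact congrArg (fun z => incl 𝕜 R (PiTensorProduct.tprod 𝕜 z)) (Subsingleton.elim _ _)
  | succ n ih =>
    have h := ih (Fin.tail v)
    change baseC 𝕜 R (tcons 𝕜 V n) (tmulC (incl 𝕜 R (v 0))
      (tprodC 𝕜 R V n (fun b => incl 𝕜 R (Fin.tail v b)))) = _
    rw [h, tmulC_incl, baseC_incl]
    simp [tcons]

/-- The `R`-linear extension `h_1 ⊗ ⋯ ⊗ h_n : V^{⊗ n} ⊗̂ R → W^{⊗ n} ⊗̂ R` of the tensor
product of `R`-linear maps `h_1, …, h_n : V ⊗̂ R → W ⊗̂ R` (no sign: all are meant to be of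
degree zero). -/
def tensorC {n : ℕ} (h : Fin n → (Cpl 𝕜 R V →ₗ[R] Cpl 𝕜 R W)) :
    Cpl 𝕜 R (⨂[𝕜] _ : Fin n, V) →ₗ[R] Cpl 𝕜 R (⨂[𝕜] _ : Fin n, W) :=
  ext <| PiTensorProduct.lift <| ((tprodC 𝕜 R W n).restrictScalars 𝕜).compLinearMap
    fun b => (h b).restrictScalars 𝕜 ∘ₗ incl 𝕜 R

theorem tensorC_incl {n : ℕ} (h : Fin n → (Cpl 𝕜 R V →ₗ[R] Cpl 𝕜 R W)) (v : Fin n → V) :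
    tensorC h (incl 𝕜 R (PiTensorProduct.tprod 𝕜 v)) =
      tprodC 𝕜 R W n (fun b => h b (incl 𝕜 R (v b))) := by
  simp [tensorC, ext_incl]

end Completion

/-! ## The graded symmetric algebra `S(U)` -/

section SymmetricAlgebra

variable {𝕜 U : Type*} [Field 𝕜] [AddCommGroup U] [Module 𝕜 U] (𝒰 : ℤ → Submodule 𝕜 U)

/-- Graded commutativity: `u v = (-1)^{|u| |v|} v u` for homogeneous generators `u`, `v`. -/
inductive SymRel : TensorAlgebra 𝕜 U → TensorAlgebra 𝕜 U → Prop
  | swap {p q : ℤ} {u v : U} (hu : u ∈ 𝒰 p) (hv : v ∈ 𝒰 q) :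
      SymRel (TensorAlgebra.ι 𝕜 u * TensorAlgebra.ι 𝕜 v)
        ((p * q).negOnePow • (TensorAlgebra.ι 𝕜 v * TensorAlgebra.ι 𝕜 u))

/-- The symmetric algebra `S(U)` of the graded vector space `U = ⨁_d 𝒰 d`: the free graded
commutative associative unital algebra on `U`. -/
def SymAlg : Type _ := RingQuot (SymRel 𝒰)

instance : Ring (SymAlg 𝒰) := inferInstanceAs (Ring (RingQuot (SymRel 𝒰)))

instance : Algebra 𝕜 (SymAlg 𝒰) := inferInstanceAs (Algebra 𝕜 (RingQuot (SymRel 𝒰)))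

/-- The projection of the tensor algebra onto `S(U)`. -/
def symMk : TensorAlgebra 𝕜 U →ₐ[𝕜] SymAlg 𝒰 := RingQuot.mkAlgHom 𝕜 (SymRel 𝒰)

/-- The inclusion `U → S(U)` of the generators. -/
def gen : U →ₗ[𝕜] SymAlg 𝒰 :=
  (symMk 𝒰).toLinearMap ∘ₗ TensorAlgebra.ι 𝕜

variable {𝒰}

theorem gen_mul_gen {p q : ℤ} {u v : U} (hu : u ∈ 𝒰 p) (hv : v ∈ 𝒰 q) :
    gen 𝒰 u * gen 𝒰 v = (p * q).negOnePow • (gen 𝒰 v * gen 𝒰 u) := by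
  have h : symMk 𝒰 _ = symMk 𝒰 _ := RingQuot.mkAlgHom_rel 𝕜 (SymRel.swap hu hv)
  rw [Units.smul_def, map_zsmul, map_mul, map_mul, ← Units.smul_def] at h
  exact h

/-- The universal property of `S(U)`. -/
def symLift {A : Type*} [Ring A] [Algebra 𝕜 A] (φ : U →ₗ[𝕜] A)
    (hφ : ∀ (p q : ℤ) (u v : U), u ∈ 𝒰 p → v ∈ 𝒰 q →
      φ u * φ v = (p * q).negOnePow • (φ v * φ u)) : SymAlg 𝒰 →ₐ[𝕜] A :=
  RingQuot.liftAlgHom 𝕜 ⟨TensorAlgebra.lift 𝕜 φ, by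
    rintro _ _ ⟨hu, hv⟩
    rw [Units.smul_def, map_zsmul, map_mul, map_mul, TensorAlgebra.lift_ι_apply,
      TensorAlgebra.lift_ι_apply, hφ _ _ _ _ hu hv, Units.smul_def]⟩

@[simp]
theorem symLift_gen {A : Type*} [Ring A] [Algebra 𝕜 A] (φ : U →ₗ[𝕜] A)
    (hφ : ∀ (p q : ℤ) (u v : U), u ∈ 𝒰 p → v ∈ 𝒰 q →
      φ u * φ v = (p * q).negOnePow • (φ v * φ u)) (u : U) : symLift φ hφ (gen 𝒰 u) = φ u := by
  refine (RingQuot.liftAlgHom_mkAlgHom_apply 𝕜 _ _ _).trans ?_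
  exact TensorAlgebra.lift_ι_apply φ u

theorem symAlg_hom_ext {A : Type*} [Ring A] [Algebra 𝕜 A] {F G : SymAlg 𝒰 →ₐ[𝕜] A}
    (h : ∀ u, F (gen 𝒰 u) = G (gen 𝒰 u)) : F = G := by
  refine RingQuot.ringQuot_ext' 𝕜 F G ?_
  refine TensorAlgebra.hom_ext (LinearMap.ext fun u => ?_)
  exact h u

variable (𝒰)

/-- `S^n(U)`: the span of the products of `n` generators. -/
def symPow (n : ℕ) : Submodule 𝕜 (SymAlg 𝒰) :=
  Submodule.span 𝕜 {x | ∃ u : Fin n → U, x = (List.ofFn fun p => gen 𝒰 (u p)).prod}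

/-- The degree `d` part of `S(U)`: the span of the products of homogeneous generators whose
degrees add up to `d`. -/
def symDeg (d : ℤ) : Submodule 𝕜 (SymAlg 𝒰) :=
  Submodule.span 𝕜 {x | ∃ (n : ℕ) (e : Fin n → ℤ) (u : Fin n → U), (∀ p, u p ∈ 𝒰 (e p)) ∧
    ∑ p, e p = d ∧ x = (List.ofFn fun p => gen 𝒰 (u p)).prod}

/-- The algebra morphism `S(U) → S(U)[X]` with `u ↦ u X` for `u ∈ U`. -/
def lengthPoly : SymAlg 𝒰 →ₐ[𝕜] Polynomial (SymAlg 𝒰) :=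
  symLift (A := Polynomial (SymAlg 𝒰))
    ((Polynomial.monomial 1).restrictScalars 𝕜 ∘ₗ gen 𝒰) fun p q u v hu hv => by
    change Polynomial.monomial 1 (gen 𝒰 u) * Polynomial.monomial 1 (gen 𝒰 v) =
      (p * q).negOnePow • (Polynomial.monomial 1 (gen 𝒰 v) * Polynomial.monomial 1 (gen 𝒰 u))
    rw [Polynomial.monomial_mul_monomial, Polynomial.monomial_mul_monomial, gen_mul_gen hu hv,
      Units.smul_def, Units.smul_def, map_zsmul]

/-- The canonical projection `S(U) → S^n(U) ⊆ S(U)`. -/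
def symProj (n : ℕ) : SymAlg 𝒰 →ₗ[𝕜] SymAlg 𝒰 :=
  (Polynomial.lcoeff (SymAlg 𝒰) n).restrictScalars 𝕜 ∘ₗ (lengthPoly 𝒰).toLinearMap

theorem symProj_prod (n r : ℕ) (u : Fin r → U) :
    symProj 𝒰 n (List.ofFn fun p => gen 𝒰 (u p)).prod =
      if r = n then (List.ofFn fun p => gen 𝒰 (u p)).prod else 0 := by
  have h : ∀ L : List U, lengthPoly 𝒰 (L.map (gen 𝒰)).prod =
      Polynomial.monomial L.length (L.map (gen 𝒰)).prod := by
    intro L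
    induction L with
    | nil => simp
    | cons a L ih =>
      rw [List.map_cons, List.prod_cons, map_mul, ih]
      simp [lengthPoly, Polynomial.monomial_mul_monomial, add_comm]
  have h' := h (List.ofFn u)
  rw [List.map_ofFn, List.length_ofFn] at h'
  change (lengthPoly 𝒰 (List.ofFn (gen 𝒰 ∘ u)).prod).coeff n = _
  rw [h', Polynomial.coeff_monomial]
  rfl

/-- The counit `ε : S(U) → 𝕜`, the algebra morphism that vanishes on `U`. -/
def counit : SymAlg 𝒰 →ₐ[𝕜] 𝕜 := symLift 0 fun p q u v hu hv => by simp

variable [DirectSum.Decomposition 𝒰]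

/-- The linear map `U → M` that is given on each homogeneous part `𝒰 d` by the restriction
of `A d : U → M`. -/
def byDegree {M : Type*} [AddCommGroup M] [Module 𝕜 M] (A : ℤ → (U →ₗ[𝕜] M)) : U →ₗ[𝕜] M :=
  DirectSum.toModule 𝕜 ℤ M (fun d => A d ∘ₗ (𝒰 d).subtype) ∘ₗ
    (DirectSum.decomposeLinearEquiv 𝒰).toLinearMap

theorem byDegree_of_mem {M : Type*} [AddCommGroup M] [Module 𝕜 M] (A : ℤ → (U →ₗ[𝕜] M))
    {d : ℤ} {u : U} (hu : u ∈ 𝒰 d) : byDegree 𝒰 A u = A d u := by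
  simp only [byDegree, LinearMap.comp_apply, LinearEquiv.coe_coe,
    DirectSum.decomposeLinearEquiv_apply]
  rw [DirectSum.decompose_of_mem 𝒰 hu]
  exact DirectSum.toModule_lof 𝕜 d _

/-- The algebra automorphism of `S(U)` with `x ↦ (-1)^{d |x|} x`: the Koszul sign of moving an
element of degree `d` across `x`. -/
def twist (d : ℤ) : SymAlg 𝒰 →ₐ[𝕜] SymAlg 𝒰 :=
  symLift (byDegree 𝒰 fun q => (d * q).negOnePow • gen 𝒰) fun p q u v hu hv => by
    rw [byDegree_of_mem 𝒰 _ hu, byDegree_of_mem 𝒰 _ hv]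
    simp only [LinearMap.smul_apply, smul_mul_smul_comm, gen_mul_gen hu hv]
    rw [smul_smul, smul_smul]
    congr 1
    ac_rfl

theorem twist_gen (d : ℤ) {q : ℤ} {u : U} (hu : u ∈ 𝒰 q) :
    twist 𝒰 d (gen 𝒰 u) = (d * q).negOnePow • gen 𝒰 u := by
  rw [twist, symLift_gen, byDegree_of_mem 𝒰 _ hu]
  rfl

theorem twist_twist (d e : ℤ) (x : SymAlg 𝒰) :
    twist 𝒰 d (twist 𝒰 e x) = twist 𝒰 e (twist 𝒰 d x) := by
  have h : (twist 𝒰 d).comp (twist 𝒰 e) = (twist 𝒰 e).comp (twist 𝒰 d) := by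
    refine symAlg_hom_ext fun u => ?_
    induction u using DirectSum.Decomposition.inductionOn 𝒰 with
    | zero => simp
    | @homogeneous q u =>
      simp only [AlgHom.comp_apply, twist_gen 𝒰 _ u.2, Units.smul_def, map_zsmul]
      rw [smul_comm]
    | add u v hu hv => rw [map_add, map_add, map_add, hu, hv]
  exact DFunLike.congr_fun h x

/-- For `u` homogeneous of degree `d`, left multiplication by `u ⊗ 1 + 1 ⊗ u` on the graded
tensor product `S(U) ⊗ S(U)`: `a ⊗ b ↦ u a ⊗ b + (-1)^{d |a|} a ⊗ u b`. -/
def insertDeg (d : ℤ) : U →ₗ[𝕜] Module.End 𝕜 (SymAlg 𝒰 ⊗[𝕜] SymAlg 𝒰) where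
  toFun u := TensorProduct.map (LinearMap.mulLeft 𝕜 (gen 𝒰 u)) LinearMap.id +
    TensorProduct.map (twist 𝒰 d).toLinearMap (LinearMap.mulLeft 𝕜 (gen 𝒰 u))
  map_add' u v := by
    ext a b
    simp [add_mul, TensorProduct.add_tmul, TensorProduct.tmul_add]
    abel
  map_smul' c u := by
    ext a b
    simp [TensorProduct.smul_tmul']

theorem insertDeg_tmul (d : ℤ) (u : U) (a b : SymAlg 𝒰) :
    insertDeg 𝒰 d u (a ⊗ₜ b) = (gen 𝒰 u * a) ⊗ₜ b + twist 𝒰 d a ⊗ₜ (gen 𝒰 u * b) := rfl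

/-- The left multiplication action of the primitively generated Hopf algebra `S(U)` on the
graded tensor product `S(U) ⊗ S(U)` through the comultiplication. -/
def comulAct : SymAlg 𝒰 →ₐ[𝕜] Module.End 𝕜 (SymAlg 𝒰 ⊗[𝕜] SymAlg 𝒰) :=
  symLift (A := Module.End 𝕜 (SymAlg 𝒰 ⊗[𝕜] SymAlg 𝒰)) (byDegree 𝒰 (insertDeg 𝒰)) fun p q u v hu hv => by
    rw [byDegree_of_mem 𝒰 _ hu, byDegree_of_mem 𝒰 _ hv]
    refine TensorProduct.ext' fun a b => ?_
    have hs : (p * q).negOnePow * (p * q).negOnePow = 1 := Int.units_mul_self _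
    simp only [Module.End.mul_apply, LinearMap.smul_apply, Units.smul_def, insertDeg_tmul, map_add,
      map_mul, twist_gen 𝒰 _ hu, twist_gen 𝒰 _ hv, smul_add]
    simp only [← Units.smul_def, smul_mul_assoc]
    rw [twist_twist 𝒰 q p, ← mul_assoc, ← mul_assoc, ← mul_assoc, ← mul_assoc, gen_mul_gen hu hv,
      mul_comm q p]
    simp only [Units.smul_def, smul_mul_assoc, TensorProduct.tmul_smul,
      ← TensorProduct.smul_tmul', smul_smul]
    have hs' : ((p * q).negOnePow : ℤ) * ((p * q).negOnePow : ℤ) = 1 := by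
      rw [← Units.val_mul, hs, Units.val_one]
    rw [hs', one_smul]
    abel

/-- The standard comultiplication `δ` of `S(U)`: the morphism of algebras from `S(U)` to the
graded tensor product `S(U) ⊗ S(U)` with `δ(u) = u ⊗ 1 + 1 ⊗ u` for `u ∈ U`. -/
def comul : SymAlg 𝒰 →ₗ[𝕜] SymAlg 𝒰 ⊗[𝕜] SymAlg 𝒰 :=
  LinearMap.applyₗ (1 ⊗ₜ 1) ∘ₗ (comulAct 𝒰).toLinearMap

theorem comul_one : comul 𝒰 1 = 1 ⊗ₜ 1 := by
  simp [comul]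

/-- `δ(u x) = (u ⊗ 1 + 1 ⊗ u) δ(x)` in the graded tensor product, for `u ∈ U` of degree `d`. -/
theorem comul_gen_mul {d : ℤ} {u : U} (hu : u ∈ 𝒰 d) (x : SymAlg 𝒰) :
    comul 𝒰 (gen 𝒰 u * x) = insertDeg 𝒰 d u (comul 𝒰 x) := by
  simp [comul, comulAct, byDegree_of_mem 𝒰 _ hu]

end SymmetricAlgebra

/-! ## The convolution product and the composition `f ◇ g = log (exp f ∘ exp g)` -/

section Convolution

variable {𝕜 R : Type*} [Field 𝕜] [CommRing R] [IsLocalRing R] [IsNoetherianRing R] [Algebra 𝕜 R]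
variable {U₁ U₂ U₃ : Type*} [AddCommGroup U₁] [Module 𝕜 U₁] [AddCommGroup U₂] [Module 𝕜 U₂]
  [AddCommGroup U₃] [Module 𝕜 U₃]
variable {𝒰₁ : ℤ → Submodule 𝕜 U₁} {𝒰₂ : ℤ → Submodule 𝕜 U₂} {𝒰₃ : ℤ → Submodule 𝕜 U₃}

variable (R 𝒰₁) in
/-- `S(U)_d ⊗̂ R`, as an `R`-submodule of `S(U) ⊗̂ R`. -/
def cplDeg (d : ℤ) : Submodule R (Cpl 𝕜 R (SymAlg 𝒰₁)) :=
  LinearMap.range (baseC 𝕜 R (symDeg 𝒰₁ d).subtype)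

variable (𝕜 R 𝒰₁ 𝒰₂) in
/-- `Lin_R(S(U₁), S(U₂))`, whose elements are the `R`-linear maps `S(U₁) ⊗̂ R → S(U₂) ⊗̂ R`
(of degree zero, a condition that is part of `IsLin0`). -/
abbrev Lin : Type _ := Cpl 𝕜 R (SymAlg 𝒰₁) →ₗ[R] Cpl 𝕜 R (SymAlg 𝒰₂)

/-- `f ∈ Lin_R^0(S(U₁), S(U₂))`: the map `f` has degree zero, and `f(1) ∈ S(U₂) ⊗̂ 𝔪`. -/
structure IsLin0 (f : Lin 𝕜 R 𝒰₁ 𝒰₂) : Prop where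
  degree_zero : ∀ (d : ℤ), ∀ x ∈ cplDeg R 𝒰₁ d, f x ∈ cplDeg R 𝒰₂ d
  map_one : f (incl 𝕜 R 1) ∈ filt 𝕜 R (SymAlg 𝒰₂) 1

variable (𝕜 R 𝒰₁ 𝒰₂) in
/-- The unit `e = η ∘ ε` of the convolution product. -/
def convUnit : Lin 𝕜 R 𝒰₁ 𝒰₂ :=
  baseC 𝕜 R (Algebra.linearMap 𝕜 (SymAlg 𝒰₂) ∘ₗ (counit 𝒰₁).toLinearMap)

variable (𝕜 R 𝒰₁) in
/-- The `(n, m)`-component of `h`: the composition of the projection to `S^n(U₁) ⊗̂ R`, the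
map `h` and the projection to `S^m(U₂) ⊗̂ R`. -/
def comp (n m : ℕ) (h : Lin 𝕜 R 𝒰₁ 𝒰₂) : Lin 𝕜 R 𝒰₁ 𝒰₂ :=
  baseC 𝕜 R (symProj 𝒰₂ m) ∘ₗ h ∘ₗ baseC 𝕜 R (symProj 𝒰₁ n)

variable [DirectSum.Decomposition 𝒰₁] [DirectSum.Decomposition 𝒰₂]

/-- The convolution product `f ⋆ g = μ ∘ (f ⊗ g) ∘ δ`. -/
def conv (f g : Lin 𝕜 R 𝒰₁ 𝒰₂) : Lin 𝕜 R 𝒰₁ 𝒰₂ :=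
  baseC 𝕜 R (LinearMap.mul' 𝕜 (SymAlg 𝒰₂)) ∘ₗ tensor₂ f g ∘ₗ baseC 𝕜 R (comul 𝒰₁)

/-- The powers with respect to the convolution product. -/
def convPow (f : Lin 𝕜 R 𝒰₁ 𝒰₂) : ℕ → Lin 𝕜 R 𝒰₁ 𝒰₂
  | 0 => convUnit 𝕜 R 𝒰₁ 𝒰₂
  | c + 1 => conv (convPow f c) f

/-- The terms `f^c / c!` (`c ≥ 0`) of the exponential series. -/
def expTerm (f : Lin 𝕜 R 𝒰₁ 𝒰₂) (c : ℕ) : Lin 𝕜 R 𝒰₁ 𝒰₂ :=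
  algebraMap 𝕜 R (c.factorial : 𝕜)⁻¹ • convPow f c

/-- `exp(f) = e + f + f^2 / 2! + ⋯`. -/
def convExp (f : Lin 𝕜 R 𝒰₁ 𝒰₂) : Lin 𝕜 R 𝒰₁ 𝒰₂ := linSum (expTerm f)

/-- The terms `(-1)^c h^(c + 1) / (c + 1)` (`c ≥ 0`) of the series for `log(e + h)`. -/
def logTerm (h : Lin 𝕜 R 𝒰₁ 𝒰₂) (c : ℕ) : Lin 𝕜 R 𝒰₁ 𝒰₂ :=
  algebraMap 𝕜 R ((-1) ^ c * ((c : 𝕜) + 1)⁻¹) • convPow h (c + 1)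

/-- `log(H) = h - h^2 / 2 + h^3 / 3 - ⋯` for `H = e + h`. -/
def convLog (H : Lin 𝕜 R 𝒰₁ 𝒰₂) : Lin 𝕜 R 𝒰₁ 𝒰₂ :=
  linSum (logTerm (H - convUnit 𝕜 R 𝒰₁ 𝒰₂))

/-- The composition `f ◇ g = log(exp(f) ∘ exp(g))`. -/
def diamond [DirectSum.Decomposition 𝒰₃] (f : Lin 𝕜 R 𝒰₂ 𝒰₃) (g : Lin 𝕜 R 𝒰₁ 𝒰₂) :
    Lin 𝕜 R 𝒰₁ 𝒰₃ :=
  convLog (convExp f ∘ₗ convExp g)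

end Convolution

/-! ## Unshuffles, their graphs, and the explicit formula -/

section Formula

/-- Given `a_1 + ⋯ + a_k = n`, the element of `{1, …, n}` at position `p` of the `c`-th segment
of the decomposition `{1, …, n} = {1, …, a_1} ∪ ⋯ ∪ {n - a_k + 1, …, n}`. -/
def seg {k n : ℕ} (a : Fin k → ℕ) (ha : ∑ c, a c = n) (c : Fin k) (p : Fin (a c)) : Fin n :=
  Fin.cast ha (finSigmaFinEquiv ⟨c, p⟩)

/-- `σ` is an `(a_1, …, a_k)`-unshuffle: it is increasing on each segment. -/
def IsUnshuffle {k n : ℕ} (a : Fin k → ℕ) (ha : ∑ c, a c = n) (σ : Equiv.Perm (Fin n)) : Prop :=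
  ∀ c, StrictMono fun p => σ (seg a ha c p)

/-- The Koszul sign `ε(σ; u_1, …, u_n)` for `u_i` of degree `e i`, defined by
`u_1 ⋯ u_n = ε(σ) u_{σ(1)} ⋯ u_{σ(n)}`: each pair that `σ` puts out of order contributes
`(-1)^{|u| |v|}`. -/
def koszulSign {n : ℕ} (e : Fin n → ℤ) (σ : Equiv.Perm (Fin n)) : ℤˣ :=
  ∏ p : Fin n, ∏ q : Fin n,
    if p < q ∧ σ q < σ p then (e (σ p) * e (σ q)).negOnePow else 1

/-- The graph of an unshuffle `κ`, with upper vertices `Fin l` and lower vertices `Fin k`: the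
upper vertex `b` is joined to the lower vertex `a` if and only if `κ` maps some element of the
`b`-th segment of `s` to some element of the `a`-th segment of `j`. -/
def unshuffleGraph {k l r : ℕ} (j : Fin k → ℕ) (s : Fin l → ℕ) (hj : ∑ a, j a = r)
    (hs : ∑ b, s b = r) (κ : Equiv.Perm (Fin r)) : SimpleGraph (Fin l ⊕ Fin k) :=
  SimpleGraph.fromRel fun x y => ∃ (b : Fin l) (a : Fin k), x = Sum.inl b ∧ y = Sum.inr a ∧
    ∃ (q : Fin (s b)) (p : Fin (j a)), κ (seg s hs b q) = seg j hj a p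

variable {𝕜 R : Type*} [Field 𝕜] [CommRing R] [IsLocalRing R] [IsNoetherianRing R] [Algebra 𝕜 R]
variable {U₁ U₂ U₃ : Type*} [AddCommGroup U₁] [Module 𝕜 U₁] [AddCommGroup U₂] [Module 𝕜 U₂]
  [AddCommGroup U₃] [Module 𝕜 U₃]
variable (𝒰₁ : ℤ → Submodule 𝕜 U₁) (𝒰₂ : ℤ → Submodule 𝕜 U₂) (𝒰₃ : ℤ → Submodule 𝕜 U₃)

/-- The product in `S(U)` of the `u_i` with `i` in the `c`-th segment. -/
def segProd {k n : ℕ} (a : Fin k → ℕ) (ha : ∑ c, a c = n) (u : Fin n → U₁) (c : Fin k) :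
    SymAlg 𝒰₁ :=
  (List.ofFn fun p => gen 𝒰₁ (u (seg a ha c p))).prod

open Classical in
/-- The defining property of the connected part `¹Ψ` of
`Ψ : S^{j_1}(U) ⊗ ⋯ ⊗ S^{j_k}(U) → S^{s_1}(U) ⊗ ⋯ ⊗ S^{s_l}(U)`: the tensor
`(u_1 ⋯ u_{j_1}) ⊗ ⋯ ⊗ (u_{r - j_k + 1} ⋯ u_r)` of products of homogeneous generators goes to
the sum, over the `(s_1, …, s_l)`-unshuffles `κ` whose graph is connected, of
`ε(κ) (u_{κ(1)} ⋯ u_{κ(s_1)}) ⊗ ⋯ ⊗ (u_{κ(r - s_l + 1)} ⋯ u_{κ(r)})`. The map is extended by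
zero from `S^{j_1}(U) ⊗ ⋯ ⊗ S^{j_k}(U)` to all of `S(U)^{⊗ k}`. -/
structure IsConnPsi {k l : ℕ} (j : Fin k → ℕ) (s : Fin l → ℕ)
    (Ψ : (⨂[𝕜] _ : Fin k, SymAlg 𝒰₂) →ₗ[𝕜] (⨂[𝕜] _ : Fin l, SymAlg 𝒰₂)) : Prop where
  apply_prod : ∀ (r : ℕ) (hj : ∑ a, j a = r) (hs : ∑ b, s b = r) (e : Fin r → ℤ)
    (u : Fin r → U₂), (∀ p, u p ∈ 𝒰₂ (e p)) →
      Ψ (PiTensorProduct.tprod 𝕜 (segProd 𝒰₂ j hj u)) =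
        ∑ κ : Equiv.Perm (Fin r) with
            IsUnshuffle s hs κ ∧ (unshuffleGraph j s hj hs κ).Connected,
          koszulSign e κ • PiTensorProduct.tprod 𝕜 (segProd 𝒰₂ s hs (u ∘ κ))
  apply_other : ∀ (i : Fin k → ℕ) (x : Fin k → SymAlg 𝒰₂), (∀ a, x a ∈ symPow 𝒰₂ (i a)) →
    i ≠ j → Ψ (PiTensorProduct.tprod 𝕜 x) = 0

open Classical in
/-- The map `¹Ψ` with upper indices `s` and lower indices `j`. -/
def connPsi {k l : ℕ} (j : Fin k → ℕ) (s : Fin l → ℕ) :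
    (⨂[𝕜] _ : Fin k, SymAlg 𝒰₂) →ₗ[𝕜] (⨂[𝕜] _ : Fin l, SymAlg 𝒰₂) :=
  if h : ∃ Ψ, IsConnPsi 𝒰₂ j s Ψ then h.choose else 0

/-- The indices of the sum in the formula for `(f ◇ g)^m_n`: natural numbers `k, l ≥ 1`,
non-negative integers with `i_1 + ⋯ + i_k = n`, `t_1 + ⋯ + t_l = m` and
`j_1 + ⋯ + j_k = s_1 + ⋯ + s_l`, and an `(i_1, …, i_k)`-unshuffle `σ`. -/
structure FormulaIndex (n m : ℕ) where
  k : ℕ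
  l : ℕ
  hk : 1 ≤ k
  hl : 1 ≤ l
  i : Fin k → ℕ
  t : Fin l → ℕ
  j : Fin k → ℕ
  s : Fin l → ℕ
  hi : ∑ a, i a = n
  ht : ∑ b, t b = m
  hjs : ∑ a, j a = ∑ b, s b
  σ : Equiv.Perm (Fin n)
  hσ : IsUnshuffle i hi σ

variable {𝒰₁ 𝒰₂ 𝒰₃}

/-- The map `1 / (k! l!) (f_{s_1}^{t_1} ⊗ ⋯ ⊗ f_{s_l}^{t_l}) ∘ ¹Ψ ∘ (g_{i_1}^{j_1} ⊗ ⋯ ⊗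
g_{i_k}^{j_k})`. -/
def graphMap (f : Lin 𝕜 R 𝒰₂ 𝒰₃) (g : Lin 𝕜 R 𝒰₁ 𝒰₂) {k l : ℕ} (i j : Fin k → ℕ)
    (s t : Fin l → ℕ) :
    Cpl 𝕜 R (⨂[𝕜] _ : Fin k, SymAlg 𝒰₁) →ₗ[R] Cpl 𝕜 R (⨂[𝕜] _ : Fin l, SymAlg 𝒰₃) :=
  algebraMap 𝕜 R ((k.factorial : 𝕜) * (l.factorial : 𝕜))⁻¹ •
    (tensorC (fun b => comp 𝕜 R 𝒰₂ (s b) (t b) f) ∘ₗ baseC 𝕜 R (connPsi 𝒰₂ j s) ∘ₗ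
      tensorC (fun a => comp 𝕜 R 𝒰₁ (i a) (j a) g))

variable (𝕜 𝒰₃) in
/-- The iterated multiplication `S(U)^{⊗ l} → S(U)`. -/
def mulIter (l : ℕ) : (⨂[𝕜] _ : Fin l, SymAlg 𝒰₃) →ₗ[𝕜] SymAlg 𝒰₃ :=
  PiTensorProduct.lift (MultilinearMap.mkPiAlgebraFin 𝕜 l (SymAlg 𝒰₃))

/-- The term with index `c` of the formula for `(f ◇ g)^m_n (u_1 ⋯ u_n)`, where `u_p` is
homogeneous of degree `e p`. -/
def formulaTerm (f : Lin 𝕜 R 𝒰₂ 𝒰₃) (g : Lin 𝕜 R 𝒰₁ 𝒰₂) {n m : ℕ} (e : Fin n → ℤ)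
    (u : Fin n → U₁) (c : FormulaIndex n m) : Cpl 𝕜 R (SymAlg 𝒰₃) :=
  koszulSign e c.σ • baseC 𝕜 R (mulIter 𝕜 𝒰₃ c.l)
    (graphMap f g c.i c.j c.s c.t
      (incl 𝕜 R (PiTensorProduct.tprod 𝕜 (segProd 𝒰₁ c.i c.hi (u ∘ c.σ)))))

end Formula

end MVComp

end

/-!
The proof counts coloured graphs: the logarithm of `H = exp(f) ∘ exp(g)` is read off from the
convolution powers `H^{⋆T}`, and these are obtained by replacing `U''` by `T` copies of itself.

*Replication.* Let `U''^(ℕ)` be the sum of copies of `U''` indexed by colours, let `G_T` be the sum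
of `g` followed by the inclusions in the colours `c < T`, and let `F_T` be the sum of `f` preceded
by the projections to these colours. Since `S(U)` is graded commutative and graded cocommutative,
maps of degree zero commute under convolution (`commute_of_mem_convDegZero`), hence
`exp(a + b) = exp(a) ⋆ exp(b)` for them (`convExp_add`). As different colours do not interact,
`exp(F_T) ∘ exp(G_T) = H^{⋆T}` (`convExp_selectSum_comp_convExp_paintSum`).

*The logarithm as a linear coefficient.* Write `H = e + h`. Then `H^{⋆T} = ∑ binom(T, c) h^{⋆c}`,
and modulo any step of a filtration for which `h` has positive order (`convFilt`) this is a
polynomial in `T`. The coefficient of `T` in `binom(T, c)` is `(-1)^(c-1) / c`, so the linear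
coefficient of `H^{⋆T}` is `log(H) = f ◇ g`. A linear coefficient is a fixed combination of the
values at finitely many natural numbers `T` (`IsWeights`, `diamond_sub_sum_convPow_mem`), so no
polynomials with coefficients in a completed module are needed.

*Connected graphs.* Expanding `exp(F_T) ∘ exp(G_T)` gives, for all `k` and `l`, the map
`(k! l!)⁻¹ μ^{[l]} f^{⊗ l} δ^{[l]} μ^{[k]} g^{⊗ k} δ^{[k]}`, with its middle part `δ^{[l]} μ^{[k]}`
taken in `S(U''^(ℕ))`, summed over the colourings of the `k` factors `g` and the `l` factors `f`
(`convPow_selectSum_convPow_paintSum`). On a tensor of words, `δ^{[l]} μ^{[k]}` is a sum over all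
graphs between the `k` lower and the `l` upper vertices, and a graph survives a colouring exactly
if the colouring is constant on its connected components. There are `T^c` such colourings for a
graph with `c` components (`sum_colourings`), so the linear coefficient keeps the connected graphs
(`avgPsi_segProd`). What remains is `¹Ψ`, which is thereby also shown to be well defined
(`isConnPsi_connPsi`, `connPsi_eq`).

*Convergence.* Modulo `𝔪^N` only finitely many terms matter on a word of length `n`: each factor
`g(1)` or `f(1)` contributes one power of `𝔪`, so that `k < n + N`; the finitely many remaining
images under `g^{⊗ k}` are, modulo `𝔪^N`, combinations of words of bounded total length `ρ`
(`boundedLength`); and then `l < ρ + N` (`formulaSummand_mem`). Unshuffles are traded throughout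
for maps with prescribed sizes of fibres (`sum_unshuffle`), which is the form in which the iterated
comultiplication produces them (`iterComul_word`).
-/

set_option linter.unusedSectionVars false

open IsLocalRing
open scoped TensorProduct

noncomputable section

namespace MVComp

/-! ### Linear maps between completed tensor products -/

section CompletionLemmas

variable {𝕜 R : Type*} [Field 𝕜] [CommRing R] [IsLocalRing R] [Algebra 𝕜 R]
variable {V W Z V' W' : Type*} [AddCommGroup V] [Module 𝕜 V] [AddCommGroup W] [Module 𝕜 W]
  [AddCommGroup Z] [Module 𝕜 Z] [AddCommGroup V'] [Module 𝕜 V'] [AddCommGroup W'] [Module 𝕜 W']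

theorem map_mem_filt (F : Cpl 𝕜 R V →ₗ[R] Cpl 𝕜 R W) {N : ℕ} {x : Cpl 𝕜 R V}
    (hx : x ∈ filt 𝕜 R V N) : F x ∈ filt 𝕜 R W N :=
  filt_le_comap F N hx

theorem filt_anti {M N : ℕ} (h : M ≤ N) : filt 𝕜 R V N ≤ filt 𝕜 R V M :=
  Submodule.smul_mono_left (Ideal.pow_le_pow_right h)

theorem mem_filt_zero (x : Cpl 𝕜 R V) : x ∈ filt 𝕜 R V 0 := by
  simp [filt]

theorem map_smul_field (F : Cpl 𝕜 R V →ₗ[R] Cpl 𝕜 R W) (c : 𝕜) (x : Cpl 𝕜 R V) :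
    F (c • x) = c • F x := by
  rw [← algebraMap_smul R c, map_smul, algebraMap_smul]

theorem smul_field_mem (P : Submodule R (Cpl 𝕜 R V)) (c : 𝕜) {x : Cpl 𝕜 R V} (hx : x ∈ P) :
    c • x ∈ P := by
  rw [← algebraMap_smul R c]
  exact P.smul_mem _ hx

theorem zsign_smul_mem (P : Submodule R (Cpl 𝕜 R V)) (c : ℤˣ) {x : Cpl 𝕜 R V} (hx : x ∈ P) :
    c • x ∈ P := by
  rcases Int.units_eq_one_or c with rfl | rfl
  · simpa using hx
  · simpa using hx

theorem tmulC_smul_left [IsNoetherianRing R] (c : 𝕜) (x : Cpl 𝕜 R V) (y : Cpl 𝕜 R W) :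
    tmulC (c • x) y = c • tmulC x y := by
  rw [← algebraMap_smul R c, map_smul, LinearMap.smul_apply, algebraMap_smul]

theorem tmulC_smul_right [IsNoetherianRing R] (c : 𝕜) (x : Cpl 𝕜 R V) (y : Cpl 𝕜 R W) :
    tmulC x (c • y) = c • tmulC x y :=
  map_smul_field _ c y

variable [IsNoetherianRing R]

theorem eq_zero_of_forall_mem_filt {x : Cpl 𝕜 R V} (h : ∀ N, x ∈ filt 𝕜 R V N) : x = 0 :=
  IsHausdorff.haus (inferInstance : IsHausdorff (maximalIdeal R) (Cpl 𝕜 R V)) _ fun N =>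
    SModEq.zero.2 (h N)

theorem eq_of_forall_sub_mem_filt {x y : Cpl 𝕜 R V} (h : ∀ N, x - y ∈ filt 𝕜 R V N) : x = y :=
  sub_eq_zero.1 (eq_zero_of_forall_mem_filt h)

/-- `V` spans a dense submodule of `V ⊗̂ R`. -/
theorem exists_span_sub_mem_filt (x : Cpl 𝕜 R V) (N : ℕ) :
    ∃ z ∈ Submodule.span R (Set.range (incl 𝕜 R (V := V))), x - z ∈ filt 𝕜 R V N := by
  obtain ⟨z, hz⟩ := Submodule.mkQ_surjective _ (AdicCompletion.eval (maximalIdeal R) _ N x)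
  refine ⟨AdicCompletion.of (maximalIdeal R) _ z, ?_, ?_⟩
  · clear hz
    induction z using TensorProduct.induction_on with
    | zero => rw [map_zero]; exact Submodule.zero_mem _
    | tmul r v =>
      have : (r ⊗ₜ[𝕜] v : R ⊗[𝕜] V) = r • (1 ⊗ₜ[𝕜] v) := by
        rw [TensorProduct.smul_tmul', smul_eq_mul, mul_one]
      rw [this, map_smul]
      exact Submodule.smul_mem _ _ (Submodule.subset_span ⟨v, rfl⟩)
    | add a b ha hb => rw [map_add]; exact Submodule.add_mem _ ha hb
  · rw [filt, AdicCompletion.pow_smul_top_eq_ker_eval (IsNoetherian.noetherian (maximalIdeal R)),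
      LinearMap.mem_ker, map_sub, AdicCompletion.eval_of, hz, sub_self]

/-- A map sends everything into an open submodule `P` if it sends `V` there. -/
theorem map_mem_of_incl_mem (F : Cpl 𝕜 R V →ₗ[R] Cpl 𝕜 R W) {N : ℕ} {P : Submodule R (Cpl 𝕜 R W)}
    (hP : filt 𝕜 R W N ≤ P) (h : ∀ v, F (incl 𝕜 R v) ∈ P) (x : Cpl 𝕜 R V) : F x ∈ P := by
  obtain ⟨z, hz, hxz⟩ := exists_span_sub_mem_filt x N
  have h1 : F z ∈ P := by
    have : Submodule.span R (Set.range (incl 𝕜 R (V := V))) ≤ P.comap F := by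
      rw [Submodule.span_le]
      rintro _ ⟨v, rfl⟩
      exact h v
    exact this hz
  have h2 := hP (map_mem_filt F hxz)
  rw [map_sub] at h2
  simpa using P.add_mem h2 h1

/-- An `R`-linear map out of `(V ⊗ W) ⊗̂ R` is determined by its values on the `v ⊗ w`. -/
theorem hom_ext_tmul {F G : Cpl 𝕜 R (V ⊗[𝕜] W) →ₗ[R] Cpl 𝕜 R Z}
    (h : ∀ v w, F (incl 𝕜 R (v ⊗ₜ w)) = G (incl 𝕜 R (v ⊗ₜ w))) : F = G := by
  refine hom_ext fun z => ?_
  induction z using TensorProduct.induction_on with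
  | zero => simp
  | tmul v w => exact h v w
  | add a b ha hb => rw [map_add, map_add, map_add, ha, hb]

/-- An `R`-linear map out of `V^{⊗ n} ⊗̂ R` is determined by its values on the pure tensors. -/
theorem hom_ext_tprod {n : ℕ} {F G : Cpl 𝕜 R (⨂[𝕜] _ : Fin n, V) →ₗ[R] Cpl 𝕜 R Z}
    (h : ∀ v, F (incl 𝕜 R (PiTensorProduct.tprod 𝕜 v)) =
      G (incl 𝕜 R (PiTensorProduct.tprod 𝕜 v))) : F = G := by
  refine hom_ext fun z => ?_
  induction z using PiTensorProduct.induction_on with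
  | smul_tprod c v => rw [map_smul, map_smul_field, map_smul_field, h]
  | add a b ha hb => rw [map_add, map_add, map_add, ha, hb]

/-- Two `R`-bilinear maps that agree on `V × W` are equal. -/
theorem bilin_ext {B B' : Cpl 𝕜 R V →ₗ[R] Cpl 𝕜 R W →ₗ[R] Cpl 𝕜 R Z}
    (h : ∀ v w, B (incl 𝕜 R v) (incl 𝕜 R w) = B' (incl 𝕜 R v) (incl 𝕜 R w))
    (x : Cpl 𝕜 R V) (y : Cpl 𝕜 R W) : B x y = B' x y := by
  have h1 : ∀ v, B (incl 𝕜 R v) = B' (incl 𝕜 R v) := fun v => hom_ext (h v)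
  have h2 : B.flip y = B'.flip y := hom_ext fun v => by
    rw [LinearMap.flip_apply, LinearMap.flip_apply, h1]
  exact LinearMap.congr_fun h2 x

theorem baseC_comp (a : W →ₗ[𝕜] Z) (b : V →ₗ[𝕜] W) :
    baseC 𝕜 R (a ∘ₗ b) = baseC 𝕜 R a ∘ₗ baseC 𝕜 R b :=
  hom_ext fun v => by simp [baseC_incl]

theorem baseC_comp_apply (a : W →ₗ[𝕜] Z) (b : V →ₗ[𝕜] W) (x : Cpl 𝕜 R V) :
    baseC 𝕜 R a (baseC 𝕜 R b x) = baseC 𝕜 R (a ∘ₗ b) x := by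
  rw [baseC_comp, LinearMap.comp_apply]

theorem baseC_id : baseC 𝕜 R (LinearMap.id : V →ₗ[𝕜] V) = LinearMap.id :=
  hom_ext fun v => by simp [baseC_incl]

theorem baseC_smul (c : 𝕜) (a : V →ₗ[𝕜] W) :
    baseC 𝕜 R (c • a) = algebraMap 𝕜 R c • baseC 𝕜 R a :=
  hom_ext fun v => by simp [baseC_incl]

theorem baseC_sum {ι : Type*} (s : Finset ι) (a : ι → (V →ₗ[𝕜] W)) :
    baseC 𝕜 R (∑ i ∈ s, a i) = ∑ i ∈ s, baseC 𝕜 R (a i) :=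
  hom_ext fun v => by simp [baseC_incl]

theorem tensor₂_tmulC (h₁ : Cpl 𝕜 R V →ₗ[R] Cpl 𝕜 R W) (h₂ : Cpl 𝕜 R V' →ₗ[R] Cpl 𝕜 R W')
    (x : Cpl 𝕜 R V) (y : Cpl 𝕜 R V') : tensor₂ h₁ h₂ (tmulC x y) = tmulC (h₁ x) (h₂ y) := by
  let B : Cpl 𝕜 R V →ₗ[R] Cpl 𝕜 R V' →ₗ[R] Cpl 𝕜 R (W ⊗[𝕜] W') :=
    tmulC.compr₂ (tensor₂ h₁ h₂)
  exact bilin_ext (B := B) (B' := tmulC.compl₁₂ h₁ h₂)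
    (fun v w => by simp [B, tmulC_incl, tensor₂_incl]) x y

theorem baseC_map (a : V →ₗ[𝕜] W) (b : V' →ₗ[𝕜] W') :
    baseC 𝕜 R (TensorProduct.map a b) = tensor₂ (baseC 𝕜 R a) (baseC 𝕜 R b) :=
  hom_ext_tmul fun v w => by
    rw [baseC_incl, tensor₂_incl, baseC_incl, baseC_incl, tmulC_incl, TensorProduct.map_tmul]

theorem tensor₂_comp {V'' W'' : Type*} [AddCommGroup V''] [Module 𝕜 V''] [AddCommGroup W'']
    [Module 𝕜 W''] (a : Cpl 𝕜 R V' →ₗ[R] Cpl 𝕜 R V'') (b : Cpl 𝕜 R W' →ₗ[R] Cpl 𝕜 R W'')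
    (a' : Cpl 𝕜 R V →ₗ[R] Cpl 𝕜 R V') (b' : Cpl 𝕜 R W →ₗ[R] Cpl 𝕜 R W') :
    tensor₂ (a ∘ₗ a') (b ∘ₗ b') = tensor₂ a b ∘ₗ tensor₂ a' b' :=
  hom_ext_tmul fun v w => by
    simp [tensor₂_incl, tensor₂_tmulC]

theorem tmulC_mem_filt {a b : ℕ} {x : Cpl 𝕜 R V} {y : Cpl 𝕜 R W} (hx : x ∈ filt 𝕜 R V a)
    (hy : y ∈ filt 𝕜 R W b) : tmulC x y ∈ filt 𝕜 R (V ⊗[𝕜] W) (a + b) := by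
  refine Submodule.smul_induction_on hx (fun r hr x' _ => ?_) fun x₁ x₂ h₁ h₂ => ?_
  · refine Submodule.smul_induction_on hy (fun s hs y' _ => ?_) fun y₁ y₂ h₁ h₂ => ?_
    · rw [map_smul, map_smul, LinearMap.smul_apply, smul_smul, mul_comm s r]
      refine Submodule.smul_mem_smul ?_ trivial
      rw [pow_add]
      exact Ideal.mul_mem_mul hr hs
    · rw [map_add]
      exact Submodule.add_mem _ h₁ h₂
  · rw [map_add, LinearMap.add_apply]
    exact Submodule.add_mem _ h₁ h₂

theorem tensorC_tprodC {n : ℕ} (h : Fin n → (Cpl 𝕜 R V →ₗ[R] Cpl 𝕜 R W)) (y : Fin n → Cpl 𝕜 R V) :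
    tensorC h (tprodC 𝕜 R V n y) = tprodC 𝕜 R W n fun b => h b (y b) := by
  -- it suffices to compare the two multilinear maps one variable at a time
  have key : ∀ (s : Finset (Fin n)) (y : Fin n → Cpl 𝕜 R V),
      (∀ b ∉ s, ∃ v, y b = incl 𝕜 R v) →
      tensorC h (tprodC 𝕜 R V n y) = tprodC 𝕜 R W n fun b => h b (y b) := by
    intro s
    induction s using Finset.induction_on with
    | empty =>
      intro y hy
      choose v hv using fun b => hy b (Finset.notMem_empty b)
      obtain rfl : y = fun b => incl 𝕜 R (v b) := funext hv
      rw [tprodC_incl, tensorC_incl]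
    | insert c s hc ih =>
      intro y hy
      let F := tensorC h ∘ₗ (tprodC 𝕜 R V n).toLinearMap y c
      let G := ((tprodC 𝕜 R W n).toLinearMap (fun b => h b (y b)) c) ∘ₗ h c
      have hFG : F = G := hom_ext fun v => by
        have := ih (Function.update y c (incl 𝕜 R v)) fun b hb => by
          by_cases hbc : b = c
          · subst hbc
            exact ⟨v, by simp⟩
          · rw [Function.update_of_ne hbc]
            exact hy b (by simp [hbc, hb])
        simp only [F, G, LinearMap.comp_apply, MultilinearMap.toLinearMap_apply]
        rw [this]
        congr 1
        funext b
        by_cases hbc : b = c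
        · subst hbc
          simp
        · simp [Function.update_of_ne hbc]
      have := LinearMap.congr_fun hFG (y c)
      simp only [F, G, LinearMap.comp_apply, MultilinearMap.toLinearMap_apply] at this
      rw [Function.update_eq_self] at this
      rw [this]
      congr 1
      exact Function.update_eq_self c fun b => h b (y b)
  exact key Finset.univ y (by simp)

theorem tensorC_comp {n : ℕ} (h : Fin n → (Cpl 𝕜 R W →ₗ[R] Cpl 𝕜 R Z))
    (h' : Fin n → (Cpl 𝕜 R V →ₗ[R] Cpl 𝕜 R W)) :
    tensorC (fun b => h b ∘ₗ h' b) = tensorC h ∘ₗ tensorC h' :=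
  hom_ext_tprod fun v => by simp [tensorC_incl, tensorC_tprodC]

theorem baseC_piMap {n : ℕ} (a : Fin n → (V →ₗ[𝕜] W)) :
    baseC 𝕜 R (PiTensorProduct.map a) = tensorC fun b => baseC 𝕜 R (a b) :=
  hom_ext_tprod fun v => by
    rw [baseC_incl, tensorC_incl, PiTensorProduct.map_tprod, ← tprodC_incl]
    simp [baseC_incl]

theorem tprodC_succ (n : ℕ) (y : Fin (n + 1) → Cpl 𝕜 R V) :
    tprodC 𝕜 R V (n + 1) y =
      baseC 𝕜 R (tcons 𝕜 V n) (tmulC (y 0) (tprodC 𝕜 R V n (Fin.tail y))) := rfl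

theorem tcons_tmul_tprod (n : ℕ) (v : V) (w : Fin n → V) :
    tcons 𝕜 V n (v ⊗ₜ PiTensorProduct.tprod 𝕜 w) = PiTensorProduct.tprod 𝕜 (Fin.cons v w) := by
  simp [tcons]

/-- The power `h^{⊗ (n + 1)}` is `h ⊗ h^{⊗ n}`, up to the identification `tcons`. -/
theorem tensorC_tcons {n : ℕ} (h : Cpl 𝕜 R V →ₗ[R] Cpl 𝕜 R W) :
    tensorC (fun _ : Fin (n + 1) => h) ∘ₗ baseC 𝕜 R (tcons 𝕜 V n) =
      baseC 𝕜 R (tcons 𝕜 W n) ∘ₗ tensor₂ h (tensorC fun _ : Fin n => h) := by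
  refine hom_ext_tmul fun v w => ?_
  induction w using PiTensorProduct.induction_on with
  | smul_tprod c w =>
    rw [TensorProduct.tmul_smul, map_smul, map_smul_field, map_smul_field]
    congr 1
    rw [LinearMap.comp_apply, LinearMap.comp_apply, baseC_incl, tcons_tmul_tprod, tensorC_incl,
      tensor₂_incl, tensorC_incl, tprodC_succ]
    rfl
  | add a b ha hb => rw [TensorProduct.tmul_add, map_add, map_add, map_add, ha, hb]

/-- Every factor that lies in `𝔪 (V ⊗̂ R)` contributes to the order of a tensor product. -/
theorem tprodC_mem_filt (n : ℕ) (y : Fin n → Cpl 𝕜 R V) (s : Finset (Fin n))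
    (hs : ∀ b ∈ s, y b ∈ filt 𝕜 R V 1) : tprodC 𝕜 R V n y ∈ filt 𝕜 R _ s.card := by
  classical
  have key : ∀ (n : ℕ) (y : Fin n → Cpl 𝕜 R V) (a : Fin n → ℕ),
      (∀ b, y b ∈ filt 𝕜 R V (a b)) → tprodC 𝕜 R V n y ∈ filt 𝕜 R _ (∑ b, a b) := by
    intro n
    induction n with
    | zero => intro y a _; simpa using mem_filt_zero _
    | succ n ih =>
      intro y a h
      rw [Fin.sum_univ_succ, tprodC_succ]
      exact map_mem_filt _ (tmulC_mem_filt (h 0) (ih _ _ fun b => h b.succ))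
  have := key n y (fun b => if b ∈ s then 1 else 0) fun b => by
    split_ifs with hb
    · exact hs b hb
    · exact mem_filt_zero _
  simpa using this

end CompletionLemmas

/-! ### Convergent series of linear maps -/

section Series

variable {𝕜 R : Type*} [Field 𝕜] [CommRing R] [IsLocalRing R] [IsNoetherianRing R] [Algebra 𝕜 R]
variable {V W : Type*} [AddCommGroup V] [Module 𝕜 V] [AddCommGroup W] [Module 𝕜 W]

/-- For a sequence of `R`-linear maps, being eventually in `𝔪^N` need only be checked on `V`. -/
theorem eventually_mem_filt {F : ℕ → (Cpl 𝕜 R V →ₗ[R] Cpl 𝕜 R W)} {N : ℕ}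
    (h : ∀ v, ∃ c₀, ∀ c ≥ c₀, F c (incl 𝕜 R v) ∈ filt 𝕜 R W N) (x : Cpl 𝕜 R V) :
    ∃ c₀, ∀ c ≥ c₀, F c x ∈ filt 𝕜 R W N := by
  obtain ⟨z, hz, hxz⟩ := exists_span_sub_mem_filt x N
  have h1 : ∃ c₀, ∀ c ≥ c₀, F c z ∈ filt 𝕜 R W N := by
    clear hxz
    induction hz using Submodule.span_induction with
    | mem z hz => obtain ⟨v, rfl⟩ := hz; exact h v
    | zero => exact ⟨0, fun c _ => by simp⟩
    | add a b _ _ ha hb =>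
      obtain ⟨c₁, h₁⟩ := ha
      obtain ⟨c₂, h₂⟩ := hb
      refine ⟨max c₁ c₂, fun c hc => ?_⟩
      rw [map_add]
      exact Submodule.add_mem _ (h₁ c (le_trans (le_max_left _ _) hc))
        (h₂ c (le_trans (le_max_right _ _) hc))
    | smul r a _ ha =>
      obtain ⟨c₁, h₁⟩ := ha
      exact ⟨c₁, fun c hc => by rw [map_smul]; exact Submodule.smul_mem _ _ (h₁ c hc)⟩
  obtain ⟨c₀, h₀⟩ := h1
  refine ⟨c₀, fun c hc => ?_⟩
  have h2 := Submodule.add_mem _ (map_mem_filt (F c) hxz) (h₀ c hc)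
  rwa [← map_add, sub_add_cancel] at h2

theorem sum_range_sub_mem {M : Type*} [AddCommGroup M] (P : AddSubgroup M) (F : ℕ → M)
    {c₀ : ℕ} (h : ∀ c ≥ c₀, F c ∈ P) {a b : ℕ} (ha : c₀ ≤ a) (hab : a ≤ b) :
    ∑ c ∈ Finset.range b, F c - ∑ c ∈ Finset.range a, F c ∈ P := by
  rw [← Finset.sum_Ico_eq_sub _ hab]
  exact P.sum_mem fun c hc => h c (le_trans ha (Finset.mem_Ico.1 hc).1)

/-- A series of linear maps converges if its terms tend to zero on `V`: completeness gives the
pointwise limits, and these form a linear map because limits are unique. -/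
theorem exists_linHasSum {F : ℕ → (Cpl 𝕜 R V →ₗ[R] Cpl 𝕜 R W)}
    (h : ∀ v N, ∃ c₀, ∀ c ≥ c₀, F c (incl 𝕜 R v) ∈ filt 𝕜 R W N) : ∃ G, LinHasSum F G := by
  choose c₀ hc₀ using fun (x : Cpl 𝕜 R V) (N : ℕ) => eventually_mem_filt (fun v => h v N) x
  -- the limit at `x` is the limit of the partial sums of length `b x N`, which is monotone in `N`
  let b : Cpl 𝕜 R V → ℕ → ℕ := fun x N => ∑ M ∈ Finset.range (N + 1), c₀ x M
  have hb : ∀ x N, c₀ x N ≤ b x N := fun x N =>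
    Finset.single_le_sum (f := fun M => c₀ x M) (fun _ _ => Nat.zero_le _)
      (Finset.mem_range.2 (Nat.lt_succ_self N))
  have hbm : ∀ x {M N}, M ≤ N → b x M ≤ b x N := fun x M N hMN =>
    Finset.sum_le_sum_of_subset (Finset.range_mono (by omega))
  have hlim : ∀ x, ∃ y, ∀ N, ∀ c ≥ c₀ x N,
      ∑ d ∈ Finset.range c, F d x - y ∈ filt 𝕜 R W N := by
    intro x
    obtain ⟨y, hy⟩ := IsPrecomplete.prec
      (inferInstance : IsPrecomplete (maximalIdeal R) (Cpl 𝕜 R W))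
      (f := fun N => ∑ d ∈ Finset.range (b x N), F d x) (fun {M N} hMN => by
        refine SModEq.symm (SModEq.sub_mem.2 ?_)
        exact sum_range_sub_mem (filt 𝕜 R W M).toAddSubgroup (fun d => F d x)
          (fun c hc => hc₀ x M c hc) (hb x M) (hbm x hMN))
    refine ⟨y, fun N c hc => ?_⟩
    have h1 := SModEq.sub_mem.1 (hy N)
    have h2 : ∑ d ∈ Finset.range c, F d x - ∑ d ∈ Finset.range (b x N), F d x ∈
        filt 𝕜 R W N := by
      rcases le_total (b x N) c with hle | hle
      · exact sum_range_sub_mem (filt 𝕜 R W N).toAddSubgroup (fun d => F d x)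
          (fun c hc => hc₀ x N c hc) (hb x N) hle
      · rw [← neg_sub]
        exact Submodule.neg_mem _ (sum_range_sub_mem (filt 𝕜 R W N).toAddSubgroup
          (fun d => F d x) (fun c hc => hc₀ x N c hc) hc hle)
    simpa using Submodule.add_mem _ h2 h1
  choose G hG using hlim
  have uniq : ∀ x y, (∀ N, ∃ c₁, ∀ c ≥ c₁,
      ∑ d ∈ Finset.range c, F d x - y ∈ filt 𝕜 R W N) → G x = y := by
    intro x y hy
    refine eq_of_forall_sub_mem_filt fun N => ?_
    obtain ⟨c₁, hc₁⟩ := hy N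
    have := Submodule.sub_mem _ (hc₁ _ (le_max_left c₁ (c₀ x N)))
      (hG x N _ (le_max_right c₁ (c₀ x N)))
    simpa using this
  refine ⟨{ toFun := G, map_add' := fun x y => uniq _ _ fun N => ?_,
            map_smul' := fun r x => uniq _ _ fun N => ?_ }, fun x N => ?_⟩
  · refine ⟨max (c₀ x N) (c₀ y N), fun c hc => ?_⟩
    have := Submodule.add_mem _ (hG x N c (le_trans (le_max_left _ _) hc))
      (hG y N c (le_trans (le_max_right _ _) hc))
    simpa only [map_add, Finset.sum_add_distrib, add_sub_add_comm] using this
  · refine ⟨c₀ x N, fun c hc => ?_⟩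
    have := Submodule.smul_mem _ r (hG x N c hc)
    simpa only [map_smul, Finset.smul_sum, smul_sub, RingHom.id_apply] using this
  · filter_upwards [Filter.eventually_ge_atTop (Finset.range (c₀ x N))] with T hT
    rw [SModEq.sub_mem]
    have h1 := hG x N _ le_rfl
    have h2 : ∑ d ∈ T, F d x - ∑ d ∈ Finset.range (c₀ x N), F d x ∈ filt 𝕜 R W N := by
      rw [← Finset.sum_sdiff hT, add_sub_cancel_right]
      refine Submodule.sum_mem _ fun d hd => hc₀ x N d ?_
      have := (Finset.mem_sdiff.1 hd).2
      simpa using this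
    simpa using Submodule.add_mem _ h2 h1

theorem linHasSum_linSum {F : ℕ → (Cpl 𝕜 R V →ₗ[R] Cpl 𝕜 R W)}
    (h : ∀ v N, ∃ c₀, ∀ c ≥ c₀, F c (incl 𝕜 R v) ∈ filt 𝕜 R W N) : LinHasSum F (linSum F) := by
  have := exists_linHasSum h
  rw [linSum, dif_pos this]
  exact this.choose_spec

/-- The sum of a convergent series is congruent modulo `𝔪^N` to every partial sum beyond which
all terms lie in `𝔪^N`. -/
theorem LinHasSum.sub_mem {F : ℕ → (Cpl 𝕜 R V →ₗ[R] Cpl 𝕜 R W)} {G : Cpl 𝕜 R V →ₗ[R] Cpl 𝕜 R W}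
    (h : LinHasSum F G) {x : Cpl 𝕜 R V} {N c₀ : ℕ} (h₀ : ∀ c ≥ c₀, F c x ∈ filt 𝕜 R W N) :
    G x - ∑ c ∈ Finset.range c₀, F c x ∈ filt 𝕜 R W N := by
  obtain ⟨T, hT1, hT2⟩ := ((h x N).and
    (Filter.eventually_ge_atTop (Finset.range c₀))).exists
  have h1 := SModEq.sub_mem.1 hT1.symm
  have h2 : ∑ d ∈ T, F d x - ∑ d ∈ Finset.range c₀, F d x ∈ filt 𝕜 R W N := by
    rw [← Finset.sum_sdiff hT2, add_sub_cancel_right]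
    refine Submodule.sum_mem _ fun d hd => h₀ d ?_
    have := (Finset.mem_sdiff.1 hd).2
    simpa using this
  simpa using Submodule.add_mem _ h1 h2

end Series

/-! ### Words in the graded symmetric algebra -/

section Words

variable {𝕜 U : Type*} [Field 𝕜] [AddCommGroup U] [Module 𝕜 U] {𝒰 : ℤ → Submodule 𝕜 U}

variable (𝒰) in
/-- `IsWord 𝒰 n d x`: the element `x` of `S(U)` is a product of `n` homogeneous generators whose
degrees add up to `d`. -/
inductive IsWord : ℕ → ℤ → SymAlg 𝒰 → Prop
  | one : IsWord 0 0 1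
  | gen_mul {n : ℕ} {d e : ℤ} {u : U} {x : SymAlg 𝒰} (hu : u ∈ 𝒰 d) (hx : IsWord n e x) :
      IsWord (n + 1) (d + e) (gen 𝒰 u * x)

theorem isWord_ofFn {n : ℕ} {e : Fin n → ℤ} {u : Fin n → U} (hu : ∀ p, u p ∈ 𝒰 (e p)) :
    IsWord 𝒰 n (∑ p, e p) (List.ofFn fun p => gen 𝒰 (u p)).prod := by
  induction n with
  | zero => simpa using IsWord.one
  | succ n ih =>
    rw [Fin.sum_univ_succ, List.ofFn_succ, List.prod_cons]
    exact IsWord.gen_mul (hu 0) (ih fun p => hu p.succ)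

theorem IsWord.exists_ofFn {n : ℕ} {d : ℤ} {x : SymAlg 𝒰} (hx : IsWord 𝒰 n d x) :
    ∃ (e : Fin n → ℤ) (u : Fin n → U), (∀ p, u p ∈ 𝒰 (e p)) ∧ ∑ p, e p = d ∧
      x = (List.ofFn fun p => gen 𝒰 (u p)).prod := by
  induction hx with
  | one => exact ⟨Fin.elim0, Fin.elim0, fun p => p.elim0, by simp, by simp⟩
  | @gen_mul n d e u x hu hx ih =>
    obtain ⟨e', u', h1, h2, h3⟩ := ih
    refine ⟨Fin.cons d e', Fin.cons u u', fun p => ?_, ?_, ?_⟩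
    · refine Fin.cases ?_ (fun p => ?_) p
      · simpa using hu
      · simpa using h1 p
    · simp [Fin.sum_univ_succ, h2]
    · simp [h3]

theorem IsWord.mul {n m : ℕ} {d e : ℤ} {x y : SymAlg 𝒰} (hx : IsWord 𝒰 n d x)
    (hy : IsWord 𝒰 m e y) : IsWord 𝒰 (n + m) (d + e) (x * y) := by
  induction hx with
  | one => simpa using hy
  | gen_mul hu _ ih =>
    rw [mul_assoc, Nat.add_right_comm, add_assoc (_ : ℤ)]
    exact IsWord.gen_mul hu ih

/-- Moving a generator across a word costs the Koszul sign of the degrees. -/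
theorem gen_mul_word {n : ℕ} {d p : ℤ} {u : U} {x : SymAlg 𝒰} (hu : u ∈ 𝒰 p)
    (hx : IsWord 𝒰 n d x) : gen 𝒰 u * x = (p * d).negOnePow • (x * gen 𝒰 u) := by
  induction hx with
  | one => simp
  | gen_mul hv _ ih =>
    rw [← mul_assoc, gen_mul_gen hu hv, smul_mul_assoc, mul_assoc, ih, mul_smul_comm, smul_smul,
      mul_add, Int.negOnePow_add, mul_assoc]

theorem IsWord.mul_comm {n m : ℕ} {d e : ℤ} {x y : SymAlg 𝒰} (hx : IsWord 𝒰 n d x)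
    (hy : IsWord 𝒰 m e y) : x * y = (d * e).negOnePow • (y * x) := by
  induction hx with
  | one => simp
  | gen_mul hu _ ih =>
    rw [mul_assoc, ih, mul_smul_comm, ← mul_assoc, gen_mul_word hu hy, smul_mul_assoc, smul_smul,
      add_mul, Int.negOnePow_add, mul_assoc, _root_.mul_comm (Int.negOnePow _)]

/-- A submodule of `S(U)` that contains `1` and is stable under multiplication by generators
is everything. -/
theorem eq_top_of_gen_mul_mem (S : Submodule 𝕜 (SymAlg 𝒰)) (h1 : (1 : SymAlg 𝒰) ∈ S)
    (hS : ∀ u, ∀ x ∈ S, gen 𝒰 u * x ∈ S) : S = ⊤ := by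
  refine eq_top_iff.2 fun x _ => ?_
  obtain ⟨a, rfl⟩ := RingQuot.mkAlgHom_surjective 𝕜 (SymRel 𝒰) x
  have key : ∀ y ∈ S, symMk 𝒰 a * y ∈ S := by
    clear * - hS
    induction a using TensorAlgebra.induction with
    | algebraMap r =>
      intro y hy
      rw [AlgHom.commutes, ← Algebra.smul_def]
      exact S.smul_mem _ hy
    | ι u => exact hS u
    | mul a b ha hb =>
      intro y hy
      rw [map_mul, mul_assoc]
      exact ha _ (hb _ hy)
    | add a b ha hb =>
      intro y hy
      rw [map_add, add_mul]
      exact S.add_mem (ha _ hy) (hb _ hy)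
  have h := key 1 h1
  rwa [mul_one] at h

theorem mem_span_words [DirectSum.Decomposition 𝒰] (x : SymAlg 𝒰) :
    x ∈ Submodule.span 𝕜 {x | ∃ n d, IsWord 𝒰 n d x} := by
  have : Submodule.span 𝕜 {x | ∃ n d, IsWord 𝒰 n d x} = ⊤ := by
    refine eq_top_of_gen_mul_mem _ (Submodule.subset_span ⟨0, 0, IsWord.one⟩) fun u x hx => ?_
    induction u using DirectSum.Decomposition.inductionOn 𝒰 with
    | zero => simp
    | @homogeneous q u =>
      induction hx using Submodule.span_induction with
      | mem x hx =>
        obtain ⟨n, d, hx⟩ := hx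
        exact Submodule.subset_span ⟨_, _, IsWord.gen_mul u.2 hx⟩
      | zero => simp
      | add a b _ _ ha hb => rw [mul_add]; exact Submodule.add_mem _ ha hb
      | smul c a _ ha => rw [mul_smul_comm]; exact Submodule.smul_mem _ _ ha
    | add u v hu hv => rw [map_add, add_mul]; exact Submodule.add_mem _ hu hv
  rw [this]
  trivial

/-- A linear map out of `S(U)` is determined by its values on words. -/
theorem lin_ext [DirectSum.Decomposition 𝒰] {M : Type*} [AddCommGroup M] [Module 𝕜 M]
    {F G : SymAlg 𝒰 →ₗ[𝕜] M} (h : ∀ n d x, IsWord 𝒰 n d x → F x = G x) : F = G := by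
  refine LinearMap.ext fun x => ?_
  induction mem_span_words x using Submodule.span_induction with
  | mem x hx => obtain ⟨n, d, hx⟩ := hx; exact h n d x hx
  | zero => simp
  | add a b _ _ ha hb => rw [map_add, map_add, ha, hb]
  | smul c a _ ha => rw [map_smul, map_smul, ha]

/-- The elements of degree `d` are the combinations of words of degree `d`. -/
theorem symDeg_eq_span (d : ℤ) :
    symDeg 𝒰 d = Submodule.span 𝕜 {x | ∃ n, IsWord 𝒰 n d x} := by
  rw [symDeg]
  congr 1
  ext x
  constructor
  · rintro ⟨n, e, u, hu, rfl, rfl⟩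
    exact ⟨n, isWord_ofFn hu⟩
  · rintro ⟨n, hx⟩
    obtain ⟨e, u, h1, h2, h3⟩ := hx.exists_ofFn
    exact ⟨n, e, u, h1, h2, h3⟩

theorem IsWord.mem_symDeg {n : ℕ} {d : ℤ} {x : SymAlg 𝒰} (hx : IsWord 𝒰 n d x) :
    x ∈ symDeg 𝒰 d := by
  rw [symDeg_eq_span]
  exact Submodule.subset_span ⟨n, hx⟩

theorem IsWord.mem_symPow {n : ℕ} {d : ℤ} {x : SymAlg 𝒰} (hx : IsWord 𝒰 n d x) :
    x ∈ symPow 𝒰 n := by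
  obtain ⟨e, u, h1, h2, h3⟩ := hx.exists_ofFn
  exact Submodule.subset_span ⟨u, h3⟩

theorem symProj_of_mem (n m : ℕ) {x : SymAlg 𝒰} (hx : x ∈ symPow 𝒰 n) :
    symProj 𝒰 m x = if n = m then x else 0 := by
  induction hx using Submodule.span_induction with
  | mem x hx => obtain ⟨u, rfl⟩ := hx; exact symProj_prod 𝒰 m n u
  | zero => simp
  | add a b _ _ ha hb => rw [map_add, ha, hb]; split_ifs <;> simp
  | smul c a _ ha => rw [map_smul, ha]; split_ifs <;> simp

theorem symProj_word {n : ℕ} {d : ℤ} {x : SymAlg 𝒰} (hx : IsWord 𝒰 n d x) (m : ℕ) :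
    symProj 𝒰 m x = if n = m then x else 0 :=
  symProj_of_mem n m hx.mem_symPow

end Words

/-! ### The coalgebra structure of `S(U)` -/

section CoalgebraStructure

variable {𝕜 U : Type*} [Field 𝕜] [AddCommGroup U] [Module 𝕜 U] {𝒰 : ℤ → Submodule 𝕜 U}
  [DirectSum.Decomposition 𝒰]

/-- The automorphism `twist d` records the sign of moving an element of degree `d` across a word. -/
theorem twist_word {n : ℕ} {e : ℤ} {x : SymAlg 𝒰} (hx : IsWord 𝒰 n e x) (d : ℤ) :
    twist 𝒰 d x = (d * e).negOnePow • x := by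
  induction hx with
  | one => simp
  | gen_mul hu _ ih =>
    rw [map_mul, twist_gen 𝒰 d hu, ih, smul_mul_smul_comm, mul_add, Int.negOnePow_add]

theorem comul_twist (d : ℤ) (x : SymAlg 𝒰) : comul 𝒰 (twist 𝒰 d x) =
    TensorProduct.map (twist 𝒰 d).toLinearMap (twist 𝒰 d).toLinearMap (comul 𝒰 x) := by
  have : comul 𝒰 ∘ₗ (twist 𝒰 d).toLinearMap =
      TensorProduct.map (twist 𝒰 d).toLinearMap (twist 𝒰 d).toLinearMap ∘ₗ comul 𝒰 := by
    refine lin_ext fun n e x hx => ?_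
    induction hx with
    | one => simp [comul_one]
    | @gen_mul n q e u x hu _ ih =>
      simp only [LinearMap.comp_apply, AlgHom.toLinearMap_apply] at ih ⊢
      rw [map_mul, twist_gen 𝒰 d hu, smul_mul_assoc, Units.smul_def, map_zsmul,
        comul_gen_mul 𝒰 hu, comul_gen_mul 𝒰 hu, ih]
      generalize comul 𝒰 x = z
      induction z using TensorProduct.induction_on with
      | zero => simp
      | tmul a b =>
        simp only [TensorProduct.map_tmul, insertDeg_tmul, map_add, AlgHom.toLinearMap_apply,
          map_mul, twist_gen 𝒰 d hu, Units.smul_def, smul_mul_assoc,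
          TensorProduct.tmul_smul, ← TensorProduct.smul_tmul', smul_add]
        rw [twist_twist]
      | add a b ha hb => simp only [map_add, smul_add, ha, hb]
  exact LinearMap.congr_fun this x

theorem counit_gen (u : U) : counit 𝒰 (gen 𝒰 u) = 0 := by
  simp [counit]

theorem counit_word {n : ℕ} {d : ℤ} {x : SymAlg 𝒰} (hx : IsWord 𝒰 n d x) (hn : n ≠ 0) :
    counit 𝒰 x = 0 := by
  cases hx with
  | one => exact absurd rfl hn
  | gen_mul hu _ => rw [map_mul, counit_gen, zero_mul]

theorem counit_twist (d : ℤ) (x : SymAlg 𝒰) : counit 𝒰 (twist 𝒰 d x) = counit 𝒰 x := by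
  have : (counit 𝒰).toLinearMap ∘ₗ (twist 𝒰 d).toLinearMap = (counit 𝒰).toLinearMap := by
    refine lin_ext fun n e x hx => ?_
    induction hx with
    | one => simp
    | gen_mul hu _ _ => simp [twist_gen 𝒰 d hu, counit_gen, Units.smul_def]
  exact LinearMap.congr_fun this x

theorem comul_coassoc : (TensorProduct.assoc 𝕜 (SymAlg 𝒰) (SymAlg 𝒰) (SymAlg 𝒰)).toLinearMap ∘ₗ
    (comul 𝒰).rTensor (SymAlg 𝒰) ∘ₗ comul 𝒰 = (comul 𝒰).lTensor (SymAlg 𝒰) ∘ₗ comul 𝒰 := by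
  refine lin_ext fun n e x hx => ?_
  induction hx with
  | one => simp [comul_one]
  | @gen_mul n q e u x hu _ ih =>
    -- `u` acts on both triple coproducts through `u ⊗ 1 ⊗ 1 + 1 ⊗ u ⊗ 1 + 1 ⊗ 1 ⊗ u`
    let τ := (twist 𝒰 q).toLinearMap
    let m := LinearMap.mulLeft 𝕜 (gen 𝒰 u)
    let K : SymAlg 𝒰 ⊗[𝕜] (SymAlg 𝒰 ⊗[𝕜] SymAlg 𝒰) →ₗ[𝕜] _ :=
      TensorProduct.map m LinearMap.id + TensorProduct.map τ (insertDeg 𝒰 q u)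
    have hL : ∀ z, (TensorProduct.assoc 𝕜 (SymAlg 𝒰) (SymAlg 𝒰) (SymAlg 𝒰))
        ((comul 𝒰).rTensor (SymAlg 𝒰) (insertDeg 𝒰 q u z)) =
        K ((TensorProduct.assoc 𝕜 (SymAlg 𝒰) (SymAlg 𝒰) (SymAlg 𝒰))
          ((comul 𝒰).rTensor (SymAlg 𝒰) z)) := by
      intro z
      induction z using TensorProduct.induction_on with
      | zero => simp
      | tmul a b =>
        rw [insertDeg_tmul, map_add, LinearMap.rTensor_tmul, LinearMap.rTensor_tmul,
          LinearMap.rTensor_tmul, comul_gen_mul 𝒰 hu, comul_twist]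
        generalize comul 𝒰 a = y
        induction y using TensorProduct.induction_on with
        | zero => simp
        | tmul c d =>
          simp [insertDeg_tmul, TensorProduct.add_tmul, TensorProduct.tmul_add, K, τ, m, add_assoc]
        | add c d hc hd =>
          simp only [map_add, TensorProduct.add_tmul] at hc hd ⊢
          rw [← hc, ← hd]
          abel
      | add a b ha hb => simp only [map_add, ha, hb]
    have hR : ∀ z, (comul 𝒰).lTensor (SymAlg 𝒰) (insertDeg 𝒰 q u z) =
        K ((comul 𝒰).lTensor (SymAlg 𝒰) z) := by
      intro z
      induction z using TensorProduct.induction_on with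
      | zero => simp
      | tmul a b =>
        simp [insertDeg_tmul, comul_gen_mul 𝒰 hu, K, τ, m]
      | add a b ha hb => simp only [map_add, ha, hb]
    simp only [LinearMap.comp_apply, LinearEquiv.coe_coe] at ih ⊢
    rw [comul_gen_mul 𝒰 hu, hL, hR, ih]

/-- The coalgebra `S(U)`, in which the elements of `U` are primitive. -/
instance : Coalgebra 𝕜 (SymAlg 𝒰) where
  comul := comul 𝒰
  counit := (counit 𝒰).toLinearMap
  coassoc := comul_coassoc
  rTensor_counit_comp_comul := by
    refine lin_ext fun n e x hx => ?_
    induction hx with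
    | one => simp [comul_one]
    | @gen_mul n q e u x hu _ ih =>
      have : ∀ z, (counit 𝒰).toLinearMap.rTensor (SymAlg 𝒰) (insertDeg 𝒰 q u z) =
          (LinearMap.mulLeft 𝕜 (gen 𝒰 u)).lTensor 𝕜
            ((counit 𝒰).toLinearMap.rTensor (SymAlg 𝒰) z) := by
        intro z
        induction z using TensorProduct.induction_on with
        | zero => simp
        | tmul a b => simp [insertDeg_tmul, counit_gen, counit_twist]
        | add a b ha hb => simp only [map_add, ha, hb]
      simp only [LinearMap.comp_apply] at ih ⊢
      rw [comul_gen_mul 𝒰 hu, this, ih]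
      simp
  lTensor_counit_comp_comul := by
    refine lin_ext fun n e x hx => ?_
    induction hx with
    | one => simp [comul_one]
    | @gen_mul n q e u x hu _ ih =>
      have : ∀ z, (counit 𝒰).toLinearMap.lTensor (SymAlg 𝒰) (insertDeg 𝒰 q u z) =
          (LinearMap.mulLeft 𝕜 (gen 𝒰 u)).rTensor 𝕜
            ((counit 𝒰).toLinearMap.lTensor (SymAlg 𝒰) z) := by
        intro z
        induction z using TensorProduct.induction_on with
        | zero => simp
        | tmul a b => simp [insertDeg_tmul, counit_gen]
        | add a b ha hb => simp only [map_add, ha, hb]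
      simp only [LinearMap.comp_apply] at ih ⊢
      rw [comul_gen_mul 𝒰 hu, this, ih]
      simp

/-- The comultiplication of a word is a sum of tensors of words whose lengths and degrees add up
to those of the given word. -/
theorem comul_word_mem {n : ℕ} {d : ℤ} {x : SymAlg 𝒰} (hx : IsWord 𝒰 n d x) :
    comul 𝒰 x ∈ Submodule.span 𝕜 {z | ∃ n₁ n₂ d₁ d₂ a b, n₁ + n₂ = n ∧ d₁ + d₂ = d ∧
      IsWord 𝒰 n₁ d₁ a ∧ IsWord 𝒰 n₂ d₂ b ∧ z = a ⊗ₜ[𝕜] b} := by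
  induction hx with
  | one =>
    rw [comul_one]
    exact Submodule.subset_span ⟨0, 0, 0, 0, 1, 1, rfl, by simp, IsWord.one, IsWord.one, rfl⟩
  | @gen_mul n q e u x hu _ ih =>
    rw [comul_gen_mul 𝒰 hu]
    generalize comul 𝒰 x = z at ih
    induction ih using Submodule.span_induction with
    | mem z hz =>
      obtain ⟨n₁, n₂, d₁, d₂, a, b, rfl, rfl, ha, hb, rfl⟩ := hz
      rw [insertDeg_tmul, twist_word ha, Units.smul_def, ← TensorProduct.smul_tmul']
      refine Submodule.add_mem _ (Submodule.subset_span ?_)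
        (zsmul_mem (Submodule.subset_span ?_) _)
      · exact ⟨n₁ + 1, n₂, q + d₁, d₂, _, _, by omega, by ring, ha.gen_mul hu, hb, rfl⟩
      · exact ⟨n₁, n₂ + 1, d₁, q + d₂, _, _, by omega, by ring, ha, hb.gen_mul hu, rfl⟩
    | zero => simp
    | add a b _ _ ha hb => rw [map_add]; exact Submodule.add_mem _ ha hb
    | smul c a _ ha => rw [map_smul]; exact Submodule.smul_mem _ _ ha

/-- Graded cocommutativity: a bilinear map `B` and the bilinear map `B'` obtained from it by
exchanging the arguments with the Koszul sign have the same value on `δ(x)`. -/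
theorem lift_comul_eq_of_graded_symm {M : Type*} [AddCommGroup M] [Module 𝕜 M]
    {B B' : SymAlg 𝒰 →ₗ[𝕜] SymAlg 𝒰 →ₗ[𝕜] M}
    (h : ∀ {n m d e a b}, IsWord 𝒰 n d a → IsWord 𝒰 m e b →
      B a b = (d * e).negOnePow • B' b a) (x : SymAlg 𝒰) :
    TensorProduct.lift B (comul 𝒰 x) = TensorProduct.lift B' (comul 𝒰 x) := by
  have : TensorProduct.lift B ∘ₗ comul 𝒰 = TensorProduct.lift B' ∘ₗ comul 𝒰 := by
    refine lin_ext fun n e x hx => ?_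
    induction hx generalizing B B' with
    | one => simpa [comul_one] using h IsWord.one IsWord.one
    | @gen_mul n q e u x hu _ ih =>
      let τ := (twist 𝒰 q).toLinearMap
      let m := LinearMap.mulLeft 𝕜 (gen 𝒰 u)
      -- precomposition with the action of `u` yields another pair of this kind
      have key : ∀ (B : SymAlg 𝒰 →ₗ[𝕜] SymAlg 𝒰 →ₗ[𝕜] M) z,
          TensorProduct.lift B (insertDeg 𝒰 q u z) =
          TensorProduct.lift (B ∘ₗ m + B.compl₁₂ τ m) z := by
        intro B z
        induction z using TensorProduct.induction_on with
        | zero => simp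
        | tmul a b => simp [insertDeg_tmul, τ, m]
        | add a b ha hb => simp only [map_add, ha, hb]
      simp only [LinearMap.comp_apply] at ih ⊢
      rw [comul_gen_mul 𝒰 hu, key, key]
      refine ih fun {n m' d e a b} ha hb => ?_
      simp only [LinearMap.add_apply, LinearMap.comp_apply, LinearMap.compl₁₂_apply, τ, m,
        LinearMap.mulLeft_apply, AlgHom.toLinearMap_apply, twist_word ha, twist_word hb]
      rw [h (ha.gen_mul hu) hb]
      simp only [Units.smul_def, map_zsmul, LinearMap.smul_apply]
      simp only [← Units.smul_def]
      rw [h ha (hb.gen_mul hu), smul_add, smul_smul, smul_smul, add_comm]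
      congr 2
      · rw [mul_add, Int.negOnePow_add, mul_comm d q, ← mul_assoc, Int.units_mul_self, one_mul]
      · rw [add_mul, Int.negOnePow_add, mul_comm]
  exact LinearMap.congr_fun this x

end CoalgebraStructure

/-! ### Functoriality of `S(U)` -/

section SymMap

variable {𝕜 U U' U'' : Type*} [Field 𝕜] [AddCommGroup U] [Module 𝕜 U] [AddCommGroup U']
  [Module 𝕜 U'] [AddCommGroup U''] [Module 𝕜 U'']
  (𝒰 : ℤ → Submodule 𝕜 U) (𝒰' : ℤ → Submodule 𝕜 U') {𝒰'' : ℤ → Submodule 𝕜 U''}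

/-- The algebra morphism `S(U) → S(U')` induced by a linear map of degree zero. -/
def symMap (φ : U →ₗ[𝕜] U') (hφ : ∀ d, ∀ u ∈ 𝒰 d, φ u ∈ 𝒰' d) : SymAlg 𝒰 →ₐ[𝕜] SymAlg 𝒰' :=
  symLift (gen 𝒰' ∘ₗ φ) fun p q u v hu hv => gen_mul_gen (hφ p u hu) (hφ q v hv)

variable {𝒰 𝒰'}

@[simp]
theorem symMap_gen (φ : U →ₗ[𝕜] U') (hφ : ∀ d, ∀ u ∈ 𝒰 d, φ u ∈ 𝒰' d) (u : U) :
    symMap 𝒰 𝒰' φ hφ (gen 𝒰 u) = gen 𝒰' (φ u) := by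
  simp [symMap]

theorem symMap_word {φ : U →ₗ[𝕜] U'} {hφ : ∀ d, ∀ u ∈ 𝒰 d, φ u ∈ 𝒰' d} {n : ℕ} {d : ℤ}
    {x : SymAlg 𝒰} (hx : IsWord 𝒰 n d x) : IsWord 𝒰' n d (symMap 𝒰 𝒰' φ hφ x) := by
  induction hx with
  | one => simpa using IsWord.one
  | gen_mul hu _ ih =>
    rw [map_mul, symMap_gen]
    exact ih.gen_mul (hφ _ _ hu)

variable [DirectSum.Decomposition 𝒰] [DirectSum.Decomposition 𝒰']

theorem symMap_twist {φ : U →ₗ[𝕜] U'} {hφ : ∀ d, ∀ u ∈ 𝒰 d, φ u ∈ 𝒰' d} (d : ℤ) (x : SymAlg 𝒰) :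
    symMap 𝒰 𝒰' φ hφ (twist 𝒰 d x) = twist 𝒰' d (symMap 𝒰 𝒰' φ hφ x) := by
  have : (symMap 𝒰 𝒰' φ hφ).toLinearMap ∘ₗ (twist 𝒰 d).toLinearMap =
      (twist 𝒰' d).toLinearMap ∘ₗ (symMap 𝒰 𝒰' φ hφ).toLinearMap := by
    refine lin_ext fun n e x hx => ?_
    simp only [LinearMap.comp_apply, AlgHom.toLinearMap_apply]
    rw [twist_word hx, twist_word (symMap_word hx), Units.smul_def, Units.smul_def,
      map_zsmul]
  exact LinearMap.congr_fun this x

theorem counit_symMap (φ : U →ₗ[𝕜] U') (hφ : ∀ d, ∀ u ∈ 𝒰 d, φ u ∈ 𝒰' d) (x : SymAlg 𝒰) :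
    counit 𝒰' (symMap 𝒰 𝒰' φ hφ x) = counit 𝒰 x := by
  have : (counit 𝒰').comp (symMap 𝒰 𝒰' φ hφ) = counit 𝒰 :=
    symAlg_hom_ext fun u => by simp [counit]
  exact DFunLike.congr_fun this x

theorem comul_symMap (φ : U →ₗ[𝕜] U') (hφ : ∀ d, ∀ u ∈ 𝒰 d, φ u ∈ 𝒰' d) :
    comul 𝒰' ∘ₗ (symMap 𝒰 𝒰' φ hφ).toLinearMap =
      TensorProduct.map (symMap 𝒰 𝒰' φ hφ).toLinearMap (symMap 𝒰 𝒰' φ hφ).toLinearMap ∘ₗ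
        comul 𝒰 := by
  refine lin_ext fun n e x hx => ?_
  induction hx with
  | one => simp [comul_one]
  | @gen_mul n q e u x hu _ ih =>
    simp only [LinearMap.comp_apply, AlgHom.toLinearMap_apply] at ih ⊢
    rw [map_mul, symMap_gen, comul_gen_mul 𝒰 hu, comul_gen_mul 𝒰' (hφ _ _ hu), ih]
    generalize comul 𝒰 x = z
    induction z using TensorProduct.induction_on with
    | zero => simp
    | tmul a b => simp [insertDeg_tmul, symMap_twist]
    | add a b ha hb => simp only [map_add, ha, hb]

theorem symMap_comp (φ : U →ₗ[𝕜] U') (hφ : ∀ d, ∀ u ∈ 𝒰 d, φ u ∈ 𝒰' d)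
    (ψ : U' →ₗ[𝕜] U'') (hψ : ∀ d, ∀ u ∈ 𝒰' d, ψ u ∈ 𝒰'' d)
    (χ : U →ₗ[𝕜] U'') (hχ : ∀ d, ∀ u ∈ 𝒰 d, χ u ∈ 𝒰'' d) (h : ∀ u, ψ (φ u) = χ u) :
    (symMap 𝒰' 𝒰'' ψ hψ).toLinearMap ∘ₗ (symMap 𝒰 𝒰' φ hφ).toLinearMap =
      (symMap 𝒰 𝒰'' χ hχ).toLinearMap := by
  have : (symMap 𝒰' 𝒰'' ψ hψ).comp (symMap 𝒰 𝒰' φ hφ) = symMap 𝒰 𝒰'' χ hχ :=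
    symAlg_hom_ext fun u => by simp [h]
  rw [← this, AlgHom.comp_toLinearMap]

/-- For complementary projections `q` and `p` of `U` (the latter with section `i`), the
comultiplication followed by `S(q) ⊗ S(p)` separates the factors of `S(q)(a) · S(i)(b)`. -/
theorem separate_comul_mul (q : U →ₗ[𝕜] U) (hq : ∀ d, ∀ u ∈ 𝒰 d, q u ∈ 𝒰 d)
    (p : U →ₗ[𝕜] U') (hp : ∀ d, ∀ u ∈ 𝒰 d, p u ∈ 𝒰' d)
    (i : U' →ₗ[𝕜] U) (hi : ∀ d, ∀ u ∈ 𝒰' d, i u ∈ 𝒰 d)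
    (hqq : ∀ u, q (q u) = q u) (hpq : ∀ u, p (q u) = 0) (hqi : ∀ u, q (i u) = 0)
    (hpi : ∀ u, p (i u) = u) :
    TensorProduct.map (symMap 𝒰 𝒰 q hq).toLinearMap (symMap 𝒰 𝒰' p hp).toLinearMap ∘ₗ comul 𝒰 ∘ₗ
      LinearMap.mul' 𝕜 (SymAlg 𝒰) ∘ₗ
      TensorProduct.map (symMap 𝒰 𝒰 q hq).toLinearMap (symMap 𝒰' 𝒰 i hi).toLinearMap =
    TensorProduct.map (symMap 𝒰 𝒰 q hq).toLinearMap LinearMap.id := by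
  have hb : ∀ {n d b}, IsWord 𝒰' n d b →
      TensorProduct.map (symMap 𝒰 𝒰 q hq).toLinearMap (symMap 𝒰 𝒰' p hp).toLinearMap
        (comul 𝒰 (symMap 𝒰' 𝒰 i hi b)) = 1 ⊗ₜ b := by
    intro n d b hb
    induction hb with
    | one => simp [comul_one]
    | @gen_mul n r e u x hu _ ih =>
      have key : ∀ z, TensorProduct.map (symMap 𝒰 𝒰 q hq).toLinearMap
          (symMap 𝒰 𝒰' p hp).toLinearMap (insertDeg 𝒰 r (i u) z) =
          TensorProduct.map (twist 𝒰 r).toLinearMap (LinearMap.mulLeft 𝕜 (gen 𝒰' u))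
            (TensorProduct.map (symMap 𝒰 𝒰 q hq).toLinearMap (symMap 𝒰 𝒰' p hp).toLinearMap z) := by
        intro z
        induction z using TensorProduct.induction_on with
        | zero => simp
        | tmul a b => simp [insertDeg_tmul, symMap_twist, hqi, hpi]
        | add a b ha hb => simp only [map_add, ha, hb]
      rw [map_mul, symMap_gen, comul_gen_mul 𝒰 (hi _ _ hu), key, ih]
      simp
  have hab : ∀ {n d a}, IsWord 𝒰 n d a → ∀ {m e b}, IsWord 𝒰' m e b →
      TensorProduct.map (symMap 𝒰 𝒰 q hq).toLinearMap (symMap 𝒰 𝒰' p hp).toLinearMap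
        (comul 𝒰 (symMap 𝒰 𝒰 q hq a * symMap 𝒰' 𝒰 i hi b)) = symMap 𝒰 𝒰 q hq a ⊗ₜ b := by
    intro n d a ha m e b hb'
    induction ha with
    | one => simpa using hb hb'
    | @gen_mul n r e u x hu _ ih =>
      have key : ∀ z, TensorProduct.map (symMap 𝒰 𝒰 q hq).toLinearMap
          (symMap 𝒰 𝒰' p hp).toLinearMap (insertDeg 𝒰 r (q u) z) =
          TensorProduct.map (LinearMap.mulLeft 𝕜 (gen 𝒰 (q u))) LinearMap.id
            (TensorProduct.map (symMap 𝒰 𝒰 q hq).toLinearMap (symMap 𝒰 𝒰' p hp).toLinearMap z) := by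
        intro z
        induction z using TensorProduct.induction_on with
        | zero => simp
        | tmul a b => simp [insertDeg_tmul, hqq, hpq]
        | add a b ha hb => simp only [map_add, ha, hb]
      rw [map_mul (symMap 𝒰 𝒰 q hq), symMap_gen, mul_assoc, comul_gen_mul 𝒰 (hq _ _ hu), key, ih]
      simp
  refine TensorProduct.ext ?_
  refine lin_ext fun n d a ha => lin_ext fun m e b hb => ?_
  simpa using hab ha hb

end SymMap

/-! ### The algebra `A ⊗̂ R` -/

section CompletedAlgebra

variable {𝕜 R : Type*} [Field 𝕜] [CommRing R] [IsLocalRing R] [IsNoetherianRing R] [Algebra 𝕜 R]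
variable {A : Type*} [Ring A] [Algebra 𝕜 A]

theorem bilin_assoc (x y z : Cpl 𝕜 R A) :
    baseC 𝕜 R (LinearMap.mul' 𝕜 A) (tmulC (baseC 𝕜 R (LinearMap.mul' 𝕜 A) (tmulC x y)) z) =
      baseC 𝕜 R (LinearMap.mul' 𝕜 A) (tmulC x (baseC 𝕜 R (LinearMap.mul' 𝕜 A) (tmulC y z))) := by
  let M : Cpl 𝕜 R A →ₗ[R] Cpl 𝕜 R A →ₗ[R] Cpl 𝕜 R A :=
    tmulC.compr₂ (baseC 𝕜 R (LinearMap.mul' 𝕜 A))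
  have hM : ∀ a b : A, M (incl 𝕜 R a) (incl 𝕜 R b) = incl 𝕜 R (a * b) := fun a b => by
    simp [M, tmulC_incl, baseC_incl]
  change M (M x y) z = M x (M y z)
  have h1 : ∀ (a : A) y z, M (M (incl 𝕜 R a) y) z = M (incl 𝕜 R a) (M y z) := fun a y z =>
    bilin_ext (B := M ∘ₗ M (incl 𝕜 R a)) (B' := M.compr₂ (M (incl 𝕜 R a)))
      (fun b c => by simp [hM, mul_assoc]) y z
  have h2 : (M.flip z) ∘ₗ (M.flip y) = M.flip (M y z) :=
    hom_ext fun a => by simpa using h1 a y z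
  exact LinearMap.congr_fun h2 x

/-- The multiplication of `A ⊗̂ R` is the continuous `R`-bilinear extension of that of `A`. -/
instance cplRing : Ring (Cpl 𝕜 R A) :=
  { __ := (inferInstance : AddCommGroup (Cpl 𝕜 R A))
    mul := fun x y => baseC 𝕜 R (LinearMap.mul' 𝕜 A) (tmulC x y)
    one := incl 𝕜 R 1
    left_distrib := fun x y z => by
      change baseC 𝕜 R (LinearMap.mul' 𝕜 A) (tmulC x (y + z)) = _
      rw [map_add, map_add]
      rfl
    right_distrib := fun x y z => by
      change baseC 𝕜 R (LinearMap.mul' 𝕜 A) (tmulC (x + y) z) = _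
      rw [map_add, LinearMap.add_apply, map_add]
      rfl
    zero_mul := fun x => by
      change baseC 𝕜 R (LinearMap.mul' 𝕜 A) (tmulC 0 x) = _
      rw [map_zero, LinearMap.zero_apply, map_zero]
    mul_zero := fun x => by
      change baseC 𝕜 R (LinearMap.mul' 𝕜 A) (tmulC x 0) = _
      rw [map_zero, map_zero]
    mul_assoc := bilin_assoc
    one_mul := fun x => by
      have : baseC 𝕜 R (LinearMap.mul' 𝕜 A) ∘ₗ tmulC (incl 𝕜 R 1) = LinearMap.id :=
        hom_ext fun a => by simp [tmulC_incl, baseC_incl]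
      exact LinearMap.congr_fun this x
    mul_one := fun x => by
      have : baseC 𝕜 R (LinearMap.mul' 𝕜 A) ∘ₗ tmulC.flip (incl 𝕜 R 1) = LinearMap.id :=
        hom_ext fun a => by simp [tmulC_incl, baseC_incl]
      exact LinearMap.congr_fun this x }

theorem mul_def (x y : Cpl 𝕜 R A) :
    x * y = baseC 𝕜 R (LinearMap.mul' 𝕜 A) (tmulC x y) := rfl

theorem one_def : (1 : Cpl 𝕜 R A) = incl 𝕜 R 1 := rfl

/-- The `𝕜`-algebra structure that underlies the `R`-algebra `A ⊗̂ R`. -/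
instance cplAlgebra : Algebra 𝕜 (Cpl 𝕜 R A) :=
  Algebra.ofModule
    (fun c x y => by rw [mul_def, tmulC_smul_left, map_smul_field, mul_def])
    (fun c x y => by rw [mul_def, tmulC_smul_right, map_smul_field, mul_def])

theorem mul_mem_filt {a b : ℕ} {x y : Cpl 𝕜 R A} (hx : x ∈ filt 𝕜 R A a) (hy : y ∈ filt 𝕜 R A b) :
    x * y ∈ filt 𝕜 R A (a + b) :=
  map_mem_filt _ (tmulC_mem_filt hx hy)

end CompletedAlgebra

/-! ### The convolution ring and its filtration -/

section ConvolutionRing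

variable {𝕜 R : Type*} [Field 𝕜] [CommRing R] [IsLocalRing R] [IsNoetherianRing R] [Algebra 𝕜 R]
variable {U₁ U₂ U₃ : Type*} [AddCommGroup U₁] [Module 𝕜 U₁] [AddCommGroup U₂] [Module 𝕜 U₂]
  [AddCommGroup U₃] [Module 𝕜 U₃]
variable {𝒰₁ : ℤ → Submodule 𝕜 U₁} {𝒰₂ : ℤ → Submodule 𝕜 U₂} {𝒰₃ : ℤ → Submodule 𝕜 U₃}

variable (𝕜 R 𝒰₁ 𝒰₂) in
/-- The convolution ring of linear maps from the coalgebra `S(U₁)` to the algebra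
`S(U₂) ⊗̂ R`. -/
def ConvRing : Type _ := WithConv (SymAlg 𝒰₁ →ₗ[𝕜] Cpl 𝕜 R (SymAlg 𝒰₂))

instance [DirectSum.Decomposition 𝒰₁] : Ring (ConvRing 𝕜 R 𝒰₁ 𝒰₂) :=
  inferInstanceAs (Ring (WithConv (SymAlg 𝒰₁ →ₗ[𝕜] Cpl 𝕜 R (SymAlg 𝒰₂))))

instance [DirectSum.Decomposition 𝒰₁] : Algebra 𝕜 (ConvRing 𝕜 R 𝒰₁ 𝒰₂) :=
  inferInstanceAs (Algebra 𝕜 (WithConv (SymAlg 𝒰₁ →ₗ[𝕜] Cpl 𝕜 R (SymAlg 𝒰₂))))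

variable [DirectSum.Decomposition 𝒰₁]

/-- The value of an element of the convolution ring at `x`. -/
def evalAt (x : SymAlg 𝒰₁) : ConvRing 𝕜 R 𝒰₁ 𝒰₂ →+ Cpl 𝕜 R (SymAlg 𝒰₂) where
  toFun φ := WithConv.ofConv φ x
  map_zero' := rfl
  map_add' _ _ := rfl

/-- An element of `Lin_R(S(U₁), S(U₂))`, regarded as an element of the convolution ring. -/
def toRing : Lin 𝕜 R 𝒰₁ 𝒰₂ →+ ConvRing 𝕜 R 𝒰₁ 𝒰₂ where
  toFun f := WithConv.toConv (f.restrictScalars 𝕜 ∘ₗ incl 𝕜 R)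
  map_zero' := rfl
  map_add' _ _ := rfl

@[simp]
theorem evalAt_toRing (f : Lin 𝕜 R 𝒰₁ 𝒰₂) (x : SymAlg 𝒰₁) :
    evalAt x (toRing f) = f (incl 𝕜 R x) := rfl

theorem evalAt_smul (x : SymAlg 𝒰₁) (c : 𝕜) (φ : ConvRing 𝕜 R 𝒰₁ 𝒰₂) :
    evalAt x (c • φ) = c • evalAt x φ := rfl

/-- The product is convolution: comultiply, apply the two maps, and multiply. -/
theorem evalAt_mul (x : SymAlg 𝒰₁) (φ ψ : ConvRing 𝕜 R 𝒰₁ 𝒰₂) :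
    evalAt x (φ * ψ) = LinearMap.mul' 𝕜 (Cpl 𝕜 R (SymAlg 𝒰₂))
      (TensorProduct.map (WithConv.ofConv φ) (WithConv.ofConv ψ) (comul 𝒰₁ x)) := rfl

theorem evalAt_one (x : SymAlg 𝒰₁) :
    evalAt x (1 : ConvRing 𝕜 R 𝒰₁ 𝒰₂) = algebraMap 𝕜 _ (counit 𝒰₁ x) := rfl

theorem convRing_ext {φ ψ : ConvRing 𝕜 R 𝒰₁ 𝒰₂} (h : ∀ x, evalAt x φ = evalAt x ψ) : φ = ψ :=
  WithConv.ofConv_injective (LinearMap.ext h)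

theorem convRing_ext_word {φ ψ : ConvRing 𝕜 R 𝒰₁ 𝒰₂}
    (h : ∀ n d x, IsWord 𝒰₁ n d x → evalAt x φ = evalAt x ψ) : φ = ψ :=
  WithConv.ofConv_injective (lin_ext h)

theorem toRing_injective : Function.Injective (toRing (𝕜 := 𝕜) (R := R) (𝒰₁ := 𝒰₁) (𝒰₂ := 𝒰₂)) :=
  fun f g h => hom_ext fun v => by
    rw [← evalAt_toRing, h, evalAt_toRing]

theorem toRing_smul (c : 𝕜) (f : Lin 𝕜 R 𝒰₁ 𝒰₂) :
    toRing (algebraMap 𝕜 R c • f) = c • toRing f := by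
  refine convRing_ext fun x => ?_
  rw [evalAt_toRing, evalAt_smul, LinearMap.smul_apply, algebraMap_smul, evalAt_toRing]

variable (𝕜 R 𝒰₁ 𝒰₂) in
/-- The step `p` of the filtration of the convolution ring: the maps that send `S^n(U₁)` to
`𝔪^(p - n)`. -/
def convFilt (p : ℕ) : Submodule 𝕜 (ConvRing 𝕜 R 𝒰₁ 𝒰₂) where
  carrier := {φ | ∀ ⦃n d x⦄, IsWord 𝒰₁ n d x →
    evalAt x φ ∈ filt 𝕜 R (SymAlg 𝒰₂) (p - n)}
  add_mem' hφ hψ _ _ _ hx := by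
    rw [map_add]
    exact Submodule.add_mem _ (hφ hx) (hψ hx)
  zero_mem' _ _ _ _ := by
    rw [map_zero]
    exact Submodule.zero_mem _
  smul_mem' c _ hφ _ _ _ hx := by
    rw [evalAt_smul]
    exact smul_field_mem _ c (hφ hx)

theorem mem_convFilt_zero (φ : ConvRing 𝕜 R 𝒰₁ 𝒰₂) : φ ∈ convFilt 𝕜 R 𝒰₁ 𝒰₂ 0 :=
  fun n _ _ _ => filt_anti (Nat.zero_sub n).le (mem_filt_zero _)

theorem convFilt_anti {p q : ℕ} (h : p ≤ q) : convFilt 𝕜 R 𝒰₁ 𝒰₂ q ≤ convFilt 𝕜 R 𝒰₁ 𝒰₂ p :=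
  fun _ hφ _ _ _ hx => filt_anti (by omega) (hφ hx)

theorem convRing_apply_one_mem {φ : ConvRing 𝕜 R 𝒰₁ 𝒰₂} (h : φ ∈ convFilt 𝕜 R 𝒰₁ 𝒰₂ 1) :
    evalAt 1 φ ∈ filt 𝕜 R (SymAlg 𝒰₂) 1 := by
  have := h IsWord.one
  rwa [Nat.sub_zero] at this

/-- Only the value at `1` is constrained by the first step of the filtration. -/
theorem mem_convFilt_one {φ : ConvRing 𝕜 R 𝒰₁ 𝒰₂} (h : evalAt 1 φ ∈ filt 𝕜 R (SymAlg 𝒰₂) 1) :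
    φ ∈ convFilt 𝕜 R 𝒰₁ 𝒰₂ 1 := by
  intro n d x hx
  cases hx with
  | one => rwa [Nat.sub_zero]
  | gen_mul _ _ => exact filt_anti (N := 0) (by omega) (mem_filt_zero _)

/-- The filtration is separated. -/
theorem eq_of_forall_sub_mem_convFilt {φ ψ : ConvRing 𝕜 R 𝒰₁ 𝒰₂}
    (h : ∀ p, φ - ψ ∈ convFilt 𝕜 R 𝒰₁ 𝒰₂ p) : φ = ψ := by
  refine convRing_ext_word fun n d x hx => ?_
  refine eq_of_forall_sub_mem_filt fun N => ?_
  have := h (N + n) hx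
  rwa [Nat.add_sub_cancel, map_sub] at this

/-- The filtration is multiplicative since the comultiplication preserves the total length: a word
of length `n` yields pairs of words of lengths `n₁ + n₂ = n`. -/
theorem mul_mem_convFilt {p q : ℕ} {φ ψ : ConvRing 𝕜 R 𝒰₁ 𝒰₂} (hφ : φ ∈ convFilt 𝕜 R 𝒰₁ 𝒰₂ p)
    (hψ : ψ ∈ convFilt 𝕜 R 𝒰₁ 𝒰₂ q) : φ * ψ ∈ convFilt 𝕜 R 𝒰₁ 𝒰₂ (p + q) := by
  intro n d x hx
  rw [evalAt_mul]
  have h := comul_word_mem hx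
  generalize comul 𝒰₁ x = z at h
  induction h using Submodule.span_induction with
  | mem z hz =>
    obtain ⟨n₁, n₂, d₁, d₂, a, b, rfl, rfl, ha, hb, rfl⟩ := hz
    exact filt_anti (by omega) (mul_mem_filt (hφ ha) (hψ hb))
  | zero => simp
  | add a b _ _ ha hb => rw [map_add, map_add]; exact Submodule.add_mem _ ha hb
  | smul c a _ ha => rw [map_smul, map_smul]; exact smul_field_mem _ c ha

theorem pow_mem_convFilt {φ : ConvRing 𝕜 R 𝒰₁ 𝒰₂} (hφ : φ ∈ convFilt 𝕜 R 𝒰₁ 𝒰₂ 1) (c : ℕ) :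
    φ ^ c ∈ convFilt 𝕜 R 𝒰₁ 𝒰₂ c := by
  induction c with
  | zero => exact mem_convFilt_zero _
  | succ c ih => rw [pow_succ]; exact mul_mem_convFilt ih hφ

theorem toRing_convUnit : toRing (convUnit 𝕜 R 𝒰₁ 𝒰₂) = 1 := by
  refine convRing_ext fun x => ?_
  rw [evalAt_toRing, evalAt_one, convUnit, baseC_incl, LinearMap.comp_apply,
    Algebra.linearMap_apply, Algebra.algebraMap_eq_smul_one, map_smul,
    Algebra.algebraMap_eq_smul_one]
  rfl

theorem toRing_conv (f g : Lin 𝕜 R 𝒰₁ 𝒰₂) : toRing (conv f g) = toRing f * toRing g := by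
  refine convRing_ext fun x => ?_
  rw [evalAt_mul, evalAt_toRing, conv, LinearMap.comp_apply, LinearMap.comp_apply, baseC_incl]
  generalize comul 𝒰₁ x = z
  induction z using TensorProduct.induction_on with
  | zero => simp
  | tmul a b => rw [tensor₂_incl, TensorProduct.map_tmul, LinearMap.mul'_apply]; rfl
  | add a b ha hb => simp only [map_add, ha, hb]

theorem toRing_convPow (f : Lin 𝕜 R 𝒰₁ 𝒰₂) (c : ℕ) : toRing (convPow f c) = toRing f ^ c := by
  induction c with
  | zero => rw [convPow, toRing_convUnit, pow_zero]
  | succ c ih => rw [convPow, toRing_conv, ih, pow_succ]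

theorem convPow_succ' (f : Lin 𝕜 R 𝒰₁ 𝒰₂) (c : ℕ) :
    convPow f (c + 1) = conv f (convPow f c) :=
  toRing_injective (by rw [toRing_convPow, toRing_conv, toRing_convPow, pow_succ'])

theorem toRing_expTerm (f : Lin 𝕜 R 𝒰₁ 𝒰₂) (c : ℕ) :
    toRing (expTerm f c) = (c.factorial : 𝕜)⁻¹ • toRing f ^ c := by
  rw [expTerm, toRing_smul, toRing_convPow]

theorem toRing_logTerm (h : Lin 𝕜 R 𝒰₁ 𝒰₂) (c : ℕ) :
    toRing (logTerm h c) = ((-1) ^ c * ((c : 𝕜) + 1)⁻¹) • toRing h ^ (c + 1) := by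
  rw [logTerm, toRing_smul, toRing_convPow]

/-- A sequence whose terms lie in higher and higher steps of the filtration tends to zero
pointwise. -/
theorem eventually_mem_of_convFilt {F : ℕ → Lin 𝕜 R 𝒰₁ 𝒰₂}
    (h : ∀ c, toRing (F c) ∈ convFilt 𝕜 R 𝒰₁ 𝒰₂ c) (v : SymAlg 𝒰₁) (N : ℕ) :
    ∃ c₀, ∀ c ≥ c₀, F c (incl 𝕜 R v) ∈ filt 𝕜 R (SymAlg 𝒰₂) N := by
  induction mem_span_words v using Submodule.span_induction with
  | mem x hx =>
    obtain ⟨n, d, hx⟩ := hx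
    exact ⟨N + n, fun c hc => filt_anti (by omega) (h c hx)⟩
  | zero => exact ⟨0, fun c _ => by simp⟩
  | add a b _ _ ha hb =>
    obtain ⟨c₁, h₁⟩ := ha
    obtain ⟨c₂, h₂⟩ := hb
    refine ⟨max c₁ c₂, fun c hc => ?_⟩
    rw [map_add, map_add]
    exact Submodule.add_mem _ (h₁ c (le_trans (le_max_left _ _) hc))
      (h₂ c (le_trans (le_max_right _ _) hc))
  | smul r a _ ha =>
    obtain ⟨c₁, h₁⟩ := ha
    refine ⟨c₁, fun c hc => ?_⟩
    rw [map_smul, map_smul_field]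
    exact smul_field_mem _ _ (h₁ c hc)

theorem linHasSum_of_convFilt {F : ℕ → Lin 𝕜 R 𝒰₁ 𝒰₂}
    (h : ∀ c, toRing (F c) ∈ convFilt 𝕜 R 𝒰₁ 𝒰₂ c) : LinHasSum F (linSum F) :=
  linHasSum_linSum (eventually_mem_of_convFilt h)

theorem toRing_linSum_sub_mem {F : ℕ → Lin 𝕜 R 𝒰₁ 𝒰₂}
    (h : ∀ c, toRing (F c) ∈ convFilt 𝕜 R 𝒰₁ 𝒰₂ c) (p : ℕ) :
    toRing (linSum F) - ∑ c ∈ Finset.range p, toRing (F c) ∈ convFilt 𝕜 R 𝒰₁ 𝒰₂ p := by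
  intro n d x hx
  have := (linHasSum_of_convFilt h).sub_mem (x := incl 𝕜 R x) (N := p - n) (c₀ := p)
    fun c hc => filt_anti (by omega) (h c hx)
  rw [← map_sum, ← map_sub, evalAt_toRing]
  simpa using this

theorem eq_linSum {F : ℕ → Lin 𝕜 R 𝒰₁ 𝒰₂} {G : Lin 𝕜 R 𝒰₁ 𝒰₂}
    (h : ∀ c, toRing (F c) ∈ convFilt 𝕜 R 𝒰₁ 𝒰₂ c)
    (hG : ∀ p, toRing G - ∑ c ∈ Finset.range p, toRing (F c) ∈ convFilt 𝕜 R 𝒰₁ 𝒰₂ p) :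
    G = linSum F :=
  toRing_injective <| eq_of_forall_sub_mem_convFilt fun p => by
    simpa using Submodule.sub_mem _ (hG p) (toRing_linSum_sub_mem h p)

/-! ### Exponential and logarithm -/

theorem toRing_expTerm_mem {f : Lin 𝕜 R 𝒰₁ 𝒰₂} (hf : f (incl 𝕜 R 1) ∈ filt 𝕜 R (SymAlg 𝒰₂) 1)
    (c : ℕ) : toRing (expTerm f c) ∈ convFilt 𝕜 R 𝒰₁ 𝒰₂ c := by
  rw [toRing_expTerm]
  exact Submodule.smul_mem _ _ (pow_mem_convFilt (mem_convFilt_one hf) c)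

theorem toRing_logTerm_mem {f : Lin 𝕜 R 𝒰₁ 𝒰₂} (hf : f (incl 𝕜 R 1) ∈ filt 𝕜 R (SymAlg 𝒰₂) 1)
    (c : ℕ) : toRing (logTerm f c) ∈ convFilt 𝕜 R 𝒰₁ 𝒰₂ (c + 1) := by
  rw [toRing_logTerm]
  exact Submodule.smul_mem _ _ (pow_mem_convFilt (mem_convFilt_one hf) _)

theorem toRing_convExp_sub_mem {f : Lin 𝕜 R 𝒰₁ 𝒰₂}
    (hf : f (incl 𝕜 R 1) ∈ filt 𝕜 R (SymAlg 𝒰₂) 1) (p : ℕ) :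
    toRing (convExp f) - ∑ c ∈ Finset.range p, (c.factorial : 𝕜)⁻¹ • toRing f ^ c ∈
      convFilt 𝕜 R 𝒰₁ 𝒰₂ p := by
  have := toRing_linSum_sub_mem (toRing_expTerm_mem hf) p
  simp only [toRing_expTerm] at this
  exact this

/-- The exponential is characterized by its congruences with the partial sums. -/
theorem eq_convExp {f G : Lin 𝕜 R 𝒰₁ 𝒰₂} (hf : f (incl 𝕜 R 1) ∈ filt 𝕜 R (SymAlg 𝒰₂) 1)
    (hG : ∀ p, toRing G - ∑ c ∈ Finset.range p, (c.factorial : 𝕜)⁻¹ • toRing f ^ c ∈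
      convFilt 𝕜 R 𝒰₁ 𝒰₂ p) : G = convExp f :=
  eq_linSum (toRing_expTerm_mem hf) (by simpa only [toRing_expTerm] using hG)

theorem convExp_zero : convExp (0 : Lin 𝕜 R 𝒰₁ 𝒰₂) = convUnit 𝕜 R 𝒰₁ 𝒰₂ := by
  refine (eq_convExp (by simp) fun p => ?_).symm
  rw [toRing_convUnit, map_zero]
  rcases p with _ | p
  · exact mem_convFilt_zero _
  · rw [Finset.sum_range_succ']
    simp

theorem convExp_one_sub_mem {f : Lin 𝕜 R 𝒰₁ 𝒰₂}
    (hf : f (incl 𝕜 R 1) ∈ filt 𝕜 R (SymAlg 𝒰₂) 1) :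
    convExp f (incl 𝕜 R 1) - incl 𝕜 R 1 ∈ filt 𝕜 R (SymAlg 𝒰₂) 1 := by
  have h := convRing_apply_one_mem (toRing_convExp_sub_mem hf 1)
  rw [Finset.sum_range_one, pow_zero, ← toRing_convUnit] at h
  simp only [Nat.factorial_zero, Nat.cast_one, inv_one, one_smul, ← map_sub, evalAt_toRing] at h
  rw [LinearMap.sub_apply] at h
  have h2 : convUnit 𝕜 R 𝒰₁ 𝒰₂ (incl 𝕜 R 1) = incl 𝕜 R 1 := by
    rw [convUnit, baseC_incl]
    simp
  rwa [h2] at h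

/-- `exp(f) ∘ exp(g)` has the form `e + h` with `h(1) ∈ 𝔪`. -/
theorem convExp_comp_convExp_one [DirectSum.Decomposition 𝒰₂] {f : Lin 𝕜 R 𝒰₂ 𝒰₃}
    {g : Lin 𝕜 R 𝒰₁ 𝒰₂}
    (hf : f (incl 𝕜 R 1) ∈ filt 𝕜 R (SymAlg 𝒰₃) 1)
    (hg : g (incl 𝕜 R 1) ∈ filt 𝕜 R (SymAlg 𝒰₂) 1) :
    (convExp f ∘ₗ convExp g - convUnit 𝕜 R 𝒰₁ 𝒰₃) (incl 𝕜 R 1) ∈ filt 𝕜 R (SymAlg 𝒰₃) 1 := by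
  have h2 : convUnit 𝕜 R 𝒰₁ 𝒰₃ (incl 𝕜 R 1) = incl 𝕜 R 1 := by
    rw [convUnit, baseC_incl]
    simp
  rw [LinearMap.sub_apply, LinearMap.comp_apply, h2]
  have := Submodule.add_mem _ (map_mem_filt (convExp f) (convExp_one_sub_mem hg))
    (convExp_one_sub_mem hf)
  simpa using this

variable [DirectSum.Decomposition 𝒰₂]

/-- Postcomposition with the algebra morphism `S(φ)` preserves convolution powers. -/
theorem convPow_baseC_comp (φ : U₂ →ₗ[𝕜] U₃) (hφ : ∀ d, ∀ u ∈ 𝒰₂ d, φ u ∈ 𝒰₃ d)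
    (g : Lin 𝕜 R 𝒰₁ 𝒰₂) (c : ℕ) :
    convPow (baseC 𝕜 R (symMap 𝒰₂ 𝒰₃ φ hφ).toLinearMap ∘ₗ g : Lin 𝕜 R 𝒰₁ 𝒰₃) c =
      baseC 𝕜 R (symMap 𝒰₂ 𝒰₃ φ hφ).toLinearMap ∘ₗ convPow g c := by
  have hmul : LinearMap.mul' 𝕜 (SymAlg 𝒰₃) ∘ₗ TensorProduct.map
      (symMap 𝒰₂ 𝒰₃ φ hφ).toLinearMap (symMap 𝒰₂ 𝒰₃ φ hφ).toLinearMap =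
      (symMap 𝒰₂ 𝒰₃ φ hφ).toLinearMap ∘ₗ LinearMap.mul' 𝕜 (SymAlg 𝒰₂) :=
    TensorProduct.ext' fun a b => by simp
  induction c with
  | zero =>
    have h0 : Algebra.linearMap 𝕜 (SymAlg 𝒰₃) ∘ₗ (counit 𝒰₁).toLinearMap =
        (symMap 𝒰₂ 𝒰₃ φ hφ).toLinearMap ∘ₗ
          Algebra.linearMap 𝕜 (SymAlg 𝒰₂) ∘ₗ (counit 𝒰₁).toLinearMap :=
      LinearMap.ext fun x => by simp
    rw [convPow, convPow, convUnit, convUnit, ← baseC_comp, ← h0]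
  | succ c ih =>
    rw [convPow, convPow, ih, conv, conv, tensor₂_comp, ← baseC_map, ← LinearMap.comp_assoc,
      ← LinearMap.comp_assoc, ← LinearMap.comp_assoc, ← baseC_comp, ← baseC_comp, hmul,
      LinearMap.comp_assoc]

theorem convExp_baseC_comp (φ : U₂ →ₗ[𝕜] U₃) (hφ : ∀ d, ∀ u ∈ 𝒰₂ d, φ u ∈ 𝒰₃ d)
    {g : Lin 𝕜 R 𝒰₁ 𝒰₂} (hg : g (incl 𝕜 R 1) ∈ filt 𝕜 R (SymAlg 𝒰₂) 1) :
    convExp (baseC 𝕜 R (symMap 𝒰₂ 𝒰₃ φ hφ).toLinearMap ∘ₗ g : Lin 𝕜 R 𝒰₁ 𝒰₃) =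
      baseC 𝕜 R (symMap 𝒰₂ 𝒰₃ φ hφ).toLinearMap ∘ₗ convExp g := by
  refine (eq_convExp ?_ fun p => ?_).symm
  · exact map_mem_filt (baseC 𝕜 R (symMap 𝒰₂ 𝒰₃ φ hφ).toLinearMap) hg
  have h : ∀ c : ℕ, (c.factorial : 𝕜)⁻¹ • toRing (baseC 𝕜 R (symMap 𝒰₂ 𝒰₃ φ hφ).toLinearMap ∘ₗ g :
      Lin 𝕜 R 𝒰₁ 𝒰₃) ^ c =
      toRing (baseC 𝕜 R (symMap 𝒰₂ 𝒰₃ φ hφ).toLinearMap ∘ₗ expTerm g c : Lin 𝕜 R 𝒰₁ 𝒰₃) := by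
    intro c
    rw [← toRing_expTerm, expTerm, convPow_baseC_comp, expTerm, LinearMap.comp_smul]
  intro n d x hx
  have h2 := map_mem_filt (baseC 𝕜 R (symMap 𝒰₂ 𝒰₃ φ hφ).toLinearMap)
    (toRing_linSum_sub_mem (toRing_expTerm_mem hg) p hx)
  simp only [h, ← map_sum, ← map_sub, evalAt_toRing, LinearMap.sub_apply,
    LinearMap.sum_apply, LinearMap.comp_apply] at h2 ⊢
  exact h2

/-- Precomposition with the coalgebra morphism `S(φ)` preserves convolution powers. -/
theorem convPow_comp_baseC (φ : U₁ →ₗ[𝕜] U₂) (hφ : ∀ d, ∀ u ∈ 𝒰₁ d, φ u ∈ 𝒰₂ d)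
    (f : Lin 𝕜 R 𝒰₂ 𝒰₃) (c : ℕ) :
    convPow (f ∘ₗ baseC 𝕜 R (symMap 𝒰₁ 𝒰₂ φ hφ).toLinearMap : Lin 𝕜 R 𝒰₁ 𝒰₃) c =
      convPow f c ∘ₗ baseC 𝕜 R (symMap 𝒰₁ 𝒰₂ φ hφ).toLinearMap := by
  induction c with
  | zero =>
    have h0 : (Algebra.linearMap 𝕜 (SymAlg 𝒰₃) ∘ₗ (counit 𝒰₂).toLinearMap) ∘ₗ
        (symMap 𝒰₁ 𝒰₂ φ hφ).toLinearMap =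
          Algebra.linearMap 𝕜 (SymAlg 𝒰₃) ∘ₗ (counit 𝒰₁).toLinearMap :=
      LinearMap.ext fun x => by simp [counit_symMap]
    rw [convPow, convPow, convUnit, convUnit, ← baseC_comp, h0]
  | succ c ih =>
    rw [convPow, convPow, ih, conv, conv, tensor₂_comp, ← baseC_map, LinearMap.comp_assoc,
      LinearMap.comp_assoc, LinearMap.comp_assoc, ← baseC_comp, ← baseC_comp, comul_symMap]

theorem convExp_comp_baseC (φ : U₁ →ₗ[𝕜] U₂) (hφ : ∀ d, ∀ u ∈ 𝒰₁ d, φ u ∈ 𝒰₂ d)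
    {f : Lin 𝕜 R 𝒰₂ 𝒰₃} (hf : f (incl 𝕜 R 1) ∈ filt 𝕜 R (SymAlg 𝒰₃) 1) :
    convExp (f ∘ₗ baseC 𝕜 R (symMap 𝒰₁ 𝒰₂ φ hφ).toLinearMap : Lin 𝕜 R 𝒰₁ 𝒰₃) =
      convExp f ∘ₗ baseC 𝕜 R (symMap 𝒰₁ 𝒰₂ φ hφ).toLinearMap := by
  refine (eq_convExp ?_ fun p => ?_).symm
  · rw [LinearMap.comp_apply, baseC_incl]
    simpa using hf
  have h : ∀ c : ℕ, (c.factorial : 𝕜)⁻¹ • toRing (f ∘ₗ baseC 𝕜 R (symMap 𝒰₁ 𝒰₂ φ hφ).toLinearMap :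
      Lin 𝕜 R 𝒰₁ 𝒰₃) ^ c =
      toRing (expTerm f c ∘ₗ baseC 𝕜 R (symMap 𝒰₁ 𝒰₂ φ hφ).toLinearMap : Lin 𝕜 R 𝒰₁ 𝒰₃) := by
    intro c
    rw [← toRing_expTerm, expTerm, convPow_comp_baseC, expTerm, LinearMap.smul_comp]
  intro n d x hx
  have h2 := toRing_linSum_sub_mem (toRing_expTerm_mem hf) p (symMap_word (φ := φ) (hφ := hφ) hx)
  simp only [h, ← map_sum, ← map_sub, evalAt_toRing, LinearMap.sub_apply,
    LinearMap.sum_apply, LinearMap.comp_apply, baseC_incl, AlgHom.toLinearMap_apply] at h2 ⊢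
  exact h2

end ConvolutionRing

/-! ### Maps of degree zero -/

section DegreeZero

variable {𝕜 R : Type*} [Field 𝕜] [CommRing R] [IsLocalRing R] [IsNoetherianRing R] [Algebra 𝕜 R]
variable {U₁ U₂ U₃ : Type*} [AddCommGroup U₁] [Module 𝕜 U₁] [AddCommGroup U₂] [Module 𝕜 U₂]
  [AddCommGroup U₃] [Module 𝕜 U₃]
variable {𝒰₁ : ℤ → Submodule 𝕜 U₁} {𝒰₂ : ℤ → Submodule 𝕜 U₂} {𝒰₃ : ℤ → Submodule 𝕜 U₃}

theorem incl_mem_cplDeg {d : ℤ} {x : SymAlg 𝒰₁} (hx : x ∈ symDeg 𝒰₁ d) :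
    incl 𝕜 R x ∈ cplDeg R 𝒰₁ d :=
  ⟨incl 𝕜 R ⟨x, hx⟩, by rw [baseC_incl]; rfl⟩

/-- `S(U)_d ⊗̂ R` is closed in `S(U) ⊗̂ R`, being the image of a continuous projection. -/
theorem mem_cplDeg_of_forall {d : ℤ} {x : Cpl 𝕜 R (SymAlg 𝒰₁)}
    (h : ∀ N, ∃ y ∈ cplDeg R 𝒰₁ d, x - y ∈ filt 𝕜 R (SymAlg 𝒰₁) N) : x ∈ cplDeg R 𝒰₁ d := by
  obtain ⟨π, hπ⟩ := LinearMap.exists_leftInverse_of_injective (symDeg 𝒰₁ d).subtype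
    (Submodule.ker_subtype _)
  suffices hx : baseC 𝕜 R (symDeg 𝒰₁ d).subtype (baseC 𝕜 R π x) = x from ⟨_, hx⟩
  refine eq_of_forall_sub_mem_filt fun N => ?_
  obtain ⟨_, ⟨y, rfl⟩, hy⟩ := h N
  have h1 : baseC 𝕜 R (symDeg 𝒰₁ d).subtype (baseC 𝕜 R π (baseC 𝕜 R (symDeg 𝒰₁ d).subtype y)) =
      baseC 𝕜 R (symDeg 𝒰₁ d).subtype y := by
    rw [baseC_comp_apply π, hπ, baseC_id, LinearMap.id_apply]
  have h2 := Submodule.sub_mem _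
    (map_mem_filt (baseC 𝕜 R (symDeg 𝒰₁ d).subtype) (map_mem_filt (baseC 𝕜 R π) hy)) hy
  rw [map_sub, map_sub, h1] at h2
  simpa using h2

/-- That a map is of degree zero need only be checked on words. -/
theorem map_mem_cplDeg {f : Lin 𝕜 R 𝒰₁ 𝒰₂}
    (h : ∀ n d x, IsWord 𝒰₁ n d x → f (incl 𝕜 R x) ∈ cplDeg R 𝒰₂ d) (d : ℤ)
    (x : Cpl 𝕜 R (SymAlg 𝒰₁)) (hx : x ∈ cplDeg R 𝒰₁ d) : f x ∈ cplDeg R 𝒰₂ d := by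
  obtain ⟨x, rfl⟩ := hx
  have hv : ∀ v ∈ symDeg 𝒰₁ d, f (incl 𝕜 R v) ∈ cplDeg R 𝒰₂ d := by
    intro v hv
    rw [symDeg_eq_span] at hv
    induction hv using Submodule.span_induction with
    | mem v hv => obtain ⟨n, hv⟩ := hv; exact h n d v hv
    | zero => simp
    | add a b _ _ ha hb => rw [map_add, map_add]; exact Submodule.add_mem _ ha hb
    | smul c a _ ha => rw [map_smul, map_smul_field]; exact smul_field_mem _ c ha
  refine mem_cplDeg_of_forall fun N => ?_
  have := map_mem_of_incl_mem (f ∘ₗ baseC 𝕜 R (symDeg 𝒰₁ d).subtype)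
    (P := cplDeg R 𝒰₂ d ⊔ filt 𝕜 R (SymAlg 𝒰₂) N) (N := N) le_sup_right
    (fun v => Submodule.mem_sup_left (by
      rw [LinearMap.comp_apply, baseC_incl]
      exact hv _ v.2)) x
  obtain ⟨y, hy, z, hz, hyz⟩ := Submodule.mem_sup.1 this
  refine ⟨y, hy, ?_⟩
  rw [LinearMap.comp_apply] at hyz
  rw [← hyz, add_sub_cancel_left]
  exact hz

theorem mul_mem_cplDeg {d e : ℤ} {x y : Cpl 𝕜 R (SymAlg 𝒰₁)} (hx : x ∈ cplDeg R 𝒰₁ d)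
    (hy : y ∈ cplDeg R 𝒰₁ e) : x * y ∈ cplDeg R 𝒰₁ (d + e) := by
  obtain ⟨x, rfl⟩ := hx
  obtain ⟨y, rfl⟩ := hy
  have hab : ∀ a ∈ symDeg 𝒰₁ d, ∀ b ∈ symDeg 𝒰₁ e, a * b ∈ symDeg 𝒰₁ (d + e) := by
    intro a ha b hb
    rw [symDeg_eq_span] at ha hb
    induction ha using Submodule.span_induction with
    | mem a ha =>
      obtain ⟨n, ha⟩ := ha
      induction hb using Submodule.span_induction with
      | mem b hb => obtain ⟨m, hb⟩ := hb; exact (ha.mul hb).mem_symDeg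
      | zero => simp
      | add a b _ _ ha hb => rw [mul_add]; exact Submodule.add_mem _ ha hb
      | smul c a _ ha => rw [mul_smul_comm]; exact Submodule.smul_mem _ _ ha
    | zero => simp
    | add a b _ _ ha hb => rw [add_mul]; exact Submodule.add_mem _ ha hb
    | smul c a _ ha => rw [smul_mul_assoc]; exact Submodule.smul_mem _ _ ha
  let m : symDeg 𝒰₁ d →ₗ[𝕜] symDeg 𝒰₁ e →ₗ[𝕜] symDeg 𝒰₁ (d + e) :=
    LinearMap.mk₂ 𝕜 (fun a b => ⟨a * b, hab a a.2 b b.2⟩)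
      (fun a b c => Subtype.ext (by simp [add_mul])) (fun c a b => Subtype.ext (by simp))
      (fun a b c => Subtype.ext (by simp [mul_add])) (fun c a b => Subtype.ext (by simp))
  refine ⟨baseC 𝕜 R (TensorProduct.lift m) (tmulC x y), ?_⟩
  let B : Cpl 𝕜 R (symDeg 𝒰₁ d) →ₗ[R] Cpl 𝕜 R (symDeg 𝒰₁ e) →ₗ[R] Cpl 𝕜 R (SymAlg 𝒰₁) :=
    tmulC.compr₂ (baseC 𝕜 R (symDeg 𝒰₁ (d + e)).subtype ∘ₗ baseC 𝕜 R (TensorProduct.lift m))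
  let B' : Cpl 𝕜 R (symDeg 𝒰₁ d) →ₗ[R] Cpl 𝕜 R (symDeg 𝒰₁ e) →ₗ[R] Cpl 𝕜 R (SymAlg 𝒰₁) :=
    (tmulC.compr₂ (baseC 𝕜 R (LinearMap.mul' 𝕜 (SymAlg 𝒰₁)))).compl₁₂
      (baseC 𝕜 R (symDeg 𝒰₁ d).subtype) (baseC 𝕜 R (symDeg 𝒰₁ e).subtype)
  exact bilin_ext (B := B) (B' := B')
    (fun v w => by simp [B, B', baseC_incl, tmulC_incl, m]) x y

/-- The algebra `S(U) ⊗̂ R` is graded commutative. -/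
theorem cplDeg_mul_comm {d e : ℤ} {x y : Cpl 𝕜 R (SymAlg 𝒰₁)} (hx : x ∈ cplDeg R 𝒰₁ d)
    (hy : y ∈ cplDeg R 𝒰₁ e) : x * y = (d * e).negOnePow • (y * x) := by
  obtain ⟨x, rfl⟩ := hx
  obtain ⟨y, rfl⟩ := hy
  have hab : ∀ a ∈ symDeg 𝒰₁ d, ∀ b ∈ symDeg 𝒰₁ e, a * b = (d * e).negOnePow • (b * a) := by
    intro a ha b hb
    rw [symDeg_eq_span] at ha hb
    induction ha using Submodule.span_induction with
    | mem a ha =>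
      obtain ⟨n, ha⟩ := ha
      induction hb using Submodule.span_induction with
      | mem b hb => obtain ⟨m, hb⟩ := hb; exact ha.mul_comm hb
      | zero => simp
      | add b c _ _ hb hc => rw [mul_add, add_mul, smul_add, hb, hc]
      | smul c b _ hb => rw [mul_smul_comm, smul_mul_assoc, hb, smul_comm]
    | zero => simp
    | add a c _ _ ha hc => rw [mul_add, add_mul, smul_add, ha, hc]
    | smul c a _ ha => rw [mul_smul_comm, smul_mul_assoc, ha, smul_comm]
  let M : Cpl 𝕜 R (SymAlg 𝒰₁) →ₗ[R] Cpl 𝕜 R (SymAlg 𝒰₁) →ₗ[R] Cpl 𝕜 R (SymAlg 𝒰₁) :=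
    tmulC.compr₂ (baseC 𝕜 R (LinearMap.mul' 𝕜 (SymAlg 𝒰₁)))
  let B : Cpl 𝕜 R (symDeg 𝒰₁ d) →ₗ[R] Cpl 𝕜 R (symDeg 𝒰₁ e) →ₗ[R] Cpl 𝕜 R (SymAlg 𝒰₁) :=
    M.compl₁₂ (baseC 𝕜 R (symDeg 𝒰₁ d).subtype) (baseC 𝕜 R (symDeg 𝒰₁ e).subtype)
  let B' : Cpl 𝕜 R (symDeg 𝒰₁ d) →ₗ[R] Cpl 𝕜 R (symDeg 𝒰₁ e) →ₗ[R] Cpl 𝕜 R (SymAlg 𝒰₁) :=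
    ((d * e).negOnePow : ℤ) •
      M.flip.compl₁₂ (baseC 𝕜 R (symDeg 𝒰₁ d).subtype) (baseC 𝕜 R (symDeg 𝒰₁ e).subtype)
  refine bilin_ext (B := B) (B' := B') (fun v w => ?_) x y
  simp only [B, B', M, baseC_incl, tmulC_incl, LinearMap.compl₁₂_apply, LinearMap.compr₂_apply,
    LinearMap.smul_apply, LinearMap.flip_apply, LinearMap.mul'_apply, Submodule.subtype_apply]
  rw [hab v v.2 w w.2, Units.smul_def, map_zsmul]

variable [DirectSum.Decomposition 𝒰₁]

variable (𝕜 R 𝒰₁ 𝒰₂) in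
/-- The maps of degree zero form a subalgebra of the convolution ring. -/
def convDegZero : Subalgebra 𝕜 (ConvRing 𝕜 R 𝒰₁ 𝒰₂) where
  carrier := {φ | ∀ ⦃n d x⦄, IsWord 𝒰₁ n d x → evalAt x φ ∈ cplDeg R 𝒰₂ d}
  add_mem' hφ hψ _ _ _ hx := by
    rw [map_add]
    exact Submodule.add_mem _ (hφ hx) (hψ hx)
  mul_mem' := by
    intro φ ψ hφ hψ n d x hx
    rw [evalAt_mul]
    have h := comul_word_mem hx
    generalize comul 𝒰₁ x = z at h
    induction h using Submodule.span_induction with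
    | mem z hz =>
      obtain ⟨n₁, n₂, d₁, d₂, a, b, rfl, rfl, ha, hb, rfl⟩ := hz
      exact mul_mem_cplDeg (hφ ha) (hψ hb)
    | zero => simp
    | add a b _ _ ha hb => rw [map_add, map_add]; exact Submodule.add_mem _ ha hb
    | smul c a _ ha => rw [map_smul, map_smul]; exact smul_field_mem _ c ha
  algebraMap_mem' := by
    intro c n d x hx
    rw [Algebra.algebraMap_eq_smul_one, evalAt_smul, evalAt_one]
    refine smul_field_mem _ c ?_
    cases hx with
    | one =>
      rw [map_one, map_one, one_def]
      exact incl_mem_cplDeg IsWord.one.mem_symDeg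
    | gen_mul hu hx =>
      rw [counit_word (hx.gen_mul hu) (Nat.succ_ne_zero _), map_zero]
      exact Submodule.zero_mem _

theorem toRing_mem_convDegZero {f : Lin 𝕜 R 𝒰₁ 𝒰₂} : toRing f ∈ convDegZero 𝕜 R 𝒰₁ 𝒰₂ ↔
    ∀ (d : ℤ), ∀ x ∈ cplDeg R 𝒰₁ d, f x ∈ cplDeg R 𝒰₂ d :=
  ⟨fun h => map_mem_cplDeg fun _ _ _ hx => h hx,
    fun h _ d _ hx => h d _ (incl_mem_cplDeg hx.mem_symDeg)⟩

/-- Maps of degree zero commute for the convolution product: `S(U₁)` is graded cocommutative and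
`S(U₂)` is graded commutative. -/
theorem commute_of_mem_convDegZero {φ ψ : ConvRing 𝕜 R 𝒰₁ 𝒰₂}
    (hφ : φ ∈ convDegZero 𝕜 R 𝒰₁ 𝒰₂) (hψ : ψ ∈ convDegZero 𝕜 R 𝒰₁ 𝒰₂) : Commute φ ψ := by
  refine convRing_ext fun x => ?_
  rw [evalAt_mul, evalAt_mul]
  have key : ∀ φ ψ : ConvRing 𝕜 R 𝒰₁ 𝒰₂,
      LinearMap.mul' 𝕜 (Cpl 𝕜 R (SymAlg 𝒰₂)) ∘ₗ
        TensorProduct.map (WithConv.ofConv φ) (WithConv.ofConv ψ) =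
      TensorProduct.lift
        ((LinearMap.mul 𝕜 (Cpl 𝕜 R (SymAlg 𝒰₂))).compl₁₂ (WithConv.ofConv φ) (WithConv.ofConv ψ)) :=
    fun φ ψ => TensorProduct.ext' fun a b => by simp
  have h := lift_comul_eq_of_graded_symm (𝒰 := 𝒰₁)
    (B := (LinearMap.mul 𝕜 (Cpl 𝕜 R (SymAlg 𝒰₂))).compl₁₂ (WithConv.ofConv φ) (WithConv.ofConv ψ))
    (B' := (LinearMap.mul 𝕜 (Cpl 𝕜 R (SymAlg 𝒰₂))).compl₁₂ (WithConv.ofConv ψ) (WithConv.ofConv φ))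
    (fun ha hb => cplDeg_mul_comm (hφ ha) (hψ hb)) x
  rw [← key, ← key] at h
  exact h

/-- `Lin^0_R` is the first step of the filtration of the subalgebra of maps of degree zero. -/
theorem isLin0_iff {f : Lin 𝕜 R 𝒰₁ 𝒰₂} : IsLin0 f ↔
    toRing f ∈ convDegZero 𝕜 R 𝒰₁ 𝒰₂ ∧ toRing f ∈ convFilt 𝕜 R 𝒰₁ 𝒰₂ 1 :=
  ⟨fun h => ⟨toRing_mem_convDegZero.2 h.degree_zero, mem_convFilt_one h.map_one⟩,
    fun h => ⟨toRing_mem_convDegZero.1 h.1, convRing_apply_one_mem h.2⟩⟩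

/-- The subalgebra of maps of degree zero is closed. -/
theorem mem_convDegZero_of_forall {φ : ConvRing 𝕜 R 𝒰₁ 𝒰₂}
    (h : ∀ p, ∃ ψ ∈ convDegZero 𝕜 R 𝒰₁ 𝒰₂, φ - ψ ∈ convFilt 𝕜 R 𝒰₁ 𝒰₂ p) :
    φ ∈ convDegZero 𝕜 R 𝒰₁ 𝒰₂ := by
  intro n d x hx
  refine mem_cplDeg_of_forall fun N => ?_
  obtain ⟨ψ, h1, h2⟩ := h (N + n)
  refine ⟨_, h1 hx, ?_⟩
  have := h2 hx
  rwa [Nat.add_sub_cancel, map_sub] at this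

theorem toRing_convExp_mem_convDegZero {f : Lin 𝕜 R 𝒰₁ 𝒰₂} (hf : IsLin0 f) :
    toRing (convExp f) ∈ convDegZero 𝕜 R 𝒰₁ 𝒰₂ :=
  mem_convDegZero_of_forall fun p => ⟨_,
    Subalgebra.sum_mem _ fun c _ => Subalgebra.smul_mem _ (pow_mem (isLin0_iff.1 hf).1 c) _,
    toRing_convExp_sub_mem hf.map_one p⟩

theorem IsLin0.add {f g : Lin 𝕜 R 𝒰₁ 𝒰₂} (hf : IsLin0 f) (hg : IsLin0 g) : IsLin0 (f + g) := by
  rw [isLin0_iff] at *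
  rw [map_add]
  exact ⟨add_mem hf.1 hg.1, add_mem hf.2 hg.2⟩

theorem isLin0_sum {ι : Type*} (s : Finset ι) {f : ι → Lin 𝕜 R 𝒰₁ 𝒰₂} (hf : ∀ i, IsLin0 (f i)) :
    IsLin0 (∑ i ∈ s, f i) := by
  rw [isLin0_iff, map_sum]
  exact ⟨sum_mem fun i _ => (isLin0_iff.1 (hf i)).1, sum_mem fun i _ => (isLin0_iff.1 (hf i)).2⟩

theorem IsLin0.baseC_comp {g : Lin 𝕜 R 𝒰₁ 𝒰₂} (hg : IsLin0 g) (φ : U₂ →ₗ[𝕜] U₃)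
    (hφ : ∀ d, ∀ u ∈ 𝒰₂ d, φ u ∈ 𝒰₃ d) [DirectSum.Decomposition 𝒰₂] :
    IsLin0 (baseC 𝕜 R (symMap 𝒰₂ 𝒰₃ φ hφ).toLinearMap ∘ₗ g : Lin 𝕜 R 𝒰₁ 𝒰₃) where
  degree_zero d x hx := by
    refine map_mem_cplDeg (f := baseC 𝕜 R (symMap 𝒰₂ 𝒰₃ φ hφ).toLinearMap) (fun n d x hx => ?_)
      d _ (hg.degree_zero d x hx)
    rw [baseC_incl]
    exact incl_mem_cplDeg (symMap_word hx).mem_symDeg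
  map_one := map_mem_filt (baseC 𝕜 R (symMap 𝒰₂ 𝒰₃ φ hφ).toLinearMap) hg.map_one

theorem IsLin0.comp_baseC {f : Lin 𝕜 R 𝒰₂ 𝒰₃} (hf : IsLin0 f) (φ : U₁ →ₗ[𝕜] U₂)
    (hφ : ∀ d, ∀ u ∈ 𝒰₁ d, φ u ∈ 𝒰₂ d) :
    IsLin0 (f ∘ₗ baseC 𝕜 R (symMap 𝒰₁ 𝒰₂ φ hφ).toLinearMap : Lin 𝕜 R 𝒰₁ 𝒰₃) where
  degree_zero d x hx := by
    refine hf.degree_zero d _ (map_mem_cplDeg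
      (f := baseC 𝕜 R (symMap 𝒰₁ 𝒰₂ φ hφ).toLinearMap) (fun n d x hx => ?_) d x hx)
    rw [baseC_incl]
    exact incl_mem_cplDeg (symMap_word hx).mem_symDeg
  map_one := by
    rw [LinearMap.comp_apply, baseC_incl]
    simpa using hf.map_one

/-- The functional equation of the exponential series, for commuting elements of positive
filtration. -/
theorem exp_add_mod [CharZero 𝕜] {a b : ConvRing 𝕜 R 𝒰₁ 𝒰₂} (hab : Commute a b)
    (ha : a ∈ convFilt 𝕜 R 𝒰₁ 𝒰₂ 1) (hb : b ∈ convFilt 𝕜 R 𝒰₁ 𝒰₂ 1) (p : ℕ) :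
    (∑ c ∈ Finset.range p, (c.factorial : 𝕜)⁻¹ • a ^ c) *
      (∑ c ∈ Finset.range p, (c.factorial : 𝕜)⁻¹ • b ^ c) -
    ∑ c ∈ Finset.range p, (c.factorial : 𝕜)⁻¹ • (a + b) ^ c ∈ convFilt 𝕜 R 𝒰₁ 𝒰₂ p := by
  let t : ℕ × ℕ → ConvRing 𝕜 R 𝒰₁ 𝒰₂ := fun q =>
    ((q.1.factorial : 𝕜)⁻¹ * (q.2.factorial : 𝕜)⁻¹) • (a ^ q.1 * b ^ q.2)
  have h1 : (∑ c ∈ Finset.range p, (c.factorial : 𝕜)⁻¹ • a ^ c) *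
      (∑ c ∈ Finset.range p, (c.factorial : 𝕜)⁻¹ • b ^ c) =
      ∑ q ∈ Finset.range p ×ˢ Finset.range p, t q := by
    rw [Finset.sum_mul_sum, Finset.sum_product]
    simp only [smul_mul_smul_comm, t]
  have h2 : ∑ c ∈ Finset.range p, (c.factorial : 𝕜)⁻¹ • (a + b) ^ c =
      ∑ q ∈ (Finset.range p ×ˢ Finset.range p) with q.1 + q.2 < p, t q := by
    have : ∀ c, (c.factorial : 𝕜)⁻¹ • (a + b) ^ c =
        ∑ q ∈ Finset.HasAntidiagonal.antidiagonal c, t q := by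
      intro c
      rw [hab.add_pow', Finset.smul_sum]
      refine Finset.sum_congr rfl fun q hq => ?_
      obtain rfl := Finset.HasAntidiagonal.mem_antidiagonal.1 hq
      rw [← Nat.cast_smul_eq_nsmul 𝕜, smul_smul, Nat.cast_add_choose]
      have h0 : ((q.1 + q.2).factorial : 𝕜) ≠ 0 := Nat.cast_ne_zero.2 (Nat.factorial_ne_zero _)
      simp only [t]
      congr 1
      field_simp
    simp only [this]
    rw [Finset.sum_sigma']
    refine Finset.sum_nbij' (fun q => q.2) (fun q => ⟨q.1 + q.2, q⟩) ?_ ?_ ?_ ?_ ?_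
    · rintro ⟨c, q⟩ h
      simp only [Finset.mem_sigma, Finset.mem_range, Finset.HasAntidiagonal.mem_antidiagonal] at h
      simp only [Finset.mem_filter, Finset.mem_product, Finset.mem_range]
      omega
    · rintro q h
      simp only [Finset.mem_filter, Finset.mem_product, Finset.mem_range] at h
      simp [h.2]
    · rintro ⟨c, q⟩ h
      simp only [Finset.mem_sigma, Finset.mem_range, Finset.HasAntidiagonal.mem_antidiagonal] at h
      obtain ⟨_, rfl⟩ := h
      rfl
    · intro q _
      rfl
    · intro q _
      rfl
  rw [h1, h2, ← Finset.sum_filter_add_sum_filter_not (Finset.range p ×ˢ Finset.range p)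
    (fun q => q.1 + q.2 < p), add_sub_cancel_left]
  refine sum_mem fun q hq => ?_
  have hq' := (Finset.mem_filter.1 hq).2
  exact convFilt_anti (by omega)
    (Submodule.smul_mem _ _ (mul_mem_convFilt (pow_mem_convFilt ha q.1) (pow_mem_convFilt hb q.2)))

/-- The exponential turns sums of maps of degree zero into convolution products. -/
theorem convExp_add [CharZero 𝕜] {f g : Lin 𝕜 R 𝒰₁ 𝒰₂} (hf : IsLin0 f) (hg : IsLin0 g) :
    convExp (f + g) = conv (convExp f) (convExp g) := by
  refine (eq_convExp (hf.add hg).map_one fun p => ?_).symm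
  have h1 := toRing_convExp_sub_mem hf.map_one p
  have h2 := toRing_convExp_sub_mem hg.map_one p
  have h3 := exp_add_mod (commute_of_mem_convDegZero (isLin0_iff.1 hf).1 (isLin0_iff.1 hg).1)
    (isLin0_iff.1 hf).2 (isLin0_iff.1 hg).2 p
  rw [toRing_conv, map_add]
  generalize toRing (convExp f) = F at h1 ⊢
  generalize toRing (convExp g) = G at h2 ⊢
  generalize ∑ c ∈ Finset.range p, (c.factorial : 𝕜)⁻¹ • toRing f ^ c = a at h1 h3
  generalize ∑ c ∈ Finset.range p, (c.factorial : 𝕜)⁻¹ • toRing g ^ c = b at h2 h3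
  have h4 := add_mem (add_mem (mul_mem_convFilt h1 (mem_convFilt_zero G))
    (convFilt_anti (zero_add p).ge (mul_mem_convFilt (mem_convFilt_zero a) h2))) h3
  rw [add_zero] at h4
  -- `F * G - exp(f + g)_p = (F - a) * G + a * (G - b) + (a * b - exp(f + g)_p)`, where `a` and `b`
  -- are the partial sums
  convert h4 using 1
  noncomm_ring

/-! ### The series defining the composition -/

theorem diamond_hasSum [DirectSum.Decomposition 𝒰₂] [DirectSum.Decomposition 𝒰₃]
    {f : Lin 𝕜 R 𝒰₂ 𝒰₃} {g : Lin 𝕜 R 𝒰₁ 𝒰₂} (hf : IsLin0 f) (hg : IsLin0 g) :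
    LinHasSum (logTerm (convExp f ∘ₗ convExp g - convUnit 𝕜 R 𝒰₁ 𝒰₃)) (diamond f g) :=
  linHasSum_of_convFilt fun c => convFilt_anti (Nat.le_succ c)
    (toRing_logTerm_mem (convExp_comp_convExp_one hf.map_one hg.map_one) c)

theorem toRing_diamond_sub_mem [DirectSum.Decomposition 𝒰₂] [DirectSum.Decomposition 𝒰₃]
    {f : Lin 𝕜 R 𝒰₂ 𝒰₃} {g : Lin 𝕜 R 𝒰₁ 𝒰₂} (hf : IsLin0 f) (hg : IsLin0 g) (p : ℕ) :
    toRing (diamond f g) - ∑ c ∈ Finset.range p, ((-1) ^ c * ((c : 𝕜) + 1)⁻¹) •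
      toRing (convExp f ∘ₗ convExp g - convUnit 𝕜 R 𝒰₁ 𝒰₃) ^ (c + 1) ∈
        convFilt 𝕜 R 𝒰₁ 𝒰₃ p := by
  have := toRing_linSum_sub_mem (F := logTerm (convExp f ∘ₗ convExp g - convUnit 𝕜 R 𝒰₁ 𝒰₃))
    (fun c => convFilt_anti (Nat.le_succ c)
      (toRing_logTerm_mem (convExp_comp_convExp_one hf.map_one hg.map_one) c)) p
  simp only [toRing_logTerm] at this
  exact this

theorem isLin0_diamond [DirectSum.Decomposition 𝒰₂] [DirectSum.Decomposition 𝒰₃]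
    {f : Lin 𝕜 R 𝒰₂ 𝒰₃} {g : Lin 𝕜 R 𝒰₁ 𝒰₂} (hf : IsLin0 f) (hg : IsLin0 g) :
    IsLin0 (diamond f g) := by
  have hH : toRing (convExp f ∘ₗ convExp g - convUnit 𝕜 R 𝒰₁ 𝒰₃) ∈ convDegZero 𝕜 R 𝒰₁ 𝒰₃ := by
    rw [map_sub, toRing_convUnit]
    refine sub_mem ?_ (one_mem _)
    rw [toRing_mem_convDegZero]
    intro d x hx
    exact toRing_mem_convDegZero.1 (toRing_convExp_mem_convDegZero hf) d _
      (toRing_mem_convDegZero.1 (toRing_convExp_mem_convDegZero hg) d x hx)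
  refine isLin0_iff.2 ⟨mem_convDegZero_of_forall fun p => ⟨_, ?_, toRing_diamond_sub_mem hf hg p⟩,
    ?_⟩
  · exact sum_mem fun c _ => Subalgebra.smul_mem _ (pow_mem hH _) _
  · have h1 := toRing_diamond_sub_mem hf hg 1
    rw [Finset.sum_range_one] at h1
    have h2 := Submodule.smul_mem (convFilt 𝕜 R 𝒰₁ 𝒰₃ 1) ((-1 : 𝕜) ^ 0 * (((0 : ℕ) : 𝕜) + 1)⁻¹)
      (pow_mem_convFilt (mem_convFilt_one
        (φ := toRing (convExp f ∘ₗ convExp g - convUnit 𝕜 R 𝒰₁ 𝒰₃))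
        (convExp_comp_convExp_one hf.map_one hg.map_one)) (0 + 1))
    simpa using add_mem h1 h2

end DegreeZero

/-! ### Coloured copies of a graded vector space -/

section Colours

variable {𝕜 U : Type*} [Field 𝕜] [AddCommGroup U] [Module 𝕜 U] (𝒰 : ℤ → Submodule 𝕜 U)

/-- The grading of the sum of copies of `U` indexed by the natural numbers ("colours"). -/
def colGrading (d : ℤ) : Submodule 𝕜 (ℕ →₀ U) where
  carrier := {v | ∀ c, v c ∈ 𝒰 d}
  add_mem' hv hw c := Submodule.add_mem _ (hv c) (hw c)
  zero_mem' _ := Submodule.zero_mem _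
  smul_mem' r _ hv c := Submodule.smul_mem _ r (hv c)

theorem lsingle_mem_colGrading (c : ℕ) (d : ℤ) (u : U) (hu : u ∈ 𝒰 d) :
    Finsupp.lsingle (R := 𝕜) c u ∈ colGrading 𝒰 d := by
  intro c'
  rw [Finsupp.lsingle_apply, Finsupp.single_apply]
  split_ifs
  · exact hu
  · exact Submodule.zero_mem _

theorem lapply_mem (c : ℕ) (d : ℤ) (v : ℕ →₀ U) (hv : v ∈ colGrading 𝒰 d) :
    Finsupp.lapply (R := 𝕜) c v ∈ 𝒰 d := hv c

/-- The inclusion of the homogeneous vectors of degree `d` as those of colour `c`. -/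
def colIncl (c : ℕ) (d : ℤ) : 𝒰 d →ₗ[𝕜] colGrading 𝒰 d :=
  (Finsupp.lsingle c ∘ₗ (𝒰 d).subtype).codRestrict _ fun u => lsingle_mem_colGrading 𝒰 c d u u.2

variable [DirectSum.Decomposition 𝒰]

/-- The coloured space decomposes into homogeneous parts colour by colour. -/
instance : DirectSum.Decomposition (colGrading 𝒰) :=
  DirectSum.Decomposition.ofLinearMap (colGrading 𝒰)
    (Finsupp.lsum 𝕜 fun c => DirectSum.toModule 𝕜 ℤ (DirectSum ℤ fun d => colGrading 𝒰 d)
      (fun d => DirectSum.lof 𝕜 ℤ (fun d => colGrading 𝒰 d) d ∘ₗ colIncl 𝒰 c d) ∘ₗ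
        (DirectSum.decomposeLinearEquiv 𝒰).toLinearMap)
    (by
      refine Finsupp.lhom_ext' fun c => ?_
      refine DirectSum.decompose_lhom_ext 𝒰 fun d => LinearMap.ext fun u => ?_
      simp [DirectSum.toModule_lof, DirectSum.coeLinearMap_lof, colIncl]
      rfl)
    (by
      refine DirectSum.linearMap_ext 𝕜 fun d => LinearMap.ext fun v => ?_
      simp only [LinearMap.comp_apply, DirectSum.coeLinearMap_lof, LinearMap.id_apply,
        Finsupp.lsum_apply]
      have h : ∀ c, DirectSum.toModule 𝕜 ℤ (DirectSum ℤ fun d => colGrading 𝒰 d)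
          (fun d => DirectSum.lof 𝕜 ℤ (fun d => colGrading 𝒰 d) d ∘ₗ colIncl 𝒰 c d)
          (DirectSum.decompose 𝒰 (v.1 c)) = DirectSum.lof 𝕜 ℤ (fun d => colGrading 𝒰 d) d
            (colIncl 𝒰 c d ⟨v.1 c, v.2 c⟩) := by
        intro c
        rw [DirectSum.decompose_of_mem 𝒰 (v.2 c), ← DirectSum.lof_eq_of 𝕜, DirectSum.toModule_lof]
        rfl
      refine (Finset.sum_congr rfl fun c _ => h c).trans ?_
      rw [← map_sum]
      congr 1
      refine Subtype.ext ?_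
      rw [AddSubmonoidClass.coe_finsetSum]
      exact Finsupp.sum_single v.1)

/-- The algebra morphism `S(U) → S(U^(ℕ))` that gives all generators the colour `c`. -/
def paint (c : ℕ) : SymAlg 𝒰 →ₗ[𝕜] SymAlg (colGrading 𝒰) :=
  (symMap 𝒰 (colGrading 𝒰) (Finsupp.lsingle c) (lsingle_mem_colGrading 𝒰 c)).toLinearMap

/-- The algebra morphism `S(U^(ℕ)) → S(U)` that keeps the generators of colour `c` and sends
those of all other colours to zero. -/
def select (c : ℕ) : SymAlg (colGrading 𝒰) →ₗ[𝕜] SymAlg 𝒰 :=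
  (symMap (colGrading 𝒰) 𝒰 (Finsupp.lapply c) (lapply_mem 𝒰 c)).toLinearMap

/-- The projection of `U^(ℕ)` onto the vectors with colours less than `T`. -/
def colTrunc (T : ℕ) : (ℕ →₀ U) →ₗ[𝕜] (ℕ →₀ U) :=
  ∑ c ∈ Finset.range T, Finsupp.lsingle c ∘ₗ Finsupp.lapply c

theorem colTrunc_apply (T : ℕ) (v : ℕ →₀ U) (c : ℕ) :
    colTrunc (𝕜 := 𝕜) T v c = if c < T then v c else 0 := by
  simp only [colTrunc, LinearMap.sum_apply, LinearMap.comp_apply, Finsupp.lsingle_apply,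
    Finsupp.lapply_apply, Finsupp.finsetSum_apply, Finsupp.single_apply]
  simp

theorem colTrunc_mem (T : ℕ) (d : ℤ) (v : ℕ →₀ U) (hv : v ∈ colGrading 𝒰 d) :
    colTrunc (𝕜 := 𝕜) T v ∈ colGrading 𝒰 d := by
  intro c
  rw [colTrunc_apply]
  split_ifs
  · exact hv c
  · exact Submodule.zero_mem _

/-- The algebra endomorphism of `S(U^(ℕ))` that keeps the generators of colours less than `T`. -/
def symTrunc (T : ℕ) : SymAlg (colGrading 𝒰) →ₗ[𝕜] SymAlg (colGrading 𝒰) :=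
  (symMap (colGrading 𝒰) (colGrading 𝒰) (colTrunc T) (colTrunc_mem 𝒰 T)).toLinearMap

variable {𝒰}

theorem select_comp_symTrunc {c T : ℕ} (h : c < T) : select 𝒰 c ∘ₗ symTrunc 𝒰 T = select 𝒰 c :=
  symMap_comp _ _ _ _ _ _ fun v => by simp [colTrunc_apply, h]

theorem symTrunc_comp_paint {c T : ℕ} (h : c < T) : symTrunc 𝒰 T ∘ₗ paint 𝒰 c = paint 𝒰 c :=
  symMap_comp _ _ _ _ _ _ fun v => by
    ext c'
    by_cases hc : c = c'
    · subst hc; simp [colTrunc_apply, h]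
    · simp [colTrunc_apply, hc]

/-- If `a` has colours less than `T` and `b` has the colour `T`, then the component of `δ(a b)` with
its first factor in the former and its second factor in the latter colours is `a ⊗ b`. -/
theorem select_tensor_comul_mul_paint (T : ℕ) :
    TensorProduct.map (symTrunc 𝒰 T) (select 𝒰 T) ∘ₗ comul (colGrading 𝒰) ∘ₗ
      LinearMap.mul' 𝕜 (SymAlg (colGrading 𝒰)) ∘ₗ
      TensorProduct.map (symTrunc 𝒰 T) (paint 𝒰 T) =
    TensorProduct.map (symTrunc 𝒰 T) LinearMap.id := by
  refine separate_comul_mul _ _ _ _ _ _ ?_ ?_ ?_ ?_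
  · intro v
    ext c
    simp only [colTrunc_apply]
    split_ifs <;> rfl
  · intro v
    simp [colTrunc_apply]
  · intro u
    ext c
    rw [colTrunc_apply]
    by_cases hc : T = c
    · subst hc; simp
    · simp [hc]
  · intro u
    simp

end Colours

/-! ### Convolution powers of `exp(f) ∘ exp(g)` by replication -/

section Replica

variable {𝕜 R : Type*} [Field 𝕜] [CommRing R] [IsLocalRing R] [IsNoetherianRing R] [Algebra 𝕜 R]
variable {U₁ U₂ U₃ : Type*} [AddCommGroup U₁] [Module 𝕜 U₁] [AddCommGroup U₂] [Module 𝕜 U₂]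
  [AddCommGroup U₃] [Module 𝕜 U₃]
variable {𝒰₁ : ℤ → Submodule 𝕜 U₁} {𝒰₂ : ℤ → Submodule 𝕜 U₂} {𝒰₃ : ℤ → Submodule 𝕜 U₃}
variable [DirectSum.Decomposition 𝒰₁] [DirectSum.Decomposition 𝒰₂]

/-- The sum of the copies of `g` in the colours less than `T`. -/
def paintSum (g : Lin 𝕜 R 𝒰₁ 𝒰₂) (T : ℕ) : Lin 𝕜 R 𝒰₁ (colGrading 𝒰₂) :=
  ∑ c ∈ Finset.range T, baseC 𝕜 R (paint 𝒰₂ c) ∘ₗ g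

/-- The sum of the copies of `f` on the colours less than `T`. -/
def selectSum (f : Lin 𝕜 R 𝒰₂ 𝒰₃) (T : ℕ) : Lin 𝕜 R (colGrading 𝒰₂) 𝒰₃ :=
  ∑ c ∈ Finset.range T, f ∘ₗ baseC 𝕜 R (select 𝒰₂ c)

theorem isLin0_paintSum {g : Lin 𝕜 R 𝒰₁ 𝒰₂} (hg : IsLin0 g) (T : ℕ) : IsLin0 (paintSum g T) :=
  isLin0_sum _ fun c => hg.baseC_comp (𝒰₃ := colGrading 𝒰₂) (Finsupp.lsingle c)
    (lsingle_mem_colGrading 𝒰₂ c)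

theorem isLin0_selectSum {f : Lin 𝕜 R 𝒰₂ 𝒰₃} (hf : IsLin0 f) (T : ℕ) :
    IsLin0 (selectSum f T) :=
  isLin0_sum _ fun c => hf.comp_baseC (𝒰₁ := colGrading 𝒰₂) (Finsupp.lapply c) (lapply_mem 𝒰₂ c)

/-- The map `exp(G_T)` has its values in the part with colours less than `T`. -/
theorem symTrunc_comp_convExp_paintSum {g : Lin 𝕜 R 𝒰₁ 𝒰₂} (hg : IsLin0 g) (T : ℕ) :
    baseC 𝕜 R (symTrunc 𝒰₂ T) ∘ₗ convExp (paintSum g T) = convExp (paintSum g T) := by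
  refine (convExp_baseC_comp _ _ (isLin0_paintSum hg T).map_one).symm.trans ?_
  congr 1
  change baseC 𝕜 R (symTrunc 𝒰₂ T) ∘ₗ paintSum g T = _
  have h : ∀ B : Cpl 𝕜 R (SymAlg (colGrading 𝒰₂)) →ₗ[R] Cpl 𝕜 R (SymAlg (colGrading 𝒰₂)),
      B ∘ₗ paintSum g T = ∑ c ∈ Finset.range T, B ∘ₗ baseC 𝕜 R (paint 𝒰₂ c) ∘ₗ g := fun B =>
    LinearMap.ext fun x => by simp [paintSum]
  rw [h]
  refine Finset.sum_congr rfl fun c hc => ?_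
  rw [← LinearMap.comp_assoc, ← baseC_comp, symTrunc_comp_paint (Finset.mem_range.1 hc)]

/-- The map `exp(F_T)` depends only on the part with colours less than `T`. -/
theorem convExp_selectSum_comp_symTrunc {f : Lin 𝕜 R 𝒰₂ 𝒰₃} (hf : IsLin0 f) (T : ℕ) :
    convExp (selectSum f T) ∘ₗ baseC 𝕜 R (symTrunc 𝒰₂ T) = convExp (selectSum f T) := by
  refine (convExp_comp_baseC _ _ (isLin0_selectSum hf T).map_one).symm.trans ?_
  congr 1
  change selectSum f T ∘ₗ baseC 𝕜 R (symTrunc 𝒰₂ T) = _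
  have h : ∀ B : Cpl 𝕜 R (SymAlg (colGrading 𝒰₂)) →ₗ[R] Cpl 𝕜 R (SymAlg (colGrading 𝒰₂)),
      selectSum f T ∘ₗ B = ∑ c ∈ Finset.range T, (f ∘ₗ baseC 𝕜 R (select 𝒰₂ c)) ∘ₗ B := fun B =>
    LinearMap.ext fun x => by simp [selectSum]
  rw [h]
  refine Finset.sum_congr rfl fun c hc => ?_
  rw [LinearMap.comp_assoc, ← baseC_comp, select_comp_symTrunc (Finset.mem_range.1 hc)]

/-- Composition of convolution products that are separated by colours. -/
theorem conv_comp_conv {P : Lin 𝕜 R (colGrading 𝒰₂) 𝒰₃} {Q : Lin 𝕜 R 𝒰₁ (colGrading 𝒰₂)} (T : ℕ)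
    (hP : P ∘ₗ baseC 𝕜 R (symTrunc 𝒰₂ T) = P) (hQ : baseC 𝕜 R (symTrunc 𝒰₂ T) ∘ₗ Q = Q)
    (P' : Lin 𝕜 R 𝒰₂ 𝒰₃) (Q' : Lin 𝕜 R 𝒰₁ 𝒰₂) :
    conv P (P' ∘ₗ baseC 𝕜 R (select 𝒰₂ T)) ∘ₗ conv Q (baseC 𝕜 R (paint 𝒰₂ T) ∘ₗ Q') =
      conv (P ∘ₗ Q : Lin 𝕜 R 𝒰₁ 𝒰₃) (P' ∘ₗ Q') := by
  have h1 : tensor₂ P (P' ∘ₗ baseC 𝕜 R (select 𝒰₂ T)) =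
      tensor₂ P P' ∘ₗ baseC 𝕜 R (TensorProduct.map (symTrunc 𝒰₂ T) (select 𝒰₂ T)) := by
    rw [baseC_map, ← tensor₂_comp, hP]
  have h2 : tensor₂ Q (baseC 𝕜 R (paint 𝒰₂ T) ∘ₗ Q') =
      baseC 𝕜 R (TensorProduct.map (symTrunc 𝒰₂ T) (paint 𝒰₂ T)) ∘ₗ tensor₂ Q Q' := by
    rw [baseC_map, ← tensor₂_comp, hQ]
  have h3 : tensor₂ P P' ∘ₗ baseC 𝕜 R (TensorProduct.map (symTrunc 𝒰₂ T) LinearMap.id) ∘ₗ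
      tensor₂ Q Q' = tensor₂ (P ∘ₗ Q) (P' ∘ₗ Q') := by
    rw [baseC_map, ← tensor₂_comp, hQ, baseC_id, LinearMap.id_comp, tensor₂_comp]
  rw [conv, conv, conv, h1, h2, ← h3, ← select_tensor_comul_mul_paint T]
  simp only [baseC_comp, LinearMap.comp_assoc]

/-- The `T`-th convolution power of `exp(f) ∘ exp(g)` is the composition of the exponentials of
sums of `T` coloured copies of `f` and `g`. -/
theorem convExp_selectSum_comp_convExp_paintSum [CharZero 𝕜] {f : Lin 𝕜 R 𝒰₂ 𝒰₃}
    {g : Lin 𝕜 R 𝒰₁ 𝒰₂} (hf : IsLin0 f) (hg : IsLin0 g) (T : ℕ) :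
    convExp (selectSum f T) ∘ₗ convExp (paintSum g T) =
      convPow (convExp f ∘ₗ convExp g : Lin 𝕜 R 𝒰₁ 𝒰₃) T := by
  induction T with
  | zero =>
    have h0 : (Algebra.linearMap 𝕜 (SymAlg 𝒰₃) ∘ₗ (counit (colGrading 𝒰₂)).toLinearMap) ∘ₗ
        (Algebra.linearMap 𝕜 (SymAlg (colGrading 𝒰₂)) ∘ₗ (counit 𝒰₁).toLinearMap) =
          Algebra.linearMap 𝕜 (SymAlg 𝒰₃) ∘ₗ (counit 𝒰₁).toLinearMap :=
      LinearMap.ext fun x => by simp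
    rw [selectSum, paintSum, Finset.sum_range_zero, Finset.sum_range_zero, convExp_zero,
      convExp_zero, convUnit, convUnit, ← baseC_comp, h0, convPow, convUnit]
  | succ T ih =>
    have hF : selectSum f (T + 1) = selectSum f T + f ∘ₗ baseC 𝕜 R (select 𝒰₂ T) :=
      Finset.sum_range_succ _ _
    have hG : paintSum g (T + 1) = paintSum g T + baseC 𝕜 R (paint 𝒰₂ T) ∘ₗ g :=
      Finset.sum_range_succ _ _
    have hF' : convExp (selectSum f (T + 1)) =
        conv (convExp (selectSum f T)) (convExp f ∘ₗ baseC 𝕜 R (select 𝒰₂ T)) := by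
      rw [hF]
      refine (convExp_add (isLin0_selectSum hf T)
        (hf.comp_baseC (Finsupp.lapply T) (lapply_mem 𝒰₂ T))).trans ?_
      congr 1
      exact convExp_comp_baseC _ _ hf.map_one
    have hG' : convExp (paintSum g (T + 1)) =
        conv (convExp (paintSum g T)) (baseC 𝕜 R (paint 𝒰₂ T) ∘ₗ convExp g) := by
      rw [hG]
      refine (convExp_add (isLin0_paintSum hg T)
        (hg.baseC_comp (Finsupp.lsingle T) (lsingle_mem_colGrading 𝒰₂ T))).trans ?_
      congr 1
      exact convExp_baseC_comp _ _ hg.map_one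
    rw [hF', hG', conv_comp_conv T (convExp_selectSum_comp_symTrunc hf T)
      (symTrunc_comp_convExp_paintSum hg T), ih, convPow]

end Replica

/-! ### Iterated multiplication and comultiplication -/

section IteratedMul

variable {𝕜 U : Type*} [Field 𝕜] [AddCommGroup U] [Module 𝕜 U] (𝒰 : ℤ → Submodule 𝕜 U)

theorem mulIter_tprod (l : ℕ) (x : Fin l → SymAlg 𝒰) :
    mulIter 𝕜 𝒰 l (PiTensorProduct.tprod 𝕜 x) = (List.ofFn x).prod := by
  simp [mulIter]

theorem mulIter_comp_tcons (l : ℕ) : mulIter 𝕜 𝒰 (l + 1) ∘ₗ tcons 𝕜 (SymAlg 𝒰) l =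
    LinearMap.mul' 𝕜 (SymAlg 𝒰) ∘ₗ (mulIter 𝕜 𝒰 l).lTensor (SymAlg 𝒰) := by
  refine TensorProduct.ext' fun a w => ?_
  induction w using PiTensorProduct.induction_on with
  | smul_tprod c w =>
    rw [TensorProduct.tmul_smul, map_smul, map_smul]
    congr 1
    rw [LinearMap.comp_apply, tcons_tmul_tprod, mulIter_tprod, List.ofFn_cons, List.prod_cons,
      LinearMap.comp_apply, LinearMap.lTensor_tmul, mulIter_tprod, LinearMap.mul'_apply]
  | add a b ha hb => rw [TensorProduct.tmul_add, map_add, map_add, ha, hb]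

end IteratedMul

section IteratedComul

variable {𝕜 U : Type*} [Field 𝕜] [AddCommGroup U] [Module 𝕜 U] (𝒰 : ℤ → Submodule 𝕜 U)
  [DirectSum.Decomposition 𝒰]

/-- The iterated comultiplication `S(U) → S(U)^{⊗ l}`. -/
def iterComul : ∀ l : ℕ, SymAlg 𝒰 →ₗ[𝕜] (⨂[𝕜] _ : Fin l, SymAlg 𝒰)
  | 0 => LinearMap.toSpanSingleton 𝕜 _ (PiTensorProduct.tprod 𝕜 Fin.elim0) ∘ₗ
      (counit 𝒰).toLinearMap
  | l + 1 => tcons 𝕜 (SymAlg 𝒰) l ∘ₗ (iterComul l).lTensor (SymAlg 𝒰) ∘ₗ comul 𝒰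

/-- The operator `τ ⊗ ⋯ ⊗ τ ⊗ u ⊗ 1 ⊗ ⋯ ⊗ 1` on `S(U)^{⊗ l}`, with (left multiplication by) `u`
in position `b` and the sign of moving `u` across the preceding factors, for `u` of degree `d`. -/
def insertAt {l : ℕ} (d : ℤ) (u : U) (b : Fin l) :
    (⨂[𝕜] _ : Fin l, SymAlg 𝒰) →ₗ[𝕜] (⨂[𝕜] _ : Fin l, SymAlg 𝒰) :=
  PiTensorProduct.map fun c => if c < b then (twist 𝒰 d).toLinearMap else
    if c = b then LinearMap.mulLeft 𝕜 (gen 𝒰 u) else LinearMap.id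

variable {𝒰}

theorem insertAt_zero_tcons {l : ℕ} (d : ℤ) (u : U) (a : SymAlg 𝒰)
    (w : ⨂[𝕜] _ : Fin l, SymAlg 𝒰) :
    insertAt 𝒰 d u 0 (tcons 𝕜 (SymAlg 𝒰) l (a ⊗ₜ w)) =
      tcons 𝕜 (SymAlg 𝒰) l ((gen 𝒰 u * a) ⊗ₜ w) := by
  induction w using PiTensorProduct.induction_on with
  | smul_tprod c w =>
    simp only [TensorProduct.tmul_smul, map_smul]
    congr 1
    rw [tcons_tmul_tprod, tcons_tmul_tprod, insertAt, PiTensorProduct.map_tprod]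
    congr 1
    funext b
    refine Fin.cases ?_ (fun b => ?_) b <;> simp
  | add a b ha hb => simp only [TensorProduct.tmul_add, map_add, ha, hb]

theorem insertAt_succ_tcons {l : ℕ} (d : ℤ) (u : U) (b : Fin l) (a : SymAlg 𝒰)
    (w : ⨂[𝕜] _ : Fin l, SymAlg 𝒰) :
    insertAt 𝒰 d u b.succ (tcons 𝕜 (SymAlg 𝒰) l (a ⊗ₜ w)) =
      tcons 𝕜 (SymAlg 𝒰) l (twist 𝒰 d a ⊗ₜ insertAt 𝒰 d u b w) := by
  induction w using PiTensorProduct.induction_on with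
  | smul_tprod c w =>
    simp only [TensorProduct.tmul_smul, map_smul]
    congr 1
    rw [tcons_tmul_tprod, insertAt, insertAt, PiTensorProduct.map_tprod,
      PiTensorProduct.map_tprod, tcons_tmul_tprod]
    congr 1
    funext b
    refine Fin.cases ?_ (fun b => ?_) b <;> simp
  | add a b ha hb => simp only [TensorProduct.tmul_add, map_add, ha, hb]

/-- A generator acts on the iterated comultiplication as the sum of its insertions in the `l`
factors. -/
theorem iterComul_gen_mul (l : ℕ) {d : ℤ} {u : U} (hu : u ∈ 𝒰 d) (x : SymAlg 𝒰) :
    iterComul 𝒰 l (gen 𝒰 u * x) = ∑ b, insertAt 𝒰 d u b (iterComul 𝒰 l x) := by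
  induction l generalizing x with
  | zero => simp [iterComul, counit_gen]
  | succ l ih =>
    rw [Fin.sum_univ_succ]
    simp only [iterComul, LinearMap.comp_apply]
    rw [comul_gen_mul 𝒰 hu]
    generalize comul 𝒰 x = z
    induction z using TensorProduct.induction_on with
    | zero => simp
    | tmul a b =>
      simp only [insertDeg_tmul, map_add, LinearMap.lTensor_tmul, insertAt_zero_tcons,
        insertAt_succ_tcons, ih, TensorProduct.tmul_sum, map_sum]
    | add a b ha hb =>
      simp only [map_add, Finset.sum_add_distrib, ha, hb]
      abel

/-- The product of the `x p` over the fibre of `ψ` over `b`, in increasing order. -/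
def fibreWord {M : Type*} [Monoid M] {n l : ℕ} (x : Fin n → M) (ψ : Fin n → Fin l) (b : Fin l) :
    M :=
  (List.ofFn fun p => if ψ p = b then x p else 1).prod

/-- The Koszul sign of sorting homogeneous elements of degrees `e p` by the fibres of `ψ`. -/
def fibreSign {n l : ℕ} (e : Fin n → ℤ) (ψ : Fin n → Fin l) : ℤˣ :=
  ∏ p, ∏ q, if p < q ∧ ψ q < ψ p then (e p * e q).negOnePow else 1

theorem fibreWord_cons {M : Type*} [Monoid M] {n l : ℕ} (x : Fin (n + 1) → M) (b : Fin l)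
    (ψ : Fin n → Fin l) (c : Fin l) : fibreWord x (Fin.cons b ψ : Fin (n + 1) → Fin l) c =
      (if b = c then x 0 else 1) * fibreWord (fun p => x p.succ) ψ c := by
  simp [fibreWord, List.ofFn_succ]

theorem fibreSign_cons {n l : ℕ} (e : Fin (n + 1) → ℤ) (b : Fin l) (ψ : Fin n → Fin l) :
    fibreSign e (Fin.cons b ψ : Fin (n + 1) → Fin l) =
      (∏ p, if ψ p < b then (e 0 * e p.succ).negOnePow else 1) *
        fibreSign (fun p => e p.succ) ψ := by
  simp [fibreSign, Fin.prod_univ_succ]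

theorem twist_fibreWord {n l : ℕ} {e : Fin n → ℤ} {u : Fin n → U} (hu : ∀ p, u p ∈ 𝒰 (e p))
    (ψ : Fin n → Fin l) (b : Fin l) (d : ℤ) :
    twist 𝒰 d (fibreWord (fun p => gen 𝒰 (u p)) ψ b) =
      (∏ p, if ψ p = b then (d * e p).negOnePow else 1) •
        fibreWord (fun p => gen 𝒰 (u p)) ψ b := by
  induction n with
  | zero => simp [fibreWord]
  | succ n ih =>
    have h := ih (fun p => hu p.succ) fun p => ψ p.succ
    simp only [fibreWord, List.ofFn_succ, List.prod_cons, map_mul, Fin.prod_univ_succ] at h ⊢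
    rw [h, mul_smul]
    split_ifs
    · rw [twist_gen 𝒰 d (hu 0)]
      simp only [Units.smul_def, smul_mul_assoc, mul_smul_comm]
      rw [smul_comm]
    · simp

theorem tprod_units_smul {l : ℕ} (s : Fin l → ℤˣ) (y : Fin l → SymAlg 𝒰) :
    PiTensorProduct.tprod 𝕜 (fun c => s c • y c) = (∏ c, s c) • PiTensorProduct.tprod 𝕜 y := by
  have h := (PiTensorProduct.tprod 𝕜 (s := fun _ : Fin l => SymAlg 𝒰)).map_smul_univ
    (fun c => (((s c : ℤˣ) : ℤ) : 𝕜)) y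
  simp only [Int.cast_smul_eq_zsmul] at h
  simp only [Units.smul_def]
  rw [h, ← Int.cast_prod, Int.cast_smul_eq_zsmul, Units.coe_prod]

/-- The iterated comultiplication of a word distributes its letters over the `l` factors in all
possible ways. -/
theorem iterComul_word (l : ℕ) {n : ℕ} {e : Fin n → ℤ} {u : Fin n → U} (hu : ∀ p, u p ∈ 𝒰 (e p)) :
    iterComul 𝒰 l (List.ofFn fun p => gen 𝒰 (u p)).prod =
      ∑ ψ : Fin n → Fin l, fibreSign e ψ •
        PiTensorProduct.tprod 𝕜 (fibreWord (fun p => gen 𝒰 (u p)) ψ) := by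
  induction n with
  | zero =>
    have h1 : ∀ l, iterComul 𝒰 l 1 = PiTensorProduct.tprod 𝕜 fun _ => 1 := by
      intro l
      induction l with
      | zero =>
        simp only [iterComul, LinearMap.comp_apply, AlgHom.toLinearMap_apply, map_one,
          LinearMap.toSpanSingleton_apply, one_smul]
        exact congrArg _ (Subsingleton.elim _ _)
      | succ l ih =>
        simp only [iterComul, LinearMap.comp_apply, comul_one, LinearMap.lTensor_tmul, ih,
          tcons_tmul_tprod]
        congr 1
        funext b
        refine Fin.cases ?_ (fun b => ?_) b <;> simp
    rw [Fintype.sum_unique]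
    simp [h1, fibreSign]
    rfl
  | succ n ih =>
    rw [List.ofFn_succ, List.prod_cons, iterComul_gen_mul l (hu 0), ih fun p => hu p.succ,
      ← (Fin.consEquiv fun _ => Fin l).sum_comp, Fintype.sum_prod_type]
    refine Finset.sum_congr rfl fun b _ => ?_
    rw [map_sum]
    refine Finset.sum_congr rfl fun ψ _ => ?_
    change _ = fibreSign e (Fin.cons b ψ : Fin (n + 1) → Fin l) • PiTensorProduct.tprod 𝕜
      (fibreWord (fun p => gen 𝒰 (u p)) (Fin.cons b ψ : Fin (n + 1) → Fin l))
    rw [fibreSign_cons, mul_comm, mul_smul, Units.smul_def, map_zsmul, ← Units.smul_def]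
    congr 1
    have hs : (∏ p, if ψ p < b then (e 0 * e p.succ).negOnePow else 1) =
        ∏ c : Fin l, if c < b then ∏ p, (if ψ p = c then (e 0 * e p.succ).negOnePow else 1)
          else 1 := by
      have : ∀ c : Fin l, (if c < b then
          ∏ p, (if ψ p = c then (e 0 * e p.succ).negOnePow else 1) else 1) =
          ∏ p, if ψ p = c then (if c < b then (e 0 * e p.succ).negOnePow else 1) else 1 := by
        intro c
        split_ifs <;> simp
      simp only [this]
      rw [Finset.prod_comm]
      simp
    rw [hs, ← tprod_units_smul, insertAt, PiTensorProduct.map_tprod]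
    congr 1
    funext c
    rw [fibreWord_cons]
    split_ifs with h1 h2 h3
    · exact absurd h1 (by rw [h2]; exact lt_irrefl _)
    · rw [one_mul]
      exact twist_fibreWord (fun p => hu p.succ) ψ c (e 0)
    · rw [one_smul]
      rfl
    · exact absurd h3.symm (by assumption)
    · exact absurd (by assumption : b = c).symm h3
    · rw [one_mul, one_smul]
      rfl

end IteratedComul

section ConvPow

variable {𝕜 R : Type*} [Field 𝕜] [CommRing R] [IsLocalRing R] [IsNoetherianRing R] [Algebra 𝕜 R]
variable {U₁ U₂ : Type*} [AddCommGroup U₁] [Module 𝕜 U₁] [AddCommGroup U₂] [Module 𝕜 U₂]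
variable {𝒰₁ : ℤ → Submodule 𝕜 U₁} {𝒰₂ : ℤ → Submodule 𝕜 U₂} [DirectSum.Decomposition 𝒰₁]

/-- The convolution power is `μ^{[l]} f^{⊗ l} δ^{[l]}`. -/
theorem convPow_eq (f : Lin 𝕜 R 𝒰₁ 𝒰₂) (l : ℕ) : convPow f l =
    baseC 𝕜 R (mulIter 𝕜 𝒰₂ l) ∘ₗ tensorC (fun _ : Fin l => f) ∘ₗ
      baseC 𝕜 R (iterComul 𝒰₁ l) := by
  induction l with
  | zero =>
    refine hom_ext fun v => ?_
    simp only [convPow, convUnit, LinearMap.comp_apply, baseC_incl, iterComul,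
      LinearMap.toSpanSingleton_apply, map_smul, map_smul_field, tensorC_incl]
    rw [tprodC, MultilinearMap.constOfIsEmpty_apply, Function.const_apply, baseC_incl,
      mulIter_tprod]
    simp [Algebra.algebraMap_eq_smul_one]
  | succ l ih =>
    have h1 : baseC 𝕜 R (LinearMap.mul' 𝕜 (SymAlg 𝒰₂)) ∘ₗ baseC 𝕜 R
        (TensorProduct.map LinearMap.id (mulIter 𝕜 𝒰₂ l)) =
        baseC 𝕜 R (mulIter 𝕜 𝒰₂ (l + 1)) ∘ₗ baseC 𝕜 R (tcons 𝕜 (SymAlg 𝒰₂) l) := by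
      rw [← baseC_comp, ← baseC_comp, mulIter_comp_tcons]
      rfl
    have h2 : tensor₂ f (convPow f l) =
        baseC 𝕜 R (TensorProduct.map LinearMap.id (mulIter 𝕜 𝒰₂ l)) ∘ₗ
          tensor₂ f (tensorC fun _ : Fin l => f) ∘ₗ
            baseC 𝕜 R (TensorProduct.map LinearMap.id (iterComul 𝒰₁ l)) := by
      rw [baseC_map, baseC_map, ← tensor₂_comp, ← tensor₂_comp, ih]
      simp only [baseC_id, LinearMap.comp_id, LinearMap.id_comp]
    rw [convPow_succ', conv, h2, iterComul, baseC_comp, baseC_comp]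
    calc _ = (baseC 𝕜 R (LinearMap.mul' 𝕜 (SymAlg 𝒰₂)) ∘ₗ baseC 𝕜 R
          (TensorProduct.map LinearMap.id (mulIter 𝕜 𝒰₂ l))) ∘ₗ
          tensor₂ f (tensorC fun _ : Fin l => f) ∘ₗ
            baseC 𝕜 R (TensorProduct.map LinearMap.id (iterComul 𝒰₁ l)) ∘ₗ
              baseC 𝕜 R (comul 𝒰₁) := rfl
      _ = baseC 𝕜 R (mulIter 𝕜 𝒰₂ (l + 1)) ∘ₗ (baseC 𝕜 R (tcons 𝕜 (SymAlg 𝒰₂) l) ∘ₗ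
          tensor₂ f (tensorC fun _ : Fin l => f)) ∘ₗ
            baseC 𝕜 R (TensorProduct.map LinearMap.id (iterComul 𝒰₁ l)) ∘ₗ
              baseC 𝕜 R (comul 𝒰₁) := by rw [h1]; rfl
      _ = _ := by rw [← tensorC_tcons]; rfl

end ConvPow

/-! ### Unshuffles and maps between finite sets -/

section Unshuffles

variable {k n : ℕ} (a : Fin k → ℕ) (ha : ∑ c, a c = n)

/-- The segment that contains a given position. -/
def segIdx (p : Fin n) : Fin k := (finSigmaFinEquiv.symm (Fin.cast ha.symm p)).1

@[simp]
theorem segIdx_seg (c : Fin k) (p : Fin (a c)) : segIdx a ha (seg a ha c p) = c := by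
  subst ha
  simp [segIdx, seg]

theorem exists_seg (x : Fin n) : ∃ p, seg a ha (segIdx a ha x) p = x := by
  subst ha
  refine ⟨(finSigmaFinEquiv.symm x).2, ?_⟩
  change finSigmaFinEquiv ⟨(finSigmaFinEquiv.symm x).1, (finSigmaFinEquiv.symm x).2⟩ = x
  simp

theorem seg_val (c : Fin k) (p : Fin (a c)) : (seg a ha c p : ℕ) =
    ∑ i ∈ Finset.range c, (if h : i < k then a ⟨i, h⟩ else 0) + p := by
  subst ha
  simp only [seg, Fin.cast_eq_self]
  rw [finSigmaFinEquiv_apply, Finset.sum_range]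
  congr 1
  refine Finset.sum_congr rfl fun i _ => ?_
  rw [dif_pos (i.2.trans c.2)]
  rfl

theorem seg_strictMono (c : Fin k) : StrictMono (seg a ha c) := by
  intro p q h
  rw [Fin.lt_def, seg_val, seg_val]
  exact Nat.add_lt_add_left h _

theorem seg_lt_seg {c d : Fin k} (h : c < d) (p : Fin (a c)) (q : Fin (a d)) :
    seg a ha c p < seg a ha d q := by
  rw [Fin.lt_def, seg_val, seg_val]
  have h1 : ∑ i ∈ Finset.range (c + 1), (if h : i < k then a ⟨i, h⟩ else 0) ≤
      ∑ i ∈ Finset.range d, (if h : i < k then a ⟨i, h⟩ else 0) :=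
    Finset.sum_le_sum_of_subset (Finset.range_mono h)
  rw [Finset.sum_range_succ, dif_pos c.2] at h1
  have := p.2
  simp only [Fin.eta] at h1
  omega

theorem segIdx_mono {x y : Fin n} (h : x ≤ y) : segIdx a ha x ≤ segIdx a ha y := by
  by_contra hlt
  obtain ⟨p, hp⟩ := exists_seg a ha x
  obtain ⟨q, hq⟩ := exists_seg a ha y
  have := seg_lt_seg a ha (not_le.1 hlt) q p
  rw [hp, hq] at this
  exact absurd h (not_le.2 this)

/-- A product over segments of products over positions is the product over all positions. -/
theorem prod_ofFn_seg {M : Type*} [Monoid M] (y : Fin n → M) :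
    (List.ofFn fun c => (List.ofFn fun p => y (seg a ha c p)).prod).prod = (List.ofFn y).prod := by
  have h : (List.ofFn fun c => List.ofFn fun p => seg a ha c p).flatten = List.finRange n := by
    refine List.SortedLT.eq_of_mem_iff ?_ (List.sortedLT_finRange n) fun x => ?_
    · refine List.Pairwise.sortedLT ?_
      rw [List.pairwise_flatten]
      constructor
      · intro l hl
        obtain ⟨c, rfl⟩ := (List.mem_ofFn' _ _).1 hl
        rw [List.pairwise_ofFn]
        exact fun i j hij => seg_strictMono a ha c hij
      · rw [List.pairwise_ofFn]
        intro c d hcd x hx y hy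
        obtain ⟨p, rfl⟩ := (List.mem_ofFn' _ _).1 hx
        obtain ⟨q, rfl⟩ := (List.mem_ofFn' _ _).1 hy
        exact seg_lt_seg a ha hcd p q
    · obtain ⟨p, hp⟩ := exists_seg a ha x
      simp only [List.mem_flatten, List.mem_ofFn', List.mem_finRange, iff_true]
      exact ⟨_, ⟨_, rfl⟩, (List.mem_ofFn' _ _).2 ⟨p, hp⟩⟩
  rw [← List.map_id (List.ofFn y), List.map_id, List.ofFn_eq_map (f := y), ← h, List.map_flatten,
    List.prod_flatten, List.map_map, List.map_ofFn]
  congr 2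
  funext c
  simp [List.map_ofFn, Function.comp_def]

/-- The products over the fibres of `ψ` are the products along their increasing enumerations. -/
theorem fibreWord_eq_prod_ofFn {M : Type*} [Monoid M] {l m : ℕ} (x : Fin n → M)
    (ψ : Fin n → Fin l) (b : Fin l) (h : Fin m → Fin n) (hmono : StrictMono h)
    (hrange : ∀ p, ψ p = b ↔ ∃ q, h q = p) : fibreWord x ψ b = (List.ofFn (x ∘ h)).prod := by
  have h1 : ∀ L : List (Fin n), (L.map fun p => if ψ p = b then x p else 1).prod =
      ((L.filter fun p => ψ p = b).map x).prod := by
    intro L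
    induction L with
    | nil => simp
    | cons p L ih =>
      rw [List.map_cons, List.prod_cons, ih]
      by_cases hp : ψ p = b
      · simp [hp]
      · simp [hp]
  have h2 : (List.finRange n).filter (fun p => ψ p = b) = List.ofFn h := by
    refine List.SortedLT.eq_of_mem_iff ?_ ?_ fun p => ?_
    · exact ((List.sortedLT_finRange n).pairwise.filter _).sortedLT
    · exact List.Pairwise.sortedLT (List.pairwise_ofFn.2 fun i j hij => hmono hij)
    · simp [List.mem_filter, hrange]
  rw [fibreWord, List.ofFn_eq_map, h1, h2, List.map_ofFn]

/-- The map that sends each element to the segment of its position in the unshuffle. -/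
def unshuffleFun (κ : Equiv.Perm (Fin n)) (x : Fin n) : Fin k := segIdx a ha (κ.symm x)

@[simp]
theorem unshuffleFun_seg (κ : Equiv.Perm (Fin n)) (c : Fin k) (p : Fin (a c)) :
    unshuffleFun a ha κ (κ (seg a ha c p)) = c := by
  simp [unshuffleFun]

theorem unshuffleFun_eq_iff (κ : Equiv.Perm (Fin n)) (c : Fin k) (x : Fin n) :
    unshuffleFun a ha κ x = c ↔ ∃ p, κ (seg a ha c p) = x := by
  constructor
  · rintro rfl
    obtain ⟨p, hp⟩ := exists_seg a ha (κ.symm x)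
    exact ⟨p, (congrArg κ hp).trans (κ.apply_symm_apply x)⟩
  · rintro ⟨p, rfl⟩
    simp

theorem card_fibre_unshuffleFun (κ : Equiv.Perm (Fin n)) (c : Fin k) :
    (Finset.univ.filter fun x => unshuffleFun a ha κ x = c).card = a c := by
  have : (Finset.univ.filter fun x => unshuffleFun a ha κ x = c) =
      Finset.univ.map ⟨fun p => κ (seg a ha c p),
        κ.injective.comp (seg_strictMono a ha c).injective⟩ := by
    ext x
    simp [unshuffleFun_eq_iff]
  rw [this, Finset.card_map, Finset.card_univ, Fintype.card_fin]

/-- An unshuffle inverts exactly the pairs of elements that lie in segments in the wrong order. -/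
theorem koszulSign_eq_fibreSign {κ : Equiv.Perm (Fin n)} (hκ : IsUnshuffle a ha κ)
    (e : Fin n → ℤ) : koszulSign e κ = fibreSign e (unshuffleFun a ha κ) := by
  rw [koszulSign, fibreSign, Finset.prod_comm]
  refine (Finset.prod_congr rfl fun q _ => ?_).trans (Equiv.prod_comp κ _)
  refine Eq.trans ?_ (Equiv.prod_comp κ _)
  refine Finset.prod_congr rfl fun p _ => ?_
  rw [mul_comm (e (κ p))]
  refine if_congr ?_ rfl rfl
  simp only [unshuffleFun, Equiv.symm_apply_apply]
  rw [and_comm]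
  refine and_congr_right fun h => ⟨fun hpq => ?_, fun hpq => ?_⟩
  · refine lt_of_le_of_ne (segIdx_mono a ha hpq.le) fun heq => ?_
    obtain ⟨i, hi⟩ := exists_seg a ha p
    obtain ⟨j, hj⟩ : ∃ j, seg a ha (segIdx a ha p) j = q := by
      rw [heq]
      exact exists_seg a ha q
    have hij : i < j := by
      rw [← (seg_strictMono a ha (segIdx a ha p)).lt_iff_lt, hi, hj]
      exact hpq
    have := hκ _ hij
    simp only [hi, hj] at this
    exact lt_asymm this h
  · by_contra hle
    exact absurd (segIdx_mono a ha (not_lt.1 hle)) (not_le.2 hpq)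

theorem segProd_eq_fibreWord {𝕜 U : Type*} [Field 𝕜] [AddCommGroup U] [Module 𝕜 U]
    (𝒰 : ℤ → Submodule 𝕜 U) {κ : Equiv.Perm (Fin n)} (hκ : IsUnshuffle a ha κ) (u : Fin n → U) :
    segProd 𝒰 a ha (u ∘ κ) = fibreWord (fun p => gen 𝒰 (u p)) (unshuffleFun a ha κ) := by
  funext c
  exact (fibreWord_eq_prod_ofFn (fun p => gen 𝒰 (u p)) (unshuffleFun a ha κ) c
    (fun p => κ (seg a ha c p)) (hκ c) (unshuffleFun_eq_iff a ha κ c)).symm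

/-- An unshuffle enumerates the fibres of its map to the segments increasingly, and is therefore
determined by this map. -/
theorem unshuffleFun_injOn {κ κ' : Equiv.Perm (Fin n)} (hκ : IsUnshuffle a ha κ)
    (hκ' : IsUnshuffle a ha κ') (h : unshuffleFun a ha κ = unshuffleFun a ha κ') : κ = κ' := by
  have hc : ∀ c, (fun p => κ (seg a ha c p)) = fun p => κ' (seg a ha c p) := by
    intro c
    refine ((hκ c).range_inj (hκ' c)).1 (Set.ext fun x => ?_)
    rw [Set.mem_range, Set.mem_range, ← unshuffleFun_eq_iff, ← unshuffleFun_eq_iff, h]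
  refine Equiv.ext fun x => ?_
  obtain ⟨p, hp⟩ := exists_seg a ha x
  have := congrFun (hc (segIdx a ha x)) p
  simpa only [hp] using this

/-- The increasing enumerations of the fibres of `ψ` assemble to an unshuffle. -/
theorem exists_unshuffleFun_eq (ψ : Fin n → Fin k)
    (hψ : ∀ c, (Finset.univ.filter fun x => ψ x = c).card = a c) :
    ∃ κ, IsUnshuffle a ha κ ∧ unshuffleFun a ha κ = ψ := by
  let h : (Σ c, Fin (a c)) → Fin n := fun q =>
    (Finset.univ.filter fun x => ψ x = q.1).orderEmbOfFin (hψ q.1) q.2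
  have hmem : ∀ q, ψ (h q) = q.1 := fun q =>
    (Finset.mem_filter.1 (Finset.orderEmbOfFin_mem _ (hψ q.1) q.2)).2
  have hinj : Function.Injective h := by
    rintro ⟨c, p⟩ ⟨d, q⟩ hpq
    obtain rfl : c = d := (hmem ⟨c, p⟩).symm.trans ((congrArg ψ hpq).trans (hmem ⟨d, q⟩))
    exact congrArg _ (RelEmbedding.injective _ hpq)
  let E : (Σ c, Fin (a c)) ≃ Fin n := finSigmaFinEquiv.trans (finCongr ha)
  have hbij : Function.Bijective (h ∘ E.symm) :=
    Finite.injective_iff_bijective.1 (hinj.comp E.symm.injective)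
  have hE : ∀ c p, E.symm (seg a ha c p) = ⟨c, p⟩ := fun c p => E.symm_apply_apply ⟨c, p⟩
  refine ⟨Equiv.ofBijective _ hbij, fun c p q hpq => ?_, ?_⟩
  · simp only [Equiv.ofBijective_apply, Function.comp_apply, hE]
    exact (OrderEmbedding.strictMono _) hpq
  · funext x
    obtain ⟨y, rfl⟩ := hbij.2 x
    rw [unshuffleFun, Equiv.ofBijective_symm_apply_apply]
    obtain ⟨p, hp⟩ := exists_seg a ha y
    rw [← hp, Function.comp_apply, hE, hmem, segIdx_seg]

open Classical in
/-- Unshuffles of given segment lengths correspond to maps with given fibre cardinalities. -/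
theorem sum_unshuffle {M : Type*} [AddCommMonoid M] (F : (Fin n → Fin k) → M) :
    ∑ κ : Equiv.Perm (Fin n) with IsUnshuffle a ha κ, F (unshuffleFun a ha κ) =
      ∑ ψ : Fin n → Fin k with ∀ c, (Finset.univ.filter fun x => ψ x = c).card = a c, F ψ := by
  refine Finset.sum_bij (fun κ _ => unshuffleFun a ha κ) ?_ ?_ ?_ ?_
  · intro κ _
    simp [card_fibre_unshuffleFun]
  · exact fun κ hκ κ' hκ' h => unshuffleFun_injOn a ha (Finset.mem_filter.1 hκ).2
      (Finset.mem_filter.1 hκ').2 h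
  · intro ψ hψ
    obtain ⟨κ, hκ, h⟩ := exists_unshuffleFun_eq a ha ψ (Finset.mem_filter.1 hψ).2
    exact ⟨κ, Finset.mem_filter.2 ⟨Finset.mem_univ _, hκ⟩, h⟩
  · intro κ _
    rfl

end Unshuffles

/-! ### Colourings of graphs and interpolation -/

section Colourings

/-- The bipartite graph on `Fin l ⊕ Fin k` with one edge from `ψ p` to `α p` for each `p`
(multiple edges are identified). -/
def linkGraph {k l r : ℕ} (α : Fin r → Fin k) (ψ : Fin r → Fin l) :
    SimpleGraph (Fin l ⊕ Fin k) :=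
  SimpleGraph.fromRel fun x y => ∃ p, x = Sum.inl (ψ p) ∧ y = Sum.inr (α p)

/-- The graph of an unshuffle links the upper and the lower segment of each of the `r` elements. -/
theorem unshuffleGraph_eq_linkGraph {k l r : ℕ} (j : Fin k → ℕ) (s : Fin l → ℕ)
    (hj : ∑ a, j a = r) (hs : ∑ b, s b = r) (κ : Equiv.Perm (Fin r)) :
    unshuffleGraph j s hj hs κ = linkGraph (segIdx j hj) (unshuffleFun s hs κ) := by
  rw [unshuffleGraph, linkGraph]
  congr 1
  funext x y
  refine propext ⟨?_, ?_⟩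
  · rintro ⟨b, a, rfl, rfl, q, p, h⟩
    exact ⟨seg j hj a p, by rw [← h, unshuffleFun_seg], by rw [segIdx_seg]⟩
  · rintro ⟨p, rfl, rfl⟩
    obtain ⟨q, hq⟩ := (unshuffleFun_eq_iff s hs κ _ p).1 rfl
    obtain ⟨p', hp'⟩ := exists_seg j hj p
    exact ⟨_, _, rfl, rfl, q, p', hq.trans hp'.symm⟩

/-- The number of colourings that are constant on connected components. -/
theorem card_colourings {V : Type*} [Finite V] (G : SimpleGraph V) (T : ℕ) :
    Nat.card {c : V → Fin T // ∀ x y, G.Adj x y → c x = c y} =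
      T ^ Nat.card G.ConnectedComponent := by
  have hr : ∀ c : V → Fin T, (∀ x y, G.Adj x y → c x = c y) →
      ∀ x y, G.Reachable x y → c x = c y := by
    rintro c hc x y ⟨w⟩
    induction w with
    | nil => rfl
    | cons h _ ih => exact (hc _ _ h).trans ih
  let E : {c : V → Fin T // ∀ x y, G.Adj x y → c x = c y} ≃ (G.ConnectedComponent → Fin T) :=
    { toFun := fun c => Quot.lift c.1 (hr c.1 c.2)
      invFun := fun d => ⟨fun v => d (G.connectedComponentMk v), fun x y h =>
        congrArg d (SimpleGraph.ConnectedComponent.sound h.reachable)⟩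
      left_inv := fun c => rfl
      right_inv := fun d => by
        funext C
        induction C using SimpleGraph.ConnectedComponent.ind
        rfl }
  rw [Nat.card_congr E, Nat.card_fun, Nat.card_eq_fintype_card, Fintype.card_fin]

open Classical in
/-- The pairs of colourings of the lower and upper vertices that agree along all edges are counted
by a power of the number of colours, with the number of components as exponent. -/
theorem sum_colourings (𝕜 : Type*) [Field 𝕜] {k l r : ℕ} (α : Fin r → Fin k) (ψ : Fin r → Fin l)
    (T : ℕ) : ∑ col : Fin k → Fin T, ∑ col' : Fin l → Fin T,
      (if ∀ p, col (α p) = col' (ψ p) then (1 : 𝕜) else 0) =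
        (T : 𝕜) ^ Nat.card (linkGraph α ψ).ConnectedComponent := by
  rw [← Nat.cast_pow, ← card_colourings, Finset.sum_comm, ← Fintype.sum_prod_type',
    ← (Equiv.sumArrowEquivProdArrow (Fin l) (Fin k) (Fin T)).sum_comp, Finset.sum_boole,
    Nat.card_eq_fintype_card, Fintype.card_subtype]
  congr 2
  refine Finset.filter_congr fun c _ => ?_
  simp only [Equiv.sumArrowEquivProdArrow_apply_fst, Equiv.sumArrowEquivProdArrow_apply_snd,
    linkGraph, SimpleGraph.fromRel_adj]
  constructor
  · rintro h x y ⟨_, ⟨p, rfl, rfl⟩ | ⟨p, rfl, rfl⟩⟩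
    · exact (h p).symm
    · exact h p
  · exact fun h p => h _ _ ⟨Sum.inr_ne_inl, Or.inr ⟨p, rfl, rfl⟩⟩

theorem connected_iff_card_connectedComponent {V : Type*} [Finite V] (G : SimpleGraph V) :
    G.Connected ↔ Nat.card G.ConnectedComponent = 1 := by
  rw [SimpleGraph.connected_iff, Nat.card_eq_one_iff_unique]
  refine and_congr ⟨fun h => h.subsingleton_connectedComponent, fun h => ?_⟩
    ⟨fun h => inferInstance, fun ⟨C⟩ => ?_⟩
  · exact fun x y => SimpleGraph.ConnectedComponent.exact (Subsingleton.elim _ _)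
  · induction C using SimpleGraph.ConnectedComponent.ind with | _ v => exact ⟨v⟩

/-- There are at most as many components as vertices, which bounds the degree of the number of
colourings as a polynomial in the number of colours. -/
theorem card_connectedComponent_le {k l r : ℕ} (α : Fin r → Fin k) (ψ : Fin r → Fin l) :
    Nat.card (linkGraph α ψ).ConnectedComponent ≤ k + l := by
  refine (Nat.card_le_card_of_surjective _
    (Quot.mk_surjective (r := (linkGraph α ψ).Reachable))).trans ?_
  simp [Nat.card_eq_fintype_card, add_comm]

/-- `lam` is a system of weights that extracts the linear coefficient of polynomials of degree at
most `D` from their values at `0, …, D`. -/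
def IsWeights {𝕜 : Type*} [Field 𝕜] (D : ℕ) (lam : ℕ → 𝕜) : Prop :=
  ∀ P : Polynomial 𝕜, P.natDegree ≤ D →
    ∑ T ∈ Finset.range (D + 1), lam T * P.eval (T : 𝕜) = P.coeff 1

open Polynomial in
/-- Lagrange interpolation: the linear coefficient of a polynomial of bounded degree is a fixed
linear combination of its values at natural numbers. -/
theorem exists_isWeights (𝕜 : Type*) [Field 𝕜] [CharZero 𝕜] (D : ℕ) :
    ∃ lam : ℕ → 𝕜, IsWeights D lam := by
  refine ⟨fun T => (Lagrange.basis (Finset.range (D + 1)) (fun T : ℕ => (T : 𝕜)) T).coeff 1,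
    fun P hP => ?_⟩
  have h := Lagrange.eq_interpolate (s := Finset.range (D + 1)) (v := fun T : ℕ => (T : 𝕜))
    (f := P) (fun _ _ _ _ h => Nat.cast_injective h) (by
      rw [Finset.card_range]
      exact lt_of_le_of_lt (degree_le_natDegree) (by exact_mod_cast Nat.lt_succ_of_le hP))
  conv_rhs => rw [h]
  rw [Lagrange.interpolate_apply, finsetSum_coeff]
  exact Finset.sum_congr rfl fun T _ => by rw [coeff_C_mul, mul_comm]

open Polynomial in
/-- The linear coefficient of `X (X - 1) ⋯ (X - c)`. -/
theorem coeff_one_descPochhammer (𝕜 : Type*) [Field 𝕜] (c : ℕ) :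
    (descPochhammer 𝕜 (c + 1)).coeff 1 = (-1) ^ c * (c.factorial : 𝕜) := by
  have h : (descPochhammer 𝕜 c).eval (-1) = (-1) ^ c * (c.factorial : 𝕜) := by
    induction c with
    | zero => simp
    | succ c ih =>
      rw [descPochhammer_succ_right, eval_mul, ih, Nat.factorial_succ, pow_succ]
      simp
      ring
  rw [descPochhammer_succ_left, coeff_X_mul, coeff_zero_eq_eval_zero, eval_comp]
  simpa using h

open Polynomial in
theorem IsWeights.sum_pow {𝕜 : Type*} [Field 𝕜] {D : ℕ} {lam : ℕ → 𝕜} (h : IsWeights D lam)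
    {c : ℕ} (hc : c ≤ D) :
    ∑ T ∈ Finset.range (D + 1), lam T * (T : 𝕜) ^ c = if c = 1 then 1 else 0 := by
  have := h (X ^ c) (by simpa using hc)
  simp only [eval_pow, eval_X, coeff_X_pow] at this
  rw [this]
  exact if_congr eq_comm rfl rfl

open Polynomial in
/-- The linear coefficient of the binomial polynomial `binom(T, c + 1)` is that of the logarithmic
series at `c + 1`. -/
theorem IsWeights.sum_choose {𝕜 : Type*} [Field 𝕜] [CharZero 𝕜] {D : ℕ} {lam : ℕ → 𝕜}
    (h : IsWeights D lam) {c : ℕ} (hc : c + 1 ≤ D) :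
    ∑ T ∈ Finset.range (D + 1), lam T * (T.choose (c + 1) : 𝕜) =
      (-1) ^ c * ((c : 𝕜) + 1)⁻¹ := by
  have h1 := h (C ((c + 1).factorial : 𝕜)⁻¹ * descPochhammer 𝕜 (c + 1))
    ((natDegree_C_mul_le _ _).trans (by rwa [descPochhammer_natDegree]))
  have hf : ((c + 1).factorial : 𝕜) ≠ 0 := Nat.cast_ne_zero.2 (Nat.factorial_ne_zero _)
  have hf' : (c.factorial : 𝕜) ≠ 0 := Nat.cast_ne_zero.2 (Nat.factorial_ne_zero _)
  have h2 : ∀ T : ℕ, eval (T : 𝕜) (C ((c + 1).factorial : 𝕜)⁻¹ * descPochhammer 𝕜 (c + 1)) =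
      (T.choose (c + 1) : 𝕜) := by
    intro T
    rw [eval_mul, eval_C, descPochhammer_eval_eq_descFactorial,
      Nat.descFactorial_eq_factorial_mul_choose, Nat.cast_mul, ← mul_assoc, inv_mul_cancel₀ hf,
      one_mul]
  simp only [h2] at h1
  rw [h1, coeff_C_mul, coeff_one_descPochhammer, Nat.factorial_succ]
  have h3 : ((c : 𝕜) + 1) ≠ 0 := Nat.cast_add_one_ne_zero c
  push_cast
  field_simp

theorem IsWeights.sum_eq_zero {𝕜 : Type*} [Field 𝕜] {D : ℕ} {lam : ℕ → 𝕜}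
    (h : IsWeights D lam) : ∑ T ∈ Finset.range (D + 1), lam T = 0 := by
  simpa using h.sum_pow (Nat.zero_le D)

end Colourings

/-! ### Tensors of words -/

section TensorWords

variable {𝕜 U : Type*} [Field 𝕜] [AddCommGroup U] [Module 𝕜 U] {𝒰 : ℤ → Submodule 𝕜 U}
  [DirectSum.Decomposition 𝒰]

variable (𝒰) in
/-- Words in homogeneous generators, with their lengths and degrees. -/
abbrev Words : Type _ := {x : SymAlg 𝒰 // ∃ n d, IsWord 𝒰 n d x}

theorem span_range_words :
    Submodule.span 𝕜 (Set.range fun x : Words 𝒰 => (x : SymAlg 𝒰)) = ⊤ := by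
  refine (congrArg _ Subtype.range_coe).trans ?_
  exact eq_top_iff.2 fun x _ => mem_span_words x

/-- Homogeneous generators can be concatenated along the segments of `{1, …, r}`. -/
theorem exists_segProd_eq {k : ℕ} {x : Fin k → SymAlg 𝒰} {v : Fin k → ℕ} {d : Fin k → ℤ}
    (hx : ∀ a, IsWord 𝒰 (v a) (d a) (x a)) {r : ℕ} (hv : ∑ a, v a = r) :
    ∃ (e : Fin r → ℤ) (u : Fin r → U), (∀ p, u p ∈ 𝒰 (e p)) ∧ x = segProd 𝒰 v hv u := by
  choose e u h1 _ h3 using fun a => (hx a).exists_ofFn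
  let E : (Σ c, Fin (v c)) ≃ Fin r := finSigmaFinEquiv.trans (finCongr hv)
  have hE : ∀ c p, E.symm (seg v hv c p) = ⟨c, p⟩ := fun c p => E.symm_apply_apply ⟨c, p⟩
  have hsymm : ∀ F : (Σ c, Fin (v c)) → U, ∀ c p, F (E.symm (seg v hv c p)) = F ⟨c, p⟩ :=
    fun F c p => congrArg F (hE c p)
  refine ⟨fun p => e (E.symm p).1 (E.symm p).2, fun p => u (E.symm p).1 (E.symm p).2,
    fun p => h1 _ _, ?_⟩
  funext a
  refine (h3 a).trans (congrArg (fun L : List (SymAlg 𝒰) => L.prod) (congrArg List.ofFn ?_))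
  funext p
  exact congrArg (gen 𝒰) (hsymm (fun q => u q.1 q.2) a p).symm

theorem isWord_segProd {k r : ℕ} (v : Fin k → ℕ) (hv : ∑ a, v a = r) {e : Fin r → ℤ}
    {u : Fin r → U} (hu : ∀ p, u p ∈ 𝒰 (e p)) (a : Fin k) :
    IsWord 𝒰 (v a) (∑ p, e (seg v hv a p)) (segProd 𝒰 v hv u a) :=
  isWord_ofFn fun p => hu (seg v hv a p)

theorem isWord_fibreWord {l r : ℕ} {e : Fin r → ℤ} {u : Fin r → U} (hu : ∀ p, u p ∈ 𝒰 (e p))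
    (ψ : Fin r → Fin l) (b : Fin l) : ∃ d, IsWord 𝒰
      (Finset.univ.filter fun p => ψ p = b).card d (fibreWord (fun p => gen 𝒰 (u p)) ψ b) := by
  rw [fibreWord_eq_prod_ofFn (fun p => gen 𝒰 (u p)) ψ b
    ((Finset.univ.filter fun p => ψ p = b).orderEmbOfFin rfl) (OrderEmbedding.strictMono _)
    fun p => by
      rw [← Set.mem_range, Finset.range_orderEmbOfFin]
      simp]
  exact ⟨_, isWord_ofFn fun q => hu _⟩

/-- Linear maps out of `S(U)^{⊗ k}` are determined by their values on tensors of products of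
homogeneous generators. -/
theorem tensor_lin_ext {k : ℕ} {M : Type*} [AddCommGroup M] [Module 𝕜 M]
    {F G : (⨂[𝕜] _ : Fin k, SymAlg 𝒰) →ₗ[𝕜] M}
    (h : ∀ (v : Fin k → ℕ) (r : ℕ) (hv : ∑ a, v a = r) (e : Fin r → ℤ) (u : Fin r → U),
      (∀ p, u p ∈ 𝒰 (e p)) → F (PiTensorProduct.tprod 𝕜 (segProd 𝒰 v hv u)) =
        G (PiTensorProduct.tprod 𝕜 (segProd 𝒰 v hv u))) : F = G := by
  refine PiTensorProduct.ext_of_span_eq_top (g := fun _ (x : Words 𝒰) => (x : SymAlg 𝒰))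
    (fun _ => span_range_words) fun x => ?_
  choose v d hx using fun a => (x a).2
  obtain ⟨e, u, hu, hxu⟩ := exists_segProd_eq hx rfl
  have := h v _ rfl e u hu
  rw [← hxu] at this
  exact this

variable (𝒰) in
/-- The projection of `S(U)^{⊗ k}` onto `S^{v_1}(U) ⊗ ⋯ ⊗ S^{v_k}(U)`. -/
def tensorProj {k : ℕ} (v : Fin k → ℕ) : (⨂[𝕜] _ : Fin k, SymAlg 𝒰) →ₗ[𝕜]
    (⨂[𝕜] _ : Fin k, SymAlg 𝒰) :=
  PiTensorProduct.map fun a => symProj 𝒰 (v a)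

theorem tensorProj_tprod {k : ℕ} {x : Fin k → SymAlg 𝒰} {v : Fin k → ℕ}
    (hx : ∀ a, x a ∈ symPow 𝒰 (v a)) (w : Fin k → ℕ) :
    tensorProj 𝒰 w (PiTensorProduct.tprod 𝕜 x) =
      if v = w then PiTensorProduct.tprod 𝕜 x else 0 := by
  rw [tensorProj, PiTensorProduct.map_tprod]
  split_ifs with h
  · subst h
    congr 1
    funext a
    rw [symProj_of_mem _ _ (hx a), if_pos rfl]
  · obtain ⟨a, ha⟩ := Function.ne_iff.1 h
    refine MultilinearMap.map_coord_zero _ a ?_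
    rw [symProj_of_mem _ _ (hx a), if_neg ha]

end TensorWords

/-! ### The connected part of `δ^{[l]} μ^{[k]}` by interpolation in the number of colours -/

section ConnPsi

variable {𝕜 U : Type*} [Field 𝕜] [AddCommGroup U] [Module 𝕜 U] (𝒰 : ℤ → Submodule 𝕜 U)
  [DirectSum.Decomposition 𝒰]

/-- The map `δ^{[l]} μ^{[k]}` with the factors of the source painted in the colours `col` and
the factors of the target restricted to the colours `col'`. -/
def colPsi {k l : ℕ} (col : Fin k → ℕ) (col' : Fin l → ℕ) :
    (⨂[𝕜] _ : Fin k, SymAlg 𝒰) →ₗ[𝕜] (⨂[𝕜] _ : Fin l, SymAlg 𝒰) :=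
  (PiTensorProduct.map fun b => select 𝒰 (col' b)) ∘ₗ iterComul (colGrading 𝒰) l ∘ₗ
    mulIter 𝕜 (colGrading 𝒰) k ∘ₗ PiTensorProduct.map fun a => paint 𝒰 (col a)

variable {𝒰}

/-- Multiplying painted words yields one word, with the letters coloured according to segments. -/
theorem mulIter_paint_segProd {k r : ℕ} (col : Fin k → ℕ) (j : Fin k → ℕ) (hj : ∑ a, j a = r)
    (u : Fin r → U) :
    mulIter 𝕜 (colGrading 𝒰) k (PiTensorProduct.map (fun a => paint 𝒰 (col a))
      (PiTensorProduct.tprod 𝕜 (segProd 𝒰 j hj u))) =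
      (List.ofFn fun p => gen (colGrading 𝒰)
        (Finsupp.single (col (segIdx j hj p)) (u p) : ℕ →₀ U)).prod := by
  have h1 : ∀ a, paint 𝒰 (col a) (segProd 𝒰 j hj u a) =
      (List.ofFn fun p => gen (colGrading 𝒰)
        (Finsupp.single (col (segIdx j hj (seg j hj a p))) (u (seg j hj a p)))).prod := by
    intro a
    rw [segProd, paint, AlgHom.toLinearMap_apply, map_list_prod, List.map_ofFn]
    congr 2
    funext p
    simp
  rw [PiTensorProduct.map_tprod, mulIter_tprod]
  simp only [h1]
  exact prod_ofFn_seg j hj fun p => gen (colGrading 𝒰)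
    (Finsupp.single (col (segIdx j hj p)) (u p) : ℕ →₀ U)

open Classical in
/-- Only those distributions `ψ` of the letters over the `l` factors survive for which each letter
has the colour of the factor that it is sent to. -/
theorem colPsi_segProd {k l r : ℕ} (col : Fin k → ℕ) (col' : Fin l → ℕ) (j : Fin k → ℕ)
    (hj : ∑ a, j a = r) {e : Fin r → ℤ} {u : Fin r → U} (hu : ∀ p, u p ∈ 𝒰 (e p)) :
    colPsi 𝒰 col col' (PiTensorProduct.tprod 𝕜 (segProd 𝒰 j hj u)) =
      ∑ ψ : Fin r → Fin l, (if ∀ p, col (segIdx j hj p) = col' (ψ p) then (1 : 𝕜) else 0) •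
        fibreSign e ψ • PiTensorProduct.tprod 𝕜 (fibreWord (fun p => gen 𝒰 (u p)) ψ) := by
  let y : Fin r → ℕ →₀ U := fun p => Finsupp.single (col (segIdx j hj p)) (u p)
  have hy : ∀ p, y p ∈ colGrading 𝒰 (e p) := fun p => lsingle_mem_colGrading 𝒰 _ _ _ (hu p)
  rw [colPsi, LinearMap.comp_apply, LinearMap.comp_apply, LinearMap.comp_apply,
    mulIter_paint_segProd, iterComul_word l hy, map_sum]
  refine Finset.sum_congr rfl fun ψ _ => ?_
  rw [Units.smul_def, map_zsmul, ← Units.smul_def, PiTensorProduct.map_tprod]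
  have h2 : ∀ b, select 𝒰 (col' b) (fibreWord (fun p => gen (colGrading 𝒰) (y p)) ψ b) =
      (List.ofFn fun p => if ψ p = b then
        (if col (segIdx j hj p) = col' b then gen 𝒰 (u p) else 0) else 1).prod := by
    intro b
    rw [fibreWord, select, AlgHom.toLinearMap_apply, map_list_prod, List.map_ofFn]
    congr 2
    funext p
    simp only [Function.comp_apply]
    rw [apply_ite (symMap (colGrading 𝒰) 𝒰 (Finsupp.lapply (col' b)) (lapply_mem 𝒰 (col' b))),
      map_one, symMap_gen, Finsupp.lapply_apply, Finsupp.single_apply, apply_ite (gen 𝒰), map_zero]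
  simp only [h2]
  split_ifs with h
  · rw [one_smul]
    congr 2
    funext b
    rw [fibreWord]
    congr 2
    funext p
    split_ifs with h3 h4
    · rfl
    · exact absurd (h3 ▸ h p) h4
    · rfl
  · rw [zero_smul]
    push Not at h
    obtain ⟨p, hp⟩ := h
    rw [MultilinearMap.map_coord_zero _ (ψ p)]
    · exact smul_zero (fibreSign e ψ)
    refine List.prod_eq_zero ?_
    rw [List.mem_ofFn']
    exact ⟨p, (if_pos rfl).trans (if_neg hp)⟩

variable (𝒰) in
/-- The weighted sum of the maps `colPsi` over all colourings with at most `D` colours. -/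
def avgPsi (lam : ℕ → 𝕜) (D k l : ℕ) :
    (⨂[𝕜] _ : Fin k, SymAlg 𝒰) →ₗ[𝕜] (⨂[𝕜] _ : Fin l, SymAlg 𝒰) :=
  ∑ T ∈ Finset.range (D + 1), lam T • ∑ col : Fin k → Fin T, ∑ col' : Fin l → Fin T,
    colPsi 𝒰 (fun a => col a) (fun b => col' b)

open Classical in
/-- The number of colourings of a graph with `T` colours that are constant on the components is
`T ^ c` for `c` components, so that the coefficient of `T` selects the connected graphs. -/
theorem avgPsi_segProd {lam : ℕ → 𝕜} {D : ℕ} (hlam : IsWeights D lam) {k l r : ℕ}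
    (hD : k + l ≤ D) (j : Fin k → ℕ)
    (hj : ∑ a, j a = r) {e : Fin r → ℤ} {u : Fin r → U} (hu : ∀ p, u p ∈ 𝒰 (e p)) :
    avgPsi 𝒰 lam D k l (PiTensorProduct.tprod 𝕜 (segProd 𝒰 j hj u)) =
      ∑ ψ : Fin r → Fin l with (linkGraph (segIdx j hj) ψ).Connected,
        fibreSign e ψ • PiTensorProduct.tprod 𝕜 (fibreWord (fun p => gen 𝒰 (u p)) ψ) := by
  simp only [avgPsi, LinearMap.sum_apply, LinearMap.smul_apply, colPsi_segProd _ _ j hj hu,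
    Fin.val_inj]
  have h : ∀ T : ℕ, ∑ col : Fin k → Fin T, ∑ col' : Fin l → Fin T, ∑ ψ : Fin r → Fin l,
      (if ∀ p, col (segIdx j hj p) = col' (ψ p) then (1 : 𝕜) else 0) •
        fibreSign e ψ • PiTensorProduct.tprod 𝕜 (fibreWord (fun p => gen 𝒰 (u p)) ψ) =
      ∑ ψ : Fin r → Fin l, ((T : 𝕜) ^ Nat.card (linkGraph (segIdx j hj) ψ).ConnectedComponent) •
        fibreSign e ψ • PiTensorProduct.tprod 𝕜 (fibreWord (fun p => gen 𝒰 (u p)) ψ) := by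
    intro T
    simp only [← sum_colourings, Finset.sum_smul]
    exact (Finset.sum_congr rfl fun col _ => Finset.sum_comm).trans Finset.sum_comm
  simp only [h, Finset.smul_sum, smul_smul (_ : 𝕜)]
  rw [Finset.sum_comm, Finset.sum_filter]
  refine Finset.sum_congr rfl fun ψ _ => ?_
  rw [← Finset.sum_smul, hlam.sum_pow ((card_connectedComponent_le _ _).trans hD)]
  simp only [connected_iff_card_connectedComponent]
  split_ifs <;> simp

variable [CharZero 𝕜]

open Classical in
/-- The component of the weighted sum of coloured maps between the given lengths satisfies the
defining formula of `¹Ψ`. Since it is a linear map from the start, the formula is consistent. -/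
theorem isConnPsi_tensorProj_avgPsi {lam : ℕ → 𝕜} {D : ℕ} (hlam : IsWeights D lam) {k l : ℕ}
    (hD : k + l ≤ D) (j : Fin k → ℕ) (s : Fin l → ℕ) :
    IsConnPsi 𝒰 j s (tensorProj 𝒰 s ∘ₗ avgPsi 𝒰 lam D k l ∘ₗ tensorProj 𝒰 j) where
  apply_prod r hj hs e u hu := by
    rw [LinearMap.comp_apply, LinearMap.comp_apply,
      tensorProj_tprod (fun a => (isWord_segProd j hj hu a).mem_symPow), if_pos rfl,
      avgPsi_segProd hlam hD j hj hu, map_sum]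
    have h1 : ∀ κ : Equiv.Perm (Fin r), IsUnshuffle s hs κ →
        koszulSign e κ • PiTensorProduct.tprod 𝕜 (segProd 𝒰 s hs (u ∘ κ)) =
          (fun ψ => fibreSign e ψ • PiTensorProduct.tprod 𝕜
            (fibreWord (fun p => gen 𝒰 (u p)) ψ)) (unshuffleFun s hs κ) := fun κ hκ => by
      rw [koszulSign_eq_fibreSign s hs hκ, segProd_eq_fibreWord s hs 𝒰 hκ]
    simp only [unshuffleGraph_eq_linkGraph]
    rw [← Finset.filter_filter, Finset.sum_filter
      fun κ => (linkGraph (segIdx j hj) (unshuffleFun s hs κ)).Connected]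
    rw [Finset.sum_congr rfl fun κ hκ => if_congr Iff.rfl (h1 κ (Finset.mem_filter.1 hκ).2) rfl,
      sum_unshuffle s hs fun ψ => if (linkGraph (segIdx j hj) ψ).Connected then
        fibreSign e ψ • PiTensorProduct.tprod 𝕜 (fibreWord (fun p => gen 𝒰 (u p)) ψ) else 0,
      Finset.sum_filter, Finset.sum_filter]
    refine Finset.sum_congr rfl fun ψ _ => ?_
    choose d hd using isWord_fibreWord hu ψ
    rw [Units.smul_def, map_zsmul, ← Units.smul_def,
      tensorProj_tprod (fun b => (hd b).mem_symPow)]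
    by_cases hψ : (fun b => (Finset.univ.filter fun p => ψ p = b).card) = s
    · rw [if_pos hψ, if_pos (congrFun hψ)]
      rfl
    · rw [if_neg hψ, if_neg fun h => hψ (funext h)]
      split_ifs
      · exact smul_zero (fibreSign e ψ)
      · rfl
  apply_other i x hx hij := by
    rw [LinearMap.comp_apply, LinearMap.comp_apply, tensorProj_tprod hx, if_neg hij, map_zero,
      map_zero]

/-- The equality of the sums of lengths is needed: otherwise the formula says nothing about the
values on `S^{j_1}(U) ⊗ ⋯ ⊗ S^{j_k}(U)`. -/
theorem IsConnPsi.unique {k l : ℕ} {j : Fin k → ℕ} {s : Fin l → ℕ} (hjs : ∑ a, j a = ∑ b, s b)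
    {Ψ Ψ' : (⨂[𝕜] _ : Fin k, SymAlg 𝒰) →ₗ[𝕜] (⨂[𝕜] _ : Fin l, SymAlg 𝒰)}
    (h : IsConnPsi 𝒰 j s Ψ) (h' : IsConnPsi 𝒰 j s Ψ') : Ψ = Ψ' := by
  refine tensor_lin_ext fun v r hv e u hu => ?_
  by_cases hvj : v = j
  · subst hvj
    rw [h.apply_prod r hv (hjs.symm.trans hv) e u hu, h'.apply_prod r hv (hjs.symm.trans hv) e u hu]
  · rw [h.apply_other v _ (fun a => (isWord_segProd v hv hu a).mem_symPow) hvj,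
      h'.apply_other v _ (fun a => (isWord_segProd v hv hu a).mem_symPow) hvj]

/-- The map `¹Ψ` is well defined. -/
theorem isConnPsi_connPsi {k l : ℕ} (j : Fin k → ℕ) (s : Fin l → ℕ) :
    IsConnPsi 𝒰 j s (connPsi 𝒰 j s) := by
  obtain ⟨lam, hlam⟩ := exists_isWeights 𝕜 (k + l)
  have h : ∃ Ψ, IsConnPsi 𝒰 j s Ψ := ⟨_, isConnPsi_tensorProj_avgPsi hlam le_rfl j s⟩
  rw [connPsi, dif_pos h]
  exact h.choose_spec

/-- The map `¹Ψ` is a component of the weighted sum of coloured maps, for all `D` at least the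
number `k + l` of vertices. -/
theorem connPsi_eq {lam : ℕ → 𝕜} {D : ℕ} (hlam : IsWeights D lam) {k l : ℕ}
    (hD : k + l ≤ D) {j : Fin k → ℕ} {s : Fin l → ℕ} (hjs : ∑ a, j a = ∑ b, s b) :
    connPsi 𝒰 j s = tensorProj 𝒰 s ∘ₗ avgPsi 𝒰 lam D k l ∘ₗ tensorProj 𝒰 j :=
  (isConnPsi_connPsi j s).unique hjs (isConnPsi_tensorProj_avgPsi hlam hD j s)

end ConnPsi

/-! ### Interpolation of `f ◇ g` from the convolution powers of `exp(f) ∘ exp(g)` -/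

section Interpolation

variable {𝕜 R : Type*} [Field 𝕜] [CharZero 𝕜] [CommRing R] [IsLocalRing R] [IsNoetherianRing R]
  [Algebra 𝕜 R]
variable {U₁ U₂ U₃ : Type*} [AddCommGroup U₁] [Module 𝕜 U₁] [AddCommGroup U₂] [Module 𝕜 U₂]
  [AddCommGroup U₃] [Module 𝕜 U₃]
variable {𝒰₁ : ℤ → Submodule 𝕜 U₁} {𝒰₂ : ℤ → Submodule 𝕜 U₂} {𝒰₃ : ℤ → Submodule 𝕜 U₃}
variable [DirectSum.Decomposition 𝒰₁] [DirectSum.Decomposition 𝒰₂] [DirectSum.Decomposition 𝒰₃]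

/-- The linear coefficient of `T ↦ (1 + h)^T`, cut off at degree `D`, is the partial sum of the
logarithmic series. -/
theorem IsWeights.sum_add_one_pow {A : Type*} [Ring A] [Algebra 𝕜 A] {D : ℕ} {lam : ℕ → 𝕜}
    (hlam : IsWeights D lam) (h : A) : ∑ T ∈ Finset.range (D + 1), lam T • (h + 1) ^ T =
      ∑ c ∈ Finset.range D, ((-1) ^ c * ((c : 𝕜) + 1)⁻¹) • h ^ (c + 1) := by
  have h1 : ∀ T ∈ Finset.range (D + 1), lam T • (h + 1) ^ T =
      ∑ c ∈ Finset.range (D + 1), (lam T * (T.choose c : 𝕜)) • h ^ c := by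
    intro T hT
    rw [(Commute.one_right h).add_pow, Finset.smul_sum]
    refine (Finset.sum_subset (Finset.range_mono (Finset.mem_range.1 hT)) fun c _ hc => ?_).trans
      (Finset.sum_congr rfl fun c _ => ?_)
    · rw [Nat.choose_eq_zero_of_lt (by simpa using hc)]
      simp
    · rw [one_pow, mul_one, mul_smul, ← nsmul_eq_mul', Nat.cast_smul_eq_nsmul]
  rw [Finset.sum_congr rfl h1, Finset.sum_comm, Finset.sum_range_succ']
  simp only [← Finset.sum_smul]
  rw [show ∑ T ∈ Finset.range (D + 1), lam T * (T.choose 0 : 𝕜) = 0 by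
    simpa using hlam.sum_eq_zero, zero_smul, add_zero]
  exact Finset.sum_congr rfl fun c hc => by rw [hlam.sum_choose (Finset.mem_range.1 hc)]

/-- Modulo `𝔪^N`, the value of `f ◇ g` on a word of length `n` is the weighted sum of the values of
the convolution powers of `exp(f) ∘ exp(g)`, for all `D` at least `n + N`. -/
theorem diamond_sub_sum_convPow_mem {f : Lin 𝕜 R 𝒰₂ 𝒰₃} {g : Lin 𝕜 R 𝒰₁ 𝒰₂} (hf : IsLin0 f)
    (hg : IsLin0 g) {D : ℕ} {lam : ℕ → 𝕜} (hlam : IsWeights D lam) {n : ℕ} {d : ℤ} {N : ℕ}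
    {x : SymAlg 𝒰₁} (hx : IsWord 𝒰₁ n d x) (hD : n + N ≤ D) :
    diamond f g (incl 𝕜 R x) - ∑ T ∈ Finset.range (D + 1),
      lam T • convPow (convExp f ∘ₗ convExp g : Lin 𝕜 R 𝒰₁ 𝒰₃) T (incl 𝕜 R x) ∈
        filt 𝕜 R (SymAlg 𝒰₃) N := by
  have h := toRing_diamond_sub_mem hf hg D
  rw [← hlam.sum_add_one_pow, map_sub, toRing_convUnit, sub_add_cancel] at h
  have h1 := filt_anti (by omega : N ≤ D - n) (h hx)
  rw [map_sub, map_sum] at h1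
  simpa only [evalAt_smul, ← toRing_convPow, evalAt_toRing] using h1

/-- On a word of length `n` the exponential can be cut off at order `n + N`, modulo `𝔪^N`. -/
theorem convExp_word_sub_mem {f : Lin 𝕜 R 𝒰₁ 𝒰₂}
    (hf : f (incl 𝕜 R 1) ∈ filt 𝕜 R (SymAlg 𝒰₂) 1) {n : ℕ} {d : ℤ} {N p : ℕ}
    {x : SymAlg 𝒰₁} (hx : IsWord 𝒰₁ n d x) (hp : n + N ≤ p) :
    convExp f (incl 𝕜 R x) - ∑ c ∈ Finset.range p, (c.factorial : 𝕜)⁻¹ •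
      convPow f c (incl 𝕜 R x) ∈ filt 𝕜 R (SymAlg 𝒰₂) N := by
  have h1 := filt_anti (by omega : N ≤ p - n) (toRing_convExp_sub_mem hf p hx)
  rw [map_sub, map_sum] at h1
  simpa only [evalAt_smul, ← toRing_convPow, evalAt_toRing] using h1

theorem tensorC_sum {V W : Type*} [AddCommGroup V] [Module 𝕜 V] [AddCommGroup W] [Module 𝕜 W]
    (k T : ℕ) (F : ℕ → (Cpl 𝕜 R V →ₗ[R] Cpl 𝕜 R W)) :
    tensorC (fun _ : Fin k => ∑ c ∈ Finset.range T, F c) =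
      ∑ col : Fin k → Fin T, tensorC fun a => F (col a) := by
  refine hom_ext_tprod fun v => ?_
  rw [tensorC_incl, LinearMap.sum_apply]
  simp only [tensorC_incl, LinearMap.sum_apply, Finset.sum_range]
  exact MultilinearMap.map_sum _ _

/-- The powers of the sum of the coloured copies of `g`, expanded over the colourings of the `k`
factors. -/
theorem convPow_paintSum (g : Lin 𝕜 R 𝒰₁ 𝒰₂) (T k : ℕ) : convPow (paintSum g T) k =
    ∑ col : Fin k → Fin T, baseC 𝕜 R (mulIter 𝕜 (colGrading 𝒰₂) k ∘ₗ
      PiTensorProduct.map fun a => paint 𝒰₂ (col a)) ∘ₗ tensorC (fun _ : Fin k => g) ∘ₗ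
        baseC 𝕜 R (iterComul 𝒰₁ k) := by
  rw [convPow_eq, paintSum, tensorC_sum]
  refine LinearMap.ext fun x => ?_
  simp only [LinearMap.comp_apply, LinearMap.sum_apply, map_sum]
  refine Finset.sum_congr rfl fun col _ => ?_
  rw [tensorC_comp, ← baseC_piMap, LinearMap.comp_apply, baseC_comp_apply]

/-- The powers of the sum of the coloured copies of `f`, expanded over the colourings of the `l`
factors. -/
theorem convPow_selectSum (f : Lin 𝕜 R 𝒰₂ 𝒰₃) (T l : ℕ) : convPow (selectSum f T) l =
    ∑ col : Fin l → Fin T, baseC 𝕜 R (mulIter 𝕜 𝒰₃ l) ∘ₗ tensorC (fun _ : Fin l => f) ∘ₗ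
      baseC 𝕜 R ((PiTensorProduct.map fun b => select 𝒰₂ (col b)) ∘ₗ
        iterComul (colGrading 𝒰₂) l) := by
  rw [convPow_eq, selectSum, tensorC_sum]
  refine LinearMap.ext fun x => ?_
  simp only [LinearMap.comp_apply, LinearMap.sum_apply, map_sum]
  refine Finset.sum_congr rfl fun col _ => ?_
  rw [tensorC_comp, ← baseC_piMap, LinearMap.comp_apply, baseC_comp_apply]

theorem convPow_selectSum_convPow_paintSum (f : Lin 𝕜 R 𝒰₂ 𝒰₃) (g : Lin 𝕜 R 𝒰₁ 𝒰₂) (T k l : ℕ)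
    (x : Cpl 𝕜 R (SymAlg 𝒰₁)) :
    convPow (selectSum f T) l (convPow (paintSum g T) k x) =
      ∑ col : Fin k → Fin T, ∑ col' : Fin l → Fin T, baseC 𝕜 R (mulIter 𝕜 𝒰₃ l)
        (tensorC (fun _ : Fin l => f) (baseC 𝕜 R (colPsi 𝒰₂ (fun a => col a) fun b => col' b)
          (tensorC (fun _ : Fin k => g) (baseC 𝕜 R (iterComul 𝒰₁ k) x)))) := by
  rw [convPow_paintSum, convPow_selectSum]
  simp only [LinearMap.comp_apply, LinearMap.sum_apply, map_sum, baseC_comp_apply]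
  rfl

/-- The weighted sum over `T` of the products of powers of the `T`-coloured exponents. -/
theorem sum_weights_convPow (f : Lin 𝕜 R 𝒰₂ 𝒰₃) (g : Lin 𝕜 R 𝒰₁ 𝒰₂) (lam : ℕ → 𝕜) (D k l : ℕ)
    (x : Cpl 𝕜 R (SymAlg 𝒰₁)) :
    ∑ T ∈ Finset.range (D + 1), lam T •
      convPow (selectSum f T) l (convPow (paintSum g T) k x) =
        baseC 𝕜 R (mulIter 𝕜 𝒰₃ l) (tensorC (fun _ : Fin l => f) (baseC 𝕜 R (avgPsi 𝒰₂ lam D k l)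
          (tensorC (fun _ : Fin k => g) (baseC 𝕜 R (iterComul 𝒰₁ k) x)))) := by
  simp only [convPow_selectSum_convPow_paintSum, avgPsi, baseC_sum, baseC_smul,
    LinearMap.sum_apply, map_sum, LinearMap.smul_apply, algebraMap_smul, map_smul_field]

end Interpolation

/-! ### Tensors of bounded length -/

section BoundedLength

variable {𝕜 R : Type*} [Field 𝕜] [CommRing R] [IsLocalRing R] [IsNoetherianRing R] [Algebra 𝕜 R]
variable {U₁ U₂ U₃ : Type*} [AddCommGroup U₁] [Module 𝕜 U₁] [AddCommGroup U₂] [Module 𝕜 U₂]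
  [AddCommGroup U₃] [Module 𝕜 U₃]
variable {𝒰₁ : ℤ → Submodule 𝕜 U₁} {𝒰₂ : ℤ → Submodule 𝕜 U₂} {𝒰₃ : ℤ → Submodule 𝕜 U₃}
variable [DirectSum.Decomposition 𝒰₁] [DirectSum.Decomposition 𝒰₂] [DirectSum.Decomposition 𝒰₃]

variable (𝕜 R 𝒰₁) in
/-- The elements of `S(U)^{⊗ k} ⊗̂ R` that are, modulo `𝔪^N`, combinations of tensors of words of
total length at most `ρ`. -/
def boundedLength (k ρ N : ℕ) : Submodule R (Cpl 𝕜 R (⨂[𝕜] _ : Fin k, SymAlg 𝒰₁)) :=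
  Submodule.span R {z | ∃ (v : Fin k → ℕ) (r : ℕ) (hv : ∑ a, v a = r) (e : Fin r → ℤ)
    (u : Fin r → U₁), (∀ p, u p ∈ 𝒰₁ (e p)) ∧ r ≤ ρ ∧
      z = incl 𝕜 R (PiTensorProduct.tprod 𝕜 (segProd 𝒰₁ v hv u))} ⊔ filt 𝕜 R _ N

theorem boundedLength_mono {k ρ ρ' N : ℕ} (h : ρ ≤ ρ') :
    boundedLength 𝕜 R 𝒰₁ k ρ N ≤ boundedLength 𝕜 R 𝒰₁ k ρ' N :=
  sup_le_sup_right (Submodule.span_mono (by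
    rintro _ ⟨v, r, hv, e, u, hu, hr, hz⟩
    exact ⟨v, r, hv, e, u, hu, hr.trans h, hz⟩)) _

/-- That a map sends tensors of bounded length to `𝔪^N` need only be checked on tensors of words. -/
theorem boundedLength_le_comap {W : Type*} [AddCommGroup W] [Module 𝕜 W] {k ρ N : ℕ}
    (F : Cpl 𝕜 R (⨂[𝕜] _ : Fin k, SymAlg 𝒰₁) →ₗ[R] Cpl 𝕜 R W)
    (h : ∀ (v : Fin k → ℕ) (r : ℕ) (hv : ∑ a, v a = r) (e : Fin r → ℤ) (u : Fin r → U₁),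
      (∀ p, u p ∈ 𝒰₁ (e p)) → r ≤ ρ →
        F (incl 𝕜 R (PiTensorProduct.tprod 𝕜 (segProd 𝒰₁ v hv u))) ∈ filt 𝕜 R W N)
    {z : Cpl 𝕜 R (⨂[𝕜] _ : Fin k, SymAlg 𝒰₁)} (hz : z ∈ boundedLength 𝕜 R 𝒰₁ k ρ N) :
    F z ∈ filt 𝕜 R W N := by
  have : boundedLength 𝕜 R 𝒰₁ k ρ N ≤ (filt 𝕜 R W N).comap F := by
    refine sup_le (Submodule.span_le.2 ?_) (filt_le_comap F N)
    rintro _ ⟨v, r, hv, e, u, hu, hr, rfl⟩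
    exact h v r hv e u hu hr
  exact this hz

theorem exists_mem_boundedLength {k : ℕ} (z : Cpl 𝕜 R (⨂[𝕜] _ : Fin k, SymAlg 𝒰₁)) (N : ℕ) :
    ∃ ρ, z ∈ boundedLength 𝕜 R 𝒰₁ k ρ N := by
  have hadd : ∀ y z : Cpl 𝕜 R (⨂[𝕜] _ : Fin k, SymAlg 𝒰₁),
      (∃ ρ, y ∈ boundedLength 𝕜 R 𝒰₁ k ρ N) → (∃ ρ, z ∈ boundedLength 𝕜 R 𝒰₁ k ρ N) →
        ∃ ρ, y + z ∈ boundedLength 𝕜 R 𝒰₁ k ρ N := by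
    rintro y z ⟨ρ, h⟩ ⟨ρ', h'⟩
    exact ⟨max ρ ρ', Submodule.add_mem _ (boundedLength_mono (le_max_left _ _) h)
      (boundedLength_mono (le_max_right _ _) h')⟩
  obtain ⟨y, hy, hyz⟩ := exists_span_sub_mem_filt z N
  rw [← add_sub_cancel y z]
  refine hadd _ _ ?_ ⟨0, Submodule.mem_sup_right hyz⟩
  clear hyz
  induction hy using Submodule.span_induction with
  | zero => exact ⟨0, Submodule.zero_mem _⟩
  | add a b _ _ ha hb => exact hadd a b ha hb
  | smul c a _ ha =>
    obtain ⟨ρ, h⟩ := ha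
    exact ⟨ρ, Submodule.smul_mem _ c h⟩
  | mem a ha =>
    obtain ⟨w, rfl⟩ := ha
    have hw := (PiTensorProduct.submodule_span_eq_top (ι := Fin k)
      (g := fun _ (x : Words 𝒰₁) => (x : SymAlg 𝒰₁)) fun _ => span_range_words).ge
        (Submodule.mem_top (x := w))
    induction hw using Submodule.span_induction with
    | zero => exact ⟨0, by rw [map_zero]; exact Submodule.zero_mem _⟩
    | add a b _ _ ha hb => rw [map_add]; exact hadd _ _ ha hb
    | smul c a _ ha =>
      obtain ⟨ρ, h⟩ := ha
      exact ⟨ρ, by rw [map_smul]; exact smul_field_mem _ c h⟩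
    | mem a ha =>
      obtain ⟨x, rfl⟩ := ha
      choose v d hx using fun a => (x a).2
      obtain ⟨e, u, hu, hxu⟩ := exists_segProd_eq hx rfl
      exact ⟨_, Submodule.mem_sup_left (Submodule.subset_span
        ⟨v, _, rfl, e, u, hu, le_rfl, by rw [← hxu]⟩)⟩

/-- The exponential of a sum of `T` coloured copies of `f` can be truncated on elements of bounded
length at an order that does not depend on `T`. -/
theorem convExp_selectSum_sub_mem [CharZero 𝕜] {f : Lin 𝕜 R 𝒰₂ 𝒰₃} (hf : IsLin0 f) (T : ℕ)
    {k ρ N : ℕ} (col : Fin k → ℕ) {L : ℕ} (hL : ρ + N ≤ L)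
    {z : Cpl 𝕜 R (⨂[𝕜] _ : Fin k, SymAlg 𝒰₂)} (hz : z ∈ boundedLength 𝕜 R 𝒰₂ k ρ N) :
    (convExp (selectSum f T) - ∑ c ∈ Finset.range L, algebraMap 𝕜 R (c.factorial : 𝕜)⁻¹ •
      convPow (selectSum f T) c) (baseC 𝕜 R (mulIter 𝕜 (colGrading 𝒰₂) k ∘ₗ
        PiTensorProduct.map fun a => paint 𝒰₂ (col a)) z) ∈ filt 𝕜 R (SymAlg 𝒰₃) N := by
  rw [← LinearMap.comp_apply]
  refine boundedLength_le_comap _ (fun v r hv e u hu hr => ?_) hz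
  rw [LinearMap.comp_apply, baseC_incl, LinearMap.comp_apply (mulIter _ _ _),
    mulIter_paint_segProd]
  have := convExp_word_sub_mem (isLin0_selectSum hf T).map_one (N := N) (p := L)
    (isWord_ofFn (𝒰 := colGrading 𝒰₂) (e := e)
      (u := fun p => (Finsupp.single (col (segIdx v hv p)) (u p) : ℕ →₀ U₂))
      fun p => lsingle_mem_colGrading 𝒰₂ _ _ _ (hu p)) (by omega)
  simpa only [LinearMap.sub_apply, LinearMap.sum_apply, LinearMap.smul_apply,
    algebraMap_smul] using this

theorem convExp_selectSum_convPow_paintSum_sub_mem [CharZero 𝕜] {f : Lin 𝕜 R 𝒰₂ 𝒰₃}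
    (hf : IsLin0 f) (g : Lin 𝕜 R 𝒰₁ 𝒰₂) (T : ℕ) {k ρ N L : ℕ} (hL : ρ + N ≤ L)
    {x : Cpl 𝕜 R (SymAlg 𝒰₁)}
    (hx : tensorC (fun _ : Fin k => g) (baseC 𝕜 R (iterComul 𝒰₁ k) x) ∈
      boundedLength 𝕜 R 𝒰₂ k ρ N) :
    convExp (selectSum f T) (convPow (paintSum g T) k x) - ∑ c ∈ Finset.range L,
      (c.factorial : 𝕜)⁻¹ • convPow (selectSum f T) c (convPow (paintSum g T) k x) ∈
        filt 𝕜 R (SymAlg 𝒰₃) N := by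
  have h : (convExp (selectSum f T) - ∑ c ∈ Finset.range L, algebraMap 𝕜 R (c.factorial : 𝕜)⁻¹ •
      convPow (selectSum f T) c) (convPow (paintSum g T) k x) ∈ filt 𝕜 R (SymAlg 𝒰₃) N := by
    rw [convPow_paintSum, LinearMap.sum_apply, map_sum]
    exact Submodule.sum_mem _ fun col _ => convExp_selectSum_sub_mem hf T _ hL hx
  simpa only [LinearMap.sub_apply, LinearMap.sum_apply, LinearMap.smul_apply,
    algebraMap_smul] using h

theorem symProj_zero (x : SymAlg 𝒰₁) : symProj 𝒰₁ 0 x = counit 𝒰₁ x • 1 := by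
  have : symProj 𝒰₁ 0 = LinearMap.toSpanSingleton 𝕜 _ 1 ∘ₗ (counit 𝒰₁).toLinearMap := by
    refine lin_ext fun n d x hx => ?_
    rw [symProj_word hx]
    split_ifs with h
    · subst h
      cases hx
      simp
    · simp [counit_word hx h]
  exact LinearMap.congr_fun this x

theorem tensorC_comp_eq {k : ℕ} (i j : Fin k → ℕ) (h : Lin 𝕜 R 𝒰₁ 𝒰₂) :
    tensorC (fun a => comp 𝕜 R 𝒰₁ (i a) (j a) h) =
      baseC 𝕜 R (tensorProj 𝒰₂ j) ∘ₗ tensorC (fun _ : Fin k => h) ∘ₗ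
        baseC 𝕜 R (tensorProj 𝒰₁ i) := by
  simp only [comp, tensorC_comp, tensorProj, baseC_piMap]

/-- Each factor `h(1)` contributes one power of `𝔪`. -/
theorem tensorC_comp_mem {k : ℕ} (i j : Fin k → ℕ) {h : Lin 𝕜 R 𝒰₁ 𝒰₂}
    (hh : h (incl 𝕜 R 1) ∈ filt 𝕜 R (SymAlg 𝒰₂) 1) {N : ℕ} (hN : ∑ a, i a + N ≤ k)
    (y : Cpl 𝕜 R (⨂[𝕜] _ : Fin k, SymAlg 𝒰₁)) :
    tensorC (fun a => comp 𝕜 R 𝒰₁ (i a) (j a) h) y ∈ filt 𝕜 R _ N := by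
  have hcard : N ≤ (Finset.univ.filter fun a => i a = 0).card := by
    have h1 : ∀ a, 1 ≤ i a + if i a = 0 then 1 else 0 := fun a => by split_ifs <;> omega
    have h2 := Finset.sum_le_sum fun a (_ : a ∈ Finset.univ) => h1 a
    rw [Finset.sum_add_distrib, ← Finset.card_filter, Finset.sum_const, Finset.card_univ,
      Fintype.card_fin, smul_eq_mul, mul_one] at h2
    omega
  have hzero : ∀ a, i a = 0 → ∀ x, comp 𝕜 R 𝒰₁ (i a) (j a) h (incl 𝕜 R x) ∈
      filt 𝕜 R (SymAlg 𝒰₂) 1 := by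
    intro a ha x
    rw [comp, ha, LinearMap.comp_apply, LinearMap.comp_apply, baseC_incl, symProj_zero, map_smul,
      map_smul_field, map_smul_field]
    exact smul_field_mem _ _ (map_mem_filt _ hh)
  refine map_mem_of_incl_mem _ le_rfl (fun w => ?_) y
  induction w using PiTensorProduct.induction_on with
  | smul_tprod c w =>
    rw [map_smul, map_smul_field, tensorC_incl]
    exact smul_field_mem _ _ (filt_anti hcard (tprodC_mem_filt _ _ _ fun a ha =>
      hzero a (Finset.mem_filter.1 ha).2 _))
  | add a b ha hb =>
    rw [map_add, map_add]
    exact Submodule.add_mem _ ha hb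

end BoundedLength

/-! ### The explicit formula -/

section ExplicitFormula

/-- The number of elements of the fibres of a map between finite sets. -/
def fibreCard {n k : ℕ} (ψ : Fin n → Fin k) (a : Fin k) : ℕ :=
  (Finset.univ.filter fun p => ψ p = a).card

theorem sum_fibreCard {n k : ℕ} (ψ : Fin n → Fin k) : ∑ a, fibreCard ψ a = n := by
  have := Finset.card_eq_sum_card_fiberwise (s := Finset.univ) (t := Finset.univ) (f := ψ)
    fun _ _ => Finset.mem_univ _
  rw [Finset.card_univ, Fintype.card_fin] at this
  exact this.symm

/-- The pairs of length vectors with the same sum, which is at most `ρ`. -/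
def lengthBox (k l ρ : ℕ) : Finset ((Fin k → ℕ) × (Fin l → ℕ)) :=
  (Finset.range (ρ + 1)).biUnion fun r =>
    Finset.piAntidiag Finset.univ r ×ˢ Finset.piAntidiag Finset.univ r

theorem mem_lengthBox {k l ρ : ℕ} {p : (Fin k → ℕ) × (Fin l → ℕ)} :
    p ∈ lengthBox k l ρ ↔ ∑ a, p.1 a = ∑ b, p.2 b ∧ ∑ a, p.1 a ≤ ρ := by
  simp only [lengthBox, Finset.mem_biUnion, Finset.mem_range, Finset.mem_product,
    Finset.mem_piAntidiag, Finset.mem_univ, implies_true, and_true]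
  constructor
  · rintro ⟨r, hr, h1, h2⟩
    exact ⟨h1.trans h2.symm, h1.le.trans (Nat.lt_succ_iff.1 hr)⟩
  · rintro ⟨h1, h2⟩
    exact ⟨_, Nat.lt_succ_of_le h2, rfl, h1.symm⟩

variable {𝕜 R : Type*} [Field 𝕜] [CommRing R] [IsLocalRing R] [IsNoetherianRing R]
  [Algebra 𝕜 R]
variable {U₁ U₂ U₃ : Type*} [AddCommGroup U₁] [Module 𝕜 U₁] [AddCommGroup U₂] [Module 𝕜 U₂]
  [AddCommGroup U₃] [Module 𝕜 U₃]
variable {𝒰₁ : ℤ → Submodule 𝕜 U₁} {𝒰₂ : ℤ → Submodule 𝕜 U₂} {𝒰₃ : ℤ → Submodule 𝕜 U₃}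
variable [DirectSum.Decomposition 𝒰₁] [DirectSum.Decomposition 𝒰₂] [DirectSum.Decomposition 𝒰₃]

/-- The product of elements of lengths `t_1, …, t_l` has length `t_1 + ⋯ + t_l`. -/
theorem symProj_comp_mulIter (l m : ℕ) : symProj 𝒰₁ m ∘ₗ mulIter 𝕜 𝒰₁ l =
    ∑ t ∈ Finset.piAntidiag (Finset.univ : Finset (Fin l)) m,
      mulIter 𝕜 𝒰₁ l ∘ₗ tensorProj 𝒰₁ t := by
  refine tensor_lin_ext fun v r hv e u hu => ?_
  have hw := isWord_ofFn hu
  rw [← prod_ofFn_seg v hv fun p => gen 𝒰₁ (u p)] at hw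
  simp only [LinearMap.sum_apply, LinearMap.comp_apply,
    tensorProj_tprod (fun a => (isWord_segProd v hv hu a).mem_symPow), mulIter_tprod, apply_ite,
    map_zero]
  rw [Finset.sum_ite_eq]
  refine (symProj_word hw m).trans (if_congr ?_ rfl rfl)
  simp [Finset.mem_piAntidiag, hv]

/-- On tensors of words of total length at most `ρ`, the sum of the maps `¹Ψ` over the box of length
vectors is the weighted sum of coloured maps: the source lengths are those of the given words, and
the target lengths are those of the fibres of `ψ`, for each graph that is given by a map `ψ`. -/
theorem sum_lengthBox_connPsi [CharZero 𝕜] {lam : ℕ → 𝕜} {D : ℕ} (hlam : IsWeights D lam)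
    {k l ρ r : ℕ} (hD : k + l ≤ D) (hr : r ≤ ρ) (v : Fin k → ℕ) (hv : ∑ a, v a = r)
    {e : Fin r → ℤ} {u : Fin r → U₂} (hu : ∀ p, u p ∈ 𝒰₂ (e p)) :
    ∑ p ∈ lengthBox k l ρ, tensorProj 𝒰₂ p.2 (connPsi 𝒰₂ p.1 p.2 (tensorProj 𝒰₂ p.1
      (PiTensorProduct.tprod 𝕜 (segProd 𝒰₂ v hv u)))) =
        avgPsi 𝒰₂ lam D k l (PiTensorProduct.tprod 𝕜 (segProd 𝒰₂ v hv u)) := by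
  classical
  have hP := fun w => tensorProj_tprod (fun a => (isWord_segProd v hv hu a).mem_symPow) w
  choose d hd using isWord_fibreWord (l := l) hu
  have hQ : ∀ ψ w, tensorProj 𝒰₂ w
      (PiTensorProduct.tprod 𝕜 (fibreWord (fun p => gen 𝒰₂ (u p)) ψ)) =
        if fibreCard ψ = w then PiTensorProduct.tprod 𝕜 (fibreWord (fun p => gen 𝒰₂ (u p)) ψ)
          else 0 := fun ψ w => tensorProj_tprod (fun b => (hd ψ b).mem_symPow) w
  have hterm : ∀ p ∈ lengthBox k l ρ, tensorProj 𝒰₂ p.2 (connPsi 𝒰₂ p.1 p.2 (tensorProj 𝒰₂ p.1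
      (PiTensorProduct.tprod 𝕜 (segProd 𝒰₂ v hv u)))) =
      ∑ ψ : Fin r → Fin l with (linkGraph (segIdx v hv) ψ).Connected,
        if (v, fibreCard ψ) = p then fibreSign e ψ • PiTensorProduct.tprod 𝕜
          (fibreWord (fun p => gen 𝒰₂ (u p)) ψ) else 0 := by
    rintro ⟨j, s⟩ hp
    rw [connPsi_eq hlam hD (mem_lengthBox.1 hp).1, LinearMap.comp_apply, LinearMap.comp_apply]
    by_cases hvj : v = j
    · subst hvj
      simp only [hP, if_true]
      rw [avgPsi_segProd hlam hD v hv hu, map_sum, map_sum]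
      refine Finset.sum_congr rfl fun ψ _ => ?_
      rw [Units.smul_def, map_zsmul, map_zsmul, hQ]
      by_cases hs : fibreCard ψ = s
      · subst hs
        rw [if_pos rfl, if_pos rfl, hQ, if_pos rfl]
      · rw [if_neg fun h => hs (Prod.ext_iff.1 h).2, if_neg hs, map_zero]
        exact zsmul_zero _
    · simp only [hP, if_neg hvj, map_zero]
      exact (Finset.sum_eq_zero fun ψ _ => if_neg fun h => hvj (Prod.ext_iff.1 h).1).symm
  rw [Finset.sum_congr rfl hterm, Finset.sum_comm, avgPsi_segProd hlam hD v hv hu]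
  refine Finset.sum_congr rfl fun ψ _ => ?_
  rw [Finset.sum_ite_eq, if_pos]
  rw [mem_lengthBox]
  exact ⟨hv.trans (sum_fibreCard ψ).symm, hv.le.trans hr⟩

/-- The same sum in the completion, on elements that are of bounded length modulo `𝔪^N`. -/
theorem sum_lengthBox_connPsi_sub_mem [CharZero 𝕜] {lam : ℕ → 𝕜} {D : ℕ}
    (hlam : IsWeights D lam) {k l ρ N : ℕ} (hD : k + l ≤ D)
    {z : Cpl 𝕜 R (⨂[𝕜] _ : Fin k, SymAlg 𝒰₂)} (hz : z ∈ boundedLength 𝕜 R 𝒰₂ k ρ N) :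
    ∑ p ∈ lengthBox k l ρ, baseC 𝕜 R (tensorProj 𝒰₂ p.2) (baseC 𝕜 R (connPsi 𝒰₂ p.1 p.2)
      (baseC 𝕜 R (tensorProj 𝒰₂ p.1) z)) - baseC 𝕜 R (avgPsi 𝒰₂ lam D k l) z ∈ filt 𝕜 R _ N := by
  have h := boundedLength_le_comap (∑ p ∈ lengthBox k l ρ, baseC 𝕜 R (tensorProj 𝒰₂ p.2) ∘ₗ
    baseC 𝕜 R (connPsi 𝒰₂ p.1 p.2) ∘ₗ baseC 𝕜 R (tensorProj 𝒰₂ p.1) -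
      baseC 𝕜 R (avgPsi 𝒰₂ lam D k l)) (fun v r hv e u hu hr => ?_) hz
  · simpa only [LinearMap.sub_apply, LinearMap.sum_apply, LinearMap.comp_apply] using h
  · simp only [LinearMap.sub_apply, LinearMap.sum_apply, LinearMap.comp_apply, baseC_incl]
    rw [← map_sum, sum_lengthBox_connPsi hlam hD hr v hv hu, sub_self]
    exact Submodule.zero_mem _

/-- The term of the explicit formula, with the unshuffle `σ` replaced by the map `ψ` that sends
each element to its segment. -/
def formulaSummand (f : Lin 𝕜 R 𝒰₂ 𝒰₃) (g : Lin 𝕜 R 𝒰₁ 𝒰₂) {n : ℕ} (e : Fin n → ℤ)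
    (u : Fin n → U₁) {k l : ℕ} (ψ : Fin n → Fin k) (t : Fin l → ℕ)
    (p : (Fin k → ℕ) × (Fin l → ℕ)) : Cpl 𝕜 R (SymAlg 𝒰₃) :=
  fibreSign e ψ • baseC 𝕜 R (mulIter 𝕜 𝒰₃ l) (graphMap f g (fibreCard ψ) p.1 p.2 t
    (incl 𝕜 R (PiTensorProduct.tprod 𝕜 (fibreWord (fun p => gen 𝒰₁ (u p)) ψ))))

theorem formulaTerm_eq (f : Lin 𝕜 R 𝒰₂ 𝒰₃) (g : Lin 𝕜 R 𝒰₁ 𝒰₂) {n m : ℕ} (e : Fin n → ℤ)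
    (u : Fin n → U₁) (c : FormulaIndex n m) : formulaTerm f g e u c =
      formulaSummand f g e u (unshuffleFun c.i c.hi c.σ) c.t (c.j, c.s) := by
  have hi : fibreCard (unshuffleFun c.i c.hi c.σ) = c.i :=
    funext fun a => card_fibre_unshuffleFun c.i c.hi c.σ a
  rw [formulaTerm, formulaSummand, koszulSign_eq_fibreSign c.i c.hi c.hσ,
    segProd_eq_fibreWord c.i c.hi 𝒰₁ c.hσ, hi]

/-- The image `g^{⊗ k}` of the tensor of the products over the fibres of `ψ`. -/
def splitImage (g : Lin 𝕜 R 𝒰₁ 𝒰₂) {n : ℕ} (u : Fin n → U₁) {k : ℕ} (ψ : Fin n → Fin k) :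
    Cpl 𝕜 R (⨂[𝕜] _ : Fin k, SymAlg 𝒰₂) :=
  tensorC (fun _ : Fin k => g)
    (incl 𝕜 R (PiTensorProduct.tprod 𝕜 (fibreWord (fun p => gen 𝒰₁ (u p)) ψ)))

theorem tensorC_comp_fibreWord (g : Lin 𝕜 R 𝒰₁ 𝒰₂) {n : ℕ} {e : Fin n → ℤ} {u : Fin n → U₁}
    (hu : ∀ p, u p ∈ 𝒰₁ (e p)) {k : ℕ} (ψ : Fin n → Fin k) (j : Fin k → ℕ) :
    tensorC (fun a => comp 𝕜 R 𝒰₁ (fibreCard ψ a) (j a) g)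
      (incl 𝕜 R (PiTensorProduct.tprod 𝕜 (fibreWord (fun p => gen 𝒰₁ (u p)) ψ))) =
        baseC 𝕜 R (tensorProj 𝒰₂ j) (splitImage g u ψ) := by
  choose d hd using isWord_fibreWord hu ψ
  rw [tensorC_comp_eq, LinearMap.comp_apply, LinearMap.comp_apply, baseC_incl,
    tensorProj_tprod (fun b => (hd b).mem_symPow), splitImage]
  congr 3
  exact if_pos rfl

theorem formulaSummand_eq (f : Lin 𝕜 R 𝒰₂ 𝒰₃) (g : Lin 𝕜 R 𝒰₁ 𝒰₂) {n : ℕ} {e : Fin n → ℤ}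
    {u : Fin n → U₁} (hu : ∀ p, u p ∈ 𝒰₁ (e p)) {k l : ℕ} (ψ : Fin n → Fin k) (t : Fin l → ℕ)
    (p : (Fin k → ℕ) × (Fin l → ℕ)) : formulaSummand f g e u ψ t p =
      fibreSign e ψ • ((k.factorial : 𝕜) * (l.factorial : 𝕜))⁻¹ •
        baseC 𝕜 R (mulIter 𝕜 𝒰₃ l) (baseC 𝕜 R (tensorProj 𝒰₃ t) (tensorC (fun _ : Fin l => f)
          (baseC 𝕜 R (tensorProj 𝒰₂ p.2) (baseC 𝕜 R (connPsi 𝒰₂ p.1 p.2)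
            (baseC 𝕜 R (tensorProj 𝒰₂ p.1) (splitImage g u ψ)))))) := by
  rw [formulaSummand, graphMap, LinearMap.smul_apply, algebraMap_smul, map_smul_field,
    LinearMap.comp_apply, LinearMap.comp_apply, tensorC_comp_fibreWord g hu,
    tensorC_comp_eq p.2 t f, LinearMap.comp_apply, LinearMap.comp_apply]

/-- A term lies in `𝔪^N` in three cases: there are many factors `g`, at least `k - n` of which are
applied to `1`; or the intermediate word is longer than any in the image of `g^{⊗ k}` modulo `𝔪^N`;
or there are many factors `f`, at least `l - ρ` of which are applied to `1` if the intermediate word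
has length at most `ρ`. -/
theorem formulaSummand_mem {f : Lin 𝕜 R 𝒰₂ 𝒰₃} {g : Lin 𝕜 R 𝒰₁ 𝒰₂} (hf : IsLin0 f)
    (hg : IsLin0 g) {n : ℕ} {e : Fin n → ℤ} {u : Fin n → U₁} (hu : ∀ p, u p ∈ 𝒰₁ (e p))
    {N ρ k l : ℕ} (ψ : Fin n → Fin k)
    (hρ : k < n + N → splitImage g u ψ ∈ boundedLength 𝕜 R 𝒰₂ k ρ N) (t : Fin l → ℕ)
    {p : (Fin k → ℕ) × (Fin l → ℕ)} (hp : ∑ a, p.1 a = ∑ b, p.2 b)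
    (h : n + N ≤ k ∨ ρ + N ≤ l ∨ ρ < ∑ a, p.1 a) :
    formulaSummand f g e u ψ t p ∈ filt 𝕜 R (SymAlg 𝒰₃) N := by
  refine zsign_smul_mem _ _ (map_mem_filt _ ?_)
  rw [graphMap, LinearMap.smul_apply, LinearMap.comp_apply, LinearMap.comp_apply]
  refine Submodule.smul_mem _ _ ?_
  by_cases hk : n + N ≤ k
  · refine map_mem_filt _ (map_mem_filt _ (tensorC_comp_mem _ _ hg.map_one ?_ _))
    rwa [sum_fibreCard]
  by_cases hρ' : ρ < ∑ a, p.1 a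
  · refine map_mem_filt _ (map_mem_filt _ ?_)
    rw [tensorC_comp_fibreWord g hu]
    refine boundedLength_le_comap _ (fun v r hv e u hu hr => ?_) (hρ (not_le.1 hk))
    rw [baseC_incl, tensorProj_tprod (fun a => (isWord_segProd v hv hu a).mem_symPow),
      if_neg (by rintro rfl; omega), map_zero]
    exact Submodule.zero_mem _
  · refine tensorC_comp_mem _ _ hf.map_one ?_ _
    rw [← hp]
    omega

/-- The contribution of one way to split `u_1 ⋯ u_n` into `k` factors. -/
theorem sum_formulaSummand_sub_mem [CharZero 𝕜] (f : Lin 𝕜 R 𝒰₂ 𝒰₃) (g : Lin 𝕜 R 𝒰₁ 𝒰₂) {n : ℕ}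
    {e : Fin n → ℤ} {u : Fin n → U₁} (hu : ∀ p, u p ∈ 𝒰₁ (e p)) (m : ℕ) {lam : ℕ → 𝕜} {D : ℕ}
    (hlam : IsWeights D lam) {k l ρ N : ℕ} (hD : k + l ≤ D) (ψ : Fin n → Fin k)
    (hρ : splitImage g u ψ ∈ boundedLength 𝕜 R 𝒰₂ k ρ N) :
    ∑ t ∈ Finset.piAntidiag (Finset.univ : Finset (Fin l)) m, ∑ p ∈ lengthBox k l ρ,
      formulaSummand f g e u ψ t p - fibreSign e ψ • ((k.factorial : 𝕜) * (l.factorial : 𝕜))⁻¹ •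
        baseC 𝕜 R (symProj 𝒰₃ m) (baseC 𝕜 R (mulIter 𝕜 𝒰₃ l) (tensorC (fun _ : Fin l => f)
          (baseC 𝕜 R (avgPsi 𝒰₂ lam D k l) (splitImage g u ψ)))) ∈ filt 𝕜 R (SymAlg 𝒰₃) N := by
  have h1 : ∀ y, ∑ t ∈ Finset.piAntidiag (Finset.univ : Finset (Fin l)) m,
      baseC 𝕜 R (mulIter 𝕜 𝒰₃ l) (baseC 𝕜 R (tensorProj 𝒰₃ t) y) =
        baseC 𝕜 R (symProj 𝒰₃ m) (baseC 𝕜 R (mulIter 𝕜 𝒰₃ l) y) := by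
    intro y
    simp only [baseC_comp_apply]
    rw [symProj_comp_mulIter, baseC_sum, LinearMap.sum_apply]
  have h2 := map_mem_filt (tensorC fun _ : Fin l => f)
    (sum_lengthBox_connPsi_sub_mem hlam hD (l := l) hρ)
  have h3 := zsign_smul_mem _ (fibreSign e ψ) (smul_field_mem _
    (((k.factorial : 𝕜) * (l.factorial : 𝕜))⁻¹) (map_mem_filt (baseC 𝕜 R (symProj 𝒰₃ m))
      (map_mem_filt (baseC 𝕜 R (mulIter 𝕜 𝒰₃ l)) h2)))
  rw [map_sub, map_sub, map_sub, smul_sub, smul_sub, ← h1] at h3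
  simp only [map_sum, Finset.smul_sum] at h3
  simp only [formulaSummand_eq f g hu]
  exact h3

/-- The image of a word under `g^{⊗ k} δ^{[k]}` is a sum over the ways to split the word. -/
theorem tensorC_iterComul_word (g : Lin 𝕜 R 𝒰₁ 𝒰₂) {n : ℕ} {e : Fin n → ℤ} {u : Fin n → U₁}
    (hu : ∀ p, u p ∈ 𝒰₁ (e p)) (k : ℕ) : tensorC (fun _ : Fin k => g)
      (baseC 𝕜 R (iterComul 𝒰₁ k) (incl 𝕜 R (List.ofFn fun p => gen 𝒰₁ (u p)).prod)) =
        ∑ ψ : Fin n → Fin k, fibreSign e ψ • splitImage g u ψ := by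
  rw [baseC_incl, iterComul_word k hu, map_sum, map_sum]
  refine Finset.sum_congr rfl fun ψ _ => ?_
  rw [Units.smul_def, map_zsmul, map_zsmul]
  rfl

/-- Modulo `𝔪^N`, the value of `f ◇ g` on a word is given by finitely many of the connected
maps. -/
theorem diamond_sub_sum_avgPsi_mem [CharZero 𝕜] {f : Lin 𝕜 R 𝒰₂ 𝒰₃} {g : Lin 𝕜 R 𝒰₁ 𝒰₂}
    (hf : IsLin0 f) (hg : IsLin0 g) {n : ℕ} {e : Fin n → ℤ} {u : Fin n → U₁}
    (hu : ∀ p, u p ∈ 𝒰₁ (e p)) {lam : ℕ → 𝕜} {D : ℕ} (hlam : IsWeights D lam) {ρ N : ℕ}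
    (hD : n + N ≤ D)
    (hρ : ∀ k < n + N, ∀ ψ : Fin n → Fin k, splitImage g u ψ ∈ boundedLength 𝕜 R 𝒰₂ k ρ N) :
    diamond f g (incl 𝕜 R (List.ofFn fun p => gen 𝒰₁ (u p)).prod) -
      ∑ k ∈ Finset.range (n + N), ∑ l ∈ Finset.range (ρ + N), ∑ ψ : Fin n → Fin k,
        fibreSign e ψ • ((k.factorial : 𝕜) * (l.factorial : 𝕜))⁻¹ •
          baseC 𝕜 R (mulIter 𝕜 𝒰₃ l) (tensorC (fun _ : Fin l => f)
            (baseC 𝕜 R (avgPsi 𝒰₂ lam D k l) (splitImage g u ψ))) ∈ filt 𝕜 R (SymAlg 𝒰₃) N := by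
  set X : Cpl 𝕜 R (SymAlg 𝒰₁) := incl 𝕜 R (List.ofFn fun p => gen 𝒰₁ (u p)).prod with hX
  have hw := isWord_ofFn hu
  have h1 := diamond_sub_sum_convPow_mem hf hg hlam hw hD
  have h2 : ∀ T, convPow (convExp f ∘ₗ convExp g : Lin 𝕜 R 𝒰₁ 𝒰₃) T X -
      ∑ k ∈ Finset.range (n + N), ∑ l ∈ Finset.range (ρ + N),
        ((k.factorial : 𝕜) * (l.factorial : 𝕜))⁻¹ •
          convPow (selectSum f T) l (convPow (paintSum g T) k X) ∈ filt 𝕜 R (SymAlg 𝒰₃) N := by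
    intro T
    -- first the inner and then the outer exponential is cut off, at orders independent of `T`
    rw [← convExp_selectSum_comp_convExp_paintSum hf hg, LinearMap.comp_apply]
    have h3 := map_mem_filt (convExp (selectSum f T))
      (convExp_word_sub_mem (isLin0_paintSum hg T).map_one (N := N) hw le_rfl)
    have h4 : ∑ k ∈ Finset.range (n + N), (k.factorial : 𝕜)⁻¹ •
        (convExp (selectSum f T) (convPow (paintSum g T) k X) - ∑ l ∈ Finset.range (ρ + N),
          (l.factorial : 𝕜)⁻¹ • convPow (selectSum f T) l (convPow (paintSum g T) k X)) ∈
            filt 𝕜 R (SymAlg 𝒰₃) N := by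
      refine Submodule.sum_mem _ fun k hk => smul_field_mem _ _
        (convExp_selectSum_convPow_paintSum_sub_mem hf g T le_rfl ?_)
      rw [tensorC_iterComul_word g hu]
      exact Submodule.sum_mem _ fun ψ _ => zsign_smul_mem _ _ (hρ k (Finset.mem_range.1 hk) ψ)
    have h5 := Submodule.add_mem _ h3 h4
    simp only [smul_sub, Finset.sum_sub_distrib, Finset.smul_sum, smul_smul, ← mul_inv] at h5
    rw [map_sub, map_sum] at h5
    simp only [map_smul_field] at h5
    rwa [sub_add_sub_cancel] at h5
  have h3 := Submodule.add_mem _ h1 (Submodule.sum_mem _ fun T (_ : T ∈ Finset.range (D + 1)) =>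
    smul_field_mem _ (lam T) (h2 T))
  simp only [smul_sub, Finset.sum_sub_distrib] at h3
  rw [sub_add_sub_cancel] at h3
  convert h3 using 2
  symm
  simp only [Finset.smul_sum]
  rw [Finset.sum_comm]
  refine Finset.sum_congr rfl fun k _ => ?_
  rw [Finset.sum_comm]
  refine Finset.sum_congr rfl fun l _ => ?_
  simp only [smul_comm (lam _)]
  rw [← Finset.smul_sum, sum_weights_convPow, tensorC_iterComul_word g hu]
  simp only [map_sum, Finset.smul_sum]
  refine Finset.sum_congr rfl fun ψ _ => ?_
  simp only [Units.smul_def, map_zsmul]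
  rw [smul_comm]

/-- A series converges to `x` if, modulo each `𝔪^N`, all terms outside some finite set vanish and
those inside it add up to `x`. -/
theorem adicHasSum_of_finset {V ι : Type*} [AddCommGroup V] [Module 𝕜 V] {v : ι → Cpl 𝕜 R V}
    {x : Cpl 𝕜 R V} (h : ∀ N, ∃ S : Finset ι, x - ∑ c ∈ S, v c ∈ filt 𝕜 R V N ∧
      ∀ c ∉ S, v c ∈ filt 𝕜 R V N) : AdicHasSum v x := by
  classical
  intro N
  obtain ⟨S, hS, hv⟩ := h N
  filter_upwards [Filter.eventually_ge_atTop S] with S' hS'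
  refine SModEq.symm ?_
  rw [SModEq.sub_mem, ← Finset.sum_sdiff hS', add_comm, ← sub_sub]
  exact Submodule.sub_mem _ hS (Submodule.sum_mem _ fun c hc => hv c (Finset.mem_sdiff.1 hc).2)

/-- The indices of the formula with the unshuffle replaced by the map to the segments. -/
abbrev FibreIndex (n : ℕ) : Type :=
  (kl : ℕ × ℕ) × (Fin n → Fin kl.1) × (Fin kl.2 → ℕ) × (Fin kl.1 → ℕ) × (Fin kl.2 → ℕ)

/-- The index with the lengths `i` and the unshuffle `σ` replaced by the map to the segments, from
which both can be recovered. -/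
def FormulaIndex.toFibreIndex {n m : ℕ} (c : FormulaIndex n m) : FibreIndex n :=
  ⟨(c.k, c.l), unshuffleFun c.i c.hi c.σ, c.t, c.j, c.s⟩

theorem toFibreIndex_injective {n m : ℕ} :
    Function.Injective (FormulaIndex.toFibreIndex : FormulaIndex n m → FibreIndex n) := by
  rintro ⟨k, l, hk, hl, i, t, j, s, hi, ht, hjs, σ, hσ⟩
    ⟨k', l', hk', hl', i', t', j', s', hi', ht', hjs', σ', hσ'⟩ h
  simp only [FormulaIndex.toFibreIndex, Sigma.mk.injEq, Prod.mk.injEq] at h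
  obtain ⟨⟨rfl, rfl⟩, h⟩ := h
  have h := eq_of_heq h
  simp only [Prod.mk.injEq] at h
  obtain ⟨hψ, rfl, rfl, rfl⟩ := h
  obtain rfl : i = i' := funext fun a => by
    rw [← card_fibre_unshuffleFun i hi σ, ← card_fibre_unshuffleFun i' hi' σ', hψ]
  obtain rfl : σ = σ' := unshuffleFun_injOn i hi hσ hσ' hψ
  rfl

/-- The conditions `k ≥ 1` and `l ≥ 1` on the indices of the formula are automatic for `n, m > 0`:
there is no map from a nonempty set to `Fin 0`, and no empty sum equals `m`. -/
theorem exists_toFibreIndex_eq {n m : ℕ} (hn : 0 < n) (hm : 0 < m) {k l : ℕ} (ψ : Fin n → Fin k)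
    {t : Fin l → ℕ} (ht : ∑ b, t b = m) {p : (Fin k → ℕ) × (Fin l → ℕ)}
    (hp : ∑ a, p.1 a = ∑ b, p.2 b) :
    ∃ c : FormulaIndex n m, c.toFibreIndex = ⟨(k, l), ψ, t, p⟩ := by
  have hk : 1 ≤ k := (ψ ⟨0, hn⟩).pos
  have hl : 1 ≤ l := by
    rcases Nat.eq_zero_or_pos l with rfl | h
    · simp only [Finset.univ_eq_empty, Finset.sum_empty] at ht
      omega
    · exact h
  obtain ⟨σ, hσ, h⟩ := exists_unshuffleFun_eq (fibreCard ψ) (sum_fibreCard ψ) ψ fun _ => rfl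
  exact ⟨⟨k, l, hk, hl, fibreCard ψ, t, p.1, p.2, sum_fibreCard ψ, ht, hp, σ, hσ⟩, by
    rw [FormulaIndex.toFibreIndex, h]⟩

/-- The explicit formula for the components of `f ◇ g` on words. -/
theorem adicHasSum_formulaTerm [CharZero 𝕜] {f : Lin 𝕜 R 𝒰₂ 𝒰₃} {g : Lin 𝕜 R 𝒰₁ 𝒰₂}
    (hf : IsLin0 f) (hg : IsLin0 g) {n m : ℕ} (hn : 0 < n) (hm : 0 < m) {e : Fin n → ℤ}
    {u : Fin n → U₁} (hu : ∀ p, u p ∈ 𝒰₁ (e p)) :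
    AdicHasSum (fun c : FormulaIndex n m => formulaTerm f g e u c)
      (comp 𝕜 R 𝒰₁ n m (diamond f g) (incl 𝕜 R (List.ofFn fun p => gen 𝒰₁ (u p)).prod)) := by
  classical
  refine adicHasSum_of_finset fun N => ?_
  -- for `k ≥ n + N` the terms lie in `𝔪^N`, so there are only finitely many images to bound
  obtain ⟨ρ, hρ⟩ : ∃ ρ, ∀ k < n + N, ∀ ψ : Fin n → Fin k,
      splitImage g u ψ ∈ boundedLength 𝕜 R 𝒰₂ k ρ N := by
    choose ρ₀ hρ₀ using fun (k : ℕ) (ψ : Fin n → Fin k) =>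
      exists_mem_boundedLength (splitImage g u ψ) N
    refine ⟨∑ k ∈ Finset.range (n + N), ∑ ψ, ρ₀ k ψ, fun k hk ψ =>
      boundedLength_mono ?_ (hρ₀ k ψ)⟩
    exact (Finset.single_le_sum (f := ρ₀ k) (fun _ _ => Nat.zero_le _) (Finset.mem_univ ψ)).trans
      (Finset.single_le_sum (f := fun k => ∑ ψ, ρ₀ k ψ) (fun _ _ => Nat.zero_le _)
        (Finset.mem_range.2 hk))
  -- the number of colours has to exceed `k + l` for all `k < n + N` and `l < ρ + N`; this choice is
  -- not circular since `ρ` does not depend on the number of colours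
  obtain ⟨lam, hlam⟩ := exists_isWeights 𝕜 (n + N + (ρ + N))
  let B : Finset (FibreIndex n) := (Finset.range (n + N) ×ˢ Finset.range (ρ + N)).sigma fun kl =>
    Finset.univ ×ˢ Finset.piAntidiag Finset.univ m ×ˢ lengthBox kl.1 kl.2 ρ
  have hB : ∀ x ∈ B, x ∈ Set.range (FormulaIndex.toFibreIndex : FormulaIndex n m → _) := by
    rintro ⟨⟨k, l⟩, ψ, t, p⟩ hx
    simp only [B, Finset.mem_sigma, Finset.mem_product, Finset.mem_piAntidiag] at hx
    exact exists_toFibreIndex_eq hn hm ψ hx.2.2.1.1 (mem_lengthBox.1 hx.2.2.2).1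
  refine ⟨B.preimage FormulaIndex.toFibreIndex toFibreIndex_injective.injOn, ?_, fun c hc => ?_⟩
  · have h1 : ∑ c ∈ B.preimage FormulaIndex.toFibreIndex toFibreIndex_injective.injOn,
        formulaTerm f g e u (c : FormulaIndex n m) =
        ∑ x ∈ B, formulaSummand f g e u x.2.1 x.2.2.1 x.2.2.2 := by
      simp only [formulaTerm_eq]
      exact Finset.sum_preimage FormulaIndex.toFibreIndex B toFibreIndex_injective.injOn
        (fun x => formulaSummand f g e u x.2.1 x.2.2.1 x.2.2.2)
        fun x hx hx' => absurd (hB x hx) hx'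
    have h2 := map_mem_filt (baseC 𝕜 R (symProj 𝒰₃ m))
      (diamond_sub_sum_avgPsi_mem hf hg hu hlam (ρ := ρ) (N := N) (by omega) hρ)
    have h3 : ∑ kl ∈ Finset.range (n + N) ×ˢ Finset.range (ρ + N), ∑ ψ : Fin n → Fin kl.1,
        (∑ t ∈ Finset.piAntidiag (Finset.univ : Finset (Fin kl.2)) m,
          ∑ p ∈ lengthBox kl.1 kl.2 ρ, formulaSummand f g e u ψ t p -
          fibreSign e ψ • ((kl.1.factorial : 𝕜) * (kl.2.factorial : 𝕜))⁻¹ •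
          baseC 𝕜 R (symProj 𝒰₃ m) (baseC 𝕜 R (mulIter 𝕜 𝒰₃ kl.2) (tensorC (fun _ => f)
            (baseC 𝕜 R (avgPsi 𝒰₂ lam (n + N + (ρ + N)) kl.1 kl.2) (splitImage g u ψ))))) ∈
              filt 𝕜 R (SymAlg 𝒰₃) N := by
      refine Submodule.sum_mem _ fun kl hkl => Submodule.sum_mem _ fun ψ _ => ?_
      rw [Finset.mem_product, Finset.mem_range, Finset.mem_range] at hkl
      exact sum_formulaSummand_sub_mem f g hu m hlam (by omega) ψ (hρ _ hkl.1 ψ)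
    have h4 : comp 𝕜 R 𝒰₁ n m (diamond f g) (incl 𝕜 R (List.ofFn fun p => gen 𝒰₁ (u p)).prod) =
        baseC 𝕜 R (symProj 𝒰₃ m) (diamond f g
          (incl 𝕜 R (List.ofFn fun p => gen 𝒰₁ (u p)).prod)) := by
      rw [comp, LinearMap.comp_apply, LinearMap.comp_apply, baseC_incl, symProj_prod, if_pos rfl]
    rw [h1, h4, Finset.sum_sigma]
    simp only [Finset.sum_product]
    have h5 := Submodule.sub_mem _ h2 h3
    simp only [Finset.sum_sub_distrib, map_sub, map_sum, Finset.sum_product, Units.smul_def,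
      map_zsmul, map_smul_field] at h5
    rwa [sub_sub_sub_cancel_right] at h5
  · rw [formulaTerm_eq]
    refine formulaSummand_mem hf hg hu _ (fun hk => hρ _ hk _) _ c.hjs ?_
    by_contra hcon
    push Not at hcon
    refine hc (Finset.mem_preimage.2 ?_)
    simp only [B, Finset.mem_sigma, Finset.mem_product, Finset.mem_piAntidiag, mem_lengthBox,
      FormulaIndex.toFibreIndex, Finset.mem_range, Finset.mem_univ, true_and, implies_true,
      and_true]
    exact ⟨⟨hcon.1, hcon.2.1⟩, c.ht, c.hjs, hcon.2.2⟩

end ExplicitFormula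

end MVComp

end

theorem mainTheorem7 {𝕜 R : Type*} [Field 𝕜] [CharZero 𝕜]
    [CommRing R] [IsLocalRing R] [IsNoetherianRing R] [Algebra 𝕜 R]
    [IsAdicComplete (IsLocalRing.maximalIdeal R) R]
    (hres : Function.Bijective (algebraMap 𝕜 (IsLocalRing.ResidueField R)))
    {U₁ U₂ U₃ : Type*} [AddCommGroup U₁] [Module 𝕜 U₁] [AddCommGroup U₂] [Module 𝕜 U₂]
    [AddCommGroup U₃] [Module 𝕜 U₃]
    (𝒰₁ : ℤ → Submodule 𝕜 U₁) [DirectSum.Decomposition 𝒰₁]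
    (𝒰₂ : ℤ → Submodule 𝕜 U₂) [DirectSum.Decomposition 𝒰₂]
    (𝒰₃ : ℤ → Submodule 𝕜 U₃) [DirectSum.Decomposition 𝒰₃]
    (g : MVComp.Lin 𝕜 R 𝒰₁ 𝒰₂) (hg : MVComp.IsLin0 g)
    (f : MVComp.Lin 𝕜 R 𝒰₂ 𝒰₃) (hf : MVComp.IsLin0 f) :
    -- the series that define `f ◇ g = log(exp(f) ∘ exp(g))` converge, and it lies in `Lin^0`
    MVComp.LinHasSum (MVComp.expTerm g) (MVComp.convExp g) ∧
    MVComp.LinHasSum (MVComp.expTerm f) (MVComp.convExp f) ∧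
    MVComp.LinHasSum
      (MVComp.logTerm (MVComp.convExp f ∘ₗ MVComp.convExp g - MVComp.convUnit 𝕜 R 𝒰₁ 𝒰₃))
      (MVComp.diamond f g) ∧
    MVComp.IsLin0 (MVComp.diamond f g) ∧
    -- the maps `¹Ψ` are well-defined
    (∀ (k l : ℕ) (j : Fin k → ℕ) (s : Fin l → ℕ), 1 ≤ k → 1 ≤ l → ∑ a, j a = ∑ b, s b →
      MVComp.IsConnPsi 𝒰₂ j s (MVComp.connPsi 𝒰₂ j s) ∧
      ∀ Ψ, MVComp.IsConnPsi 𝒰₂ j s Ψ → Ψ = MVComp.connPsi 𝒰₂ j s) ∧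
    -- the formula for the components of `f ◇ g`
    ∀ (n m : ℕ), 0 < n → 0 < m → ∀ (e : Fin n → ℤ) (u : Fin n → U₁), (∀ p, u p ∈ 𝒰₁ (e p)) →
      MVComp.AdicHasSum
        (fun c : MVComp.FormulaIndex n m => MVComp.formulaTerm f g e u c)
        (MVComp.comp 𝕜 R 𝒰₁ n m (MVComp.diamond f g)
          (MVComp.incl 𝕜 R (List.ofFn fun p => MVComp.gen 𝒰₁ (u p)).prod)) := by
  exact ⟨MVComp.linHasSum_of_convFilt (MVComp.toRing_expTerm_mem hg.map_one),
    MVComp.linHasSum_of_convFilt (MVComp.toRing_expTerm_mem hf.map_one),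
    MVComp.diamond_hasSum hf hg, MVComp.isLin0_diamond hf hg,
    fun k l j s _ _ hjs => ⟨MVComp.isConnPsi_connPsi j s,
      fun Ψ hΨ => hΨ.unique hjs (MVComp.isConnPsi_connPsi j s)⟩,
    fun n m hn hm e u hu => MVComp.adicHasSum_formulaTerm hf hg hn hm hu⟩
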